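/- Let a simple polygon be a closed polygonal curve in the plane $\mathbb{R}^2$ with at least three distinct vertices, in which consecutive edges meet only in their common vertex and non-consecutive edges are disjoint; straight angles at vertices are allowed. A vertex is reflex if the interior angle of the polygon at it is greater than $\pi$. For a finite set $S\subset\mathbb{R}^2$, let the Steiner reflexivity $\rho'(S)$ be the minimum number of reflex vertices of a simple polygon whose vertex set $V$ satisfies $V\supseteq S$ (the points of $V\setminus S$ are called Steiner points). For $n\ge 0$ let $\rho'(n)=\max_{|S|=n}\rho'(S)$, the maximum over all sets $S\subset\mathbb{R}^2$ of exactly $n$ points. Then, for every $n$, both the minimum and the maximum exist, and $$\left\lceil\frac{n-1}{4}\right\rceil-1\;\le\;\rho'(n)\;\le\;\left\lceil\frac{n}{3}\right\rceil .$$ -/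

import Mathlib

open scoped Topology

/-- The Euclidean plane. -/
abbrev Plane : Type := EuclideanSpace ℝ (Fin 2)

/-- A simple polygon with `m + 3` vertices, listed in cyclic order (indices in `Fin (m + 3)` are
added cyclically). The vertices are distinct, consecutive edges meet exactly in their common
vertex, and non-consecutive edges are disjoint. Straight angles at vertices are allowed. -/
structure SimplePolygon where
  m : ℕ
  vertex : Fin (m + 3) → Plane
  vertex_injective : Function.Injective vertex
  consecutive_edges : ∀ i : Fin (m + 3),
    segment ℝ (vertex i) (vertex (i + 1)) ∩ segment ℝ (vertex (i + 1)) (vertex (i + 1 + 1))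
      = {vertex (i + 1)}
  nonconsecutive_edges : ∀ i j : Fin (m + 3), j ≠ i → j ≠ i + 1 → i ≠ j + 1 →
    Disjoint (segment ℝ (vertex i) (vertex (i + 1))) (segment ℝ (vertex j) (vertex (j + 1)))

namespace SimplePolygon

/-- The vertex set of a polygon. -/
def vertexSet (P : SimplePolygon) : Set Plane := Set.range P.vertex

/-- The boundary curve: the union of the edges. -/
def boundary (P : SimplePolygon) : Set Plane :=
  ⋃ i : Fin (P.m + 3), segment ℝ (P.vertex i) (P.vertex (i + 1))

/-- The points enclosed by the polygon: those lying in a bounded connected component of the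
complement of the boundary curve. -/
def inside (P : SimplePolygon) : Set Plane :=
  {x | x ∉ P.boundary ∧ Bornology.IsBounded (connectedComponentIn P.boundaryᶜ x)}

open Classical in
/-- The interior angle at the `i`-th vertex. The two edges at the vertex make an unoriented angle
`∠` in `[0, π]`; the interior angle is `∠` when the polygon, near the vertex, lies within that
angle (equivalently, points close to the vertex in the direction of the midpoint of its two
neighbours are inside), and is `2π - ∠` otherwise. Both values are `π` at a straight angle. -/
noncomputable def interiorAngle (P : SimplePolygon) (i : Fin (P.m + 3)) : ℝ :=
  if ∀ᶠ t : ℝ in 𝓝[>] 0, AffineMap.lineMap (P.vertex i)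
      (midpoint ℝ (P.vertex (i - 1)) (P.vertex (i + 1))) t ∈ P.inside
  then EuclideanGeometry.angle (P.vertex (i - 1)) (P.vertex i) (P.vertex (i + 1))
  else 2 * Real.pi - EuclideanGeometry.angle (P.vertex (i - 1)) (P.vertex i) (P.vertex (i + 1))

/-- A vertex is reflex if its interior angle is greater than `π`. -/
def IsReflex (P : SimplePolygon) (i : Fin (P.m + 3)) : Prop := Real.pi < P.interiorAngle i

/-- The number of reflex vertices. -/
noncomputable def reflexCount (P : SimplePolygon) : ℕ := {i | P.IsReflex i}.ncard

end SimplePolygon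

/-- The numbers of reflex vertices of the simple polygons whose vertex set contains `S`. -/
def steinerReflexCounts (S : Finset Plane) : Set ℕ :=
  {r | ∃ P : SimplePolygon, (S : Set Plane) ⊆ P.vertexSet ∧ P.reflexCount = r}

/-- The Steiner reflexivity of `S`: the minimum number of reflex vertices of a simple polygon whose
vertex set contains `S`. -/
noncomputable def steinerReflexivity (S : Finset Plane) : ℕ := sInf (steinerReflexCounts S)

/-- The Steiner reflexivities of the `n`-point sets. -/
def steinerReflexivities (n : ℕ) : Set ℕ :=
  {r | ∃ S : Finset Plane, S.card = n ∧ steinerReflexivity S = r}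

/-- The worst-case Steiner reflexivity: the maximum over all `n`-point sets. -/
noncomputable def worstSteinerReflexivity (n : ℕ) : ℕ := sSup (steinerReflexivities n)

/-! Lower bound. The inside of a polygon with `r` reflex vertices can be cut into at most `r + 1`
convex open pieces. At each reflex vertex one edge is extended into the inside until it leaves the
current open set; the cut repairs the failure of local convexity at that vertex and adds at most one
component (`IsCutting.step`, `components_cut`). A local-to-global principle then makes the
components convex (`convex_connectedComponentIn`). The pieces avoid the boundary, so no vertex lies
in a piece, yet every vertex lies in the closure of one (`SimplePolygon.exists_convex_pieces`). Now
take `k + 1` tight pairs on the concave parabola `y = -x²`, a point just below the chord of each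
pair, and a deeper point below each pair except the first and the last: `4 k + 2` points. Any three
of the `2 k + 2` points on the parabola span a triangle with one of the other points in its interior
(`exists_belowPt_mem`). With fewer than `k` reflex vertices there are at most `k` pieces, so some
piece has three points of the parabola in its closure and hence contains a point of the set, which
is impossible for a vertex.

Upper bound. Order the points by a generic linear coordinate and split them into consecutive groups
of at most three. Each group turns weakly right (a cap) or weakly left (a cup). One monotone path
visits the caps and drops into a deep valley before each; another visits the cups and rises to a
high peak before each. Only near its own groups does a path enter the strip of heights of the given
points, so the two paths are disjoint. Joined at their left ends and closed by an apex far to the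
left, they form a polygon whose inside is below the path of the caps and above the path of the cups.
Only the valleys and peaks can be reflex, one for each group (`exists_simplePolygon_of_fits`).

Both arguments translate turns of the boundary into reflex vertices, which are defined through the
inside. This needs the Jordan curve theorem for polygons. A component of the complement that
occupies one side of the boundary somewhere occupies that side all the way round
(`SimplePolygon.VertexSide.all`), so there are at most two components; the parity of crossings shows
that there are at least two (`SimplePolygon.exists_comp_ne`); and exactly one is bounded. The
outcome is `SimplePolygon.exists_inside_side` and `SimplePolygon.isReflex_iff`. -/

/-- The cross product of two vectors of the plane. -/
def wedge (u v : Plane) : ℝ := u 0 * v 1 - u 1 * v 0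

/-- Rotation by a right angle. -/
noncomputable def quarterTurn (u : Plane) : Plane := !₂[-u 1, u 0]

/-! ### Algebra of the cross product and half-planes -/

section wedge

theorem wedge_add_right (a u v : Plane) : wedge a (u + v) = wedge a u + wedge a v := by
  simp only [wedge, PiLp.add_apply]; ring

theorem wedge_sub_right (a u v : Plane) : wedge a (u - v) = wedge a u - wedge a v := by
  simp only [wedge, PiLp.sub_apply]; ring

theorem wedge_smul_right (a u : Plane) (s : ℝ) : wedge a (s • u) = s * wedge a u := by
  simp only [wedge, PiLp.smul_apply, smul_eq_mul]; ring

theorem wedge_sub_left (u v a : Plane) : wedge (u - v) a = wedge u a - wedge v a := by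
  simp only [wedge, PiLp.sub_apply]; ring

theorem wedge_smul_left (u a : Plane) (s : ℝ) : wedge (s • u) a = s * wedge u a := by
  simp only [wedge, PiLp.smul_apply, smul_eq_mul]; ring

theorem wedge_neg_right (a u : Plane) : wedge a (-u) = -wedge a u := by
  simp only [wedge, PiLp.neg_apply]; ring

theorem wedge_neg_left (a u : Plane) : wedge (-a) u = -wedge a u := by
  simp only [wedge, PiLp.neg_apply]; ring

theorem wedge_self (a : Plane) : wedge a a = 0 := by simp only [wedge]; ring

theorem wedge_zero_right (a : Plane) : wedge a 0 = 0 := by simp [wedge]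

theorem wedge_swap (a b : Plane) : wedge a b = -wedge b a := by simp only [wedge]; ring

theorem plane_ext {u v : Plane} (h0 : u 0 = v 0) (h1 : u 1 = v 1) : u = v := by
  ext i; fin_cases i <;> assumption

theorem wedge_quarterTurn_pos {a : Plane} (ha : a ≠ 0) : 0 < wedge a (quarterTurn a) := by
  have h : a 0 ≠ 0 ∨ a 1 ≠ 0 := by
    by_contra! h
    exact ha (plane_ext (by simpa using h.1) (by simpa using h.2))
  simp only [wedge, quarterTurn]
  rcases h with h | h
  · have := sq_pos_of_ne_zero h
    have := sq_nonneg (a 1)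
    simp; nlinarith
  · have := sq_pos_of_ne_zero h
    have := sq_nonneg (a 0)
    simp; nlinarith

theorem exists_smul_of_wedge_eq_zero {a u : Plane} (ha : a ≠ 0) (h : wedge a u = 0) :
    ∃ s : ℝ, u = s • a := by
  simp only [wedge] at h
  by_cases h0 : a 0 = 0
  · have h1 : a 1 ≠ 0 := fun h1 => ha (plane_ext (by simpa using h0) (by simpa using h1))
    refine ⟨u 1 / a 1, plane_ext ?_ ?_⟩
    · simp only [PiLp.smul_apply, smul_eq_mul]
      rw [h0] at h ⊢
      have : a 1 * u 0 = 0 := by linarith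
      rcases mul_eq_zero.1 this with h | h
      · exact absurd h h1
      · simp [h]
    · simp only [PiLp.smul_apply, smul_eq_mul]; field_simp
  · refine ⟨u 0 / a 0, plane_ext ?_ ?_⟩
    · simp only [PiLp.smul_apply, smul_eq_mul]; field_simp
    · simp only [PiLp.smul_apply, smul_eq_mul]; field_simp; linarith

theorem continuous_wedge (a : Plane) : Continuous fun u => wedge a u := by
  unfold wedge; fun_prop

theorem continuous_wedge_sub (a w : Plane) : Continuous fun u => wedge a (u - w) := by
  unfold wedge; fun_prop

theorem tendsto_add_smul (w u : Plane) :
    Filter.Tendsto (fun t : ℝ => w + t • u) (𝓝[>] 0) (𝓝 w) := by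
  have : Continuous (fun t : ℝ => w + t • u) := by fun_prop
  have := this.tendsto 0
  simp only [zero_smul, add_zero] at this
  exact this.mono_left nhdsWithin_le_nhds

theorem convex_wedge_pos (σ : ℝ) (a w : Plane) : Convex ℝ {x | 0 < σ * wedge a (x - w)} := by
  intro x hx y hy s t hs ht hst
  simp only [Set.mem_ofPred_eq] at *
  have : s • x + t • y - w = s • (x - w) + t • (y - w) := by
    have : w = (s + t) • w := by rw [hst, one_smul]
    nth_rewrite 1 [this]
    module
  rw [this, wedge_add_right, wedge_smul_right, wedge_smul_right]
  rcases eq_or_lt_of_le hs with h | h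
  · have : t = 1 := by linarith
    subst this; rw [← h]; linarith
  · nlinarith [mul_pos h hx, mul_nonneg ht hy.le]

end wedge

/-! ### The two sides of a corner -/

/-- The directions on the side `σ` of a corner with incoming direction `a` and outgoing
direction `b`. -/
def sector (σ : ℝ) (a b : Plane) : Set Plane :=
  {u | (0 < σ * wedge a u ∧ 0 < σ * wedge b u) ∨
    (σ * wedge a b ≤ 0 ∧ (0 < σ * wedge a u ∨ 0 < σ * wedge b u))}

/-- Near `w`, the set `B` consists of two rays, in the directions `-a` and `b`. -/
structure IsTwoRayCorner (B : Set Plane) (w a b : Plane) : Prop where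
  left_ne : a ≠ 0
  right_ne : b ≠ 0
  -- Excludes a corner that folds back on itself, for which the sign of `wedge a b` would not tell
  -- the two sectors apart.
  straight : wedge a b = 0 → ∃ s : ℝ, 0 < s ∧ b = s • a
  mem_iff : ∀ᶠ x in 𝓝 w, x ∈ B ↔ (∃ s : ℝ, 0 ≤ s ∧ x - w = -(s • a)) ∨ ∃ s : ℝ, 0 ≤ s ∧ x - w = s • b

namespace IsTwoRayCorner

variable {B : Set Plane} {w a b : Plane}

theorem exists_common (h : IsTwoRayCorner B w a b) {σ : ℝ} (hσ : σ ≠ 0) :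
    ∃ u, 0 < σ * wedge a u ∧ 0 < σ * wedge b u := by
  have h2 : 0 < σ * σ := mul_self_pos.2 hσ
  by_cases hc : wedge a b = 0
  · obtain ⟨s, hs, rfl⟩ := h.straight hc
    have := wedge_quarterTurn_pos h.left_ne
    refine ⟨σ • quarterTurn a, ?_, ?_⟩
    · rw [wedge_smul_right]; nlinarith [mul_pos h2 this]
    · rw [wedge_smul_right, wedge_smul_left]
      nlinarith [mul_pos (mul_pos h2 this) hs]
  · have h3 : 0 < wedge a b * wedge a b := mul_self_pos.2 hc
    -- Both `a` and `b` have cross product `wedge a b` with `b - a`, so the factor makes both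
    -- quantities `(σ * wedge a b) ^ 2`.
    refine ⟨(σ * wedge a b) • (b - a), ?_, ?_⟩
    · rw [wedge_smul_right, wedge_sub_right, wedge_self]
      nlinarith [mul_pos h2 h3]
    · rw [wedge_smul_right, wedge_sub_right, wedge_self, wedge_swap b a]
      nlinarith [mul_pos h2 h3]

theorem sector_not_mem {σ : ℝ} {u : Plane} (hu : u ∈ sector σ a b) :
    ¬ ((∃ s : ℝ, 0 ≤ s ∧ u = -(s • a)) ∨ ∃ s : ℝ, 0 ≤ s ∧ u = s • b) := by
  rintro (⟨s, hs, rfl⟩ | ⟨s, hs, rfl⟩)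
  · simp only [sector, Set.mem_ofPred_eq, wedge_neg_right, wedge_smul_right, wedge_self,
      wedge_swap b a] at hu
    rcases hu with hu | ⟨h1, hu | hu⟩
    · simp at hu
    · simp at hu
    · nlinarith
  · simp only [sector, Set.mem_ofPred_eq, wedge_smul_right, wedge_self] at hu
    rcases hu with hu | ⟨h1, hu | hu⟩
    · simp at hu
    · nlinarith
    · simp at hu

theorem mem_sector_or (h : IsTwoRayCorner B w a b) {σ : ℝ} (hσ : σ ≠ 0) {u : Plane}
    (hu : ¬ ((∃ s : ℝ, 0 ≤ s ∧ u = -(s • a)) ∨ ∃ s : ℝ, 0 ≤ s ∧ u = s • b)) :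
    u ∈ sector σ a b ∨ u ∈ sector (-σ) a b := by
  have h2 : 0 < σ * σ := mul_self_pos.2 hσ
  wlog hc : 0 ≤ σ * wedge a b generalizing σ
  · have := this (σ := -σ) (by simpa using hσ) (by nlinarith) (by nlinarith)
    rw [neg_neg] at this
    exact this.symm
  by_contra! hn
  simp only [sector, Set.mem_ofPred_eq, not_or, not_and, neg_mul, not_lt] at hn
  obtain ⟨⟨h3, h4⟩, h5, h6⟩ := hn
  have h7 := h6 (by linarith)
  apply hu
  by_cases ha : wedge a u = 0
  · obtain ⟨s, rfl⟩ := exists_smul_of_wedge_eq_zero h.left_ne ha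
    rcases le_or_gt s 0 with hs | hs
    · exact Or.inl ⟨-s, by linarith, by simp⟩
    · right
      rw [wedge_smul_right, wedge_smul_right, wedge_swap b a] at h7
      have : wedge a b = 0 := by
        by_contra hab
        have : 0 < σ * wedge a b := lt_of_le_of_ne hc (by positivity)
        nlinarith [h7.2, mul_pos hs this]
      obtain ⟨r, hr, rfl⟩ := h.straight this
      exact ⟨s / r, by positivity, by rw [smul_smul]; congr 1; field_simp⟩
  · have ha' : 0 < σ * wedge a u := lt_of_le_of_ne (by linarith [h7.1]) (by positivity)
    have hb : wedge b u = 0 := by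
      have h8 := h3 ha'
      have h9 : σ * wedge b u = 0 := by linarith [h7.2]
      simpa [hσ] using h9
    obtain ⟨s, rfl⟩ := exists_smul_of_wedge_eq_zero h.right_ne hb
    rcases le_or_gt 0 s with hs | hs
    · exact Or.inr ⟨s, hs, rfl⟩
    · rw [wedge_smul_right] at ha'
      nlinarith

/-- Within a disc a sector is an intersection of two half-discs, hence convex, or a union of two
half-discs, which have a point in common by `exists_common`. -/
theorem isPreconnected_sector (h : IsTwoRayCorner B w a b) {σ : ℝ} (hσ : σ ≠ 0) {ε : ℝ} (hε : 0 < ε) :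
    IsPreconnected (Metric.ball w ε ∩ {x | x - w ∈ sector σ a b}) := by
  have hA := (convex_ball w ε).inter (convex_wedge_pos σ a w)
  have hB := (convex_ball w ε).inter (convex_wedge_pos σ b w)
  rcases le_or_gt (σ * wedge a b) 0 with hc | hc
  · obtain ⟨u, hu1, hu2⟩ := h.exists_common hσ
    have ht : ∃ t : ℝ, 0 < t ∧ w + t • u ∈ Metric.ball w ε := by
      exact ((Filter.eventually_mem_set.2 self_mem_nhdsWithin).and
        ((tendsto_add_smul w u).eventually (Metric.ball_mem_nhds w hε))).exists
    obtain ⟨t, ht, htb⟩ := ht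
    have hp := IsPreconnected.union (w + t • u) (s := Metric.ball w ε ∩ {x | 0 < σ * wedge a (x - w)})
      (t := Metric.ball w ε ∩ {x | 0 < σ * wedge b (x - w)}) ⟨htb, by
        simp only [Set.mem_ofPred_eq, add_sub_cancel_left, wedge_smul_right]
        nlinarith [mul_pos ht hu1]⟩ ⟨htb, by
        simp only [Set.mem_ofPred_eq, add_sub_cancel_left, wedge_smul_right]
        nlinarith [mul_pos ht hu2]⟩ hA.isPreconnected hB.isPreconnected
    convert hp using 1
    rw [← Set.inter_union_distrib_left]
    congr 1
    ext x
    simp only [sector, Set.mem_ofPred_eq, Set.mem_union]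
    tauto
  · convert (hA.inter hB).isPreconnected using 1
    ext x
    simp only [sector, Set.mem_ofPred_eq, Set.mem_inter_iff]
    have := hc.not_ge
    tauto

theorem eventually_not_mem (h : IsTwoRayCorner B w a b) (σ : ℝ) :
    ∀ᶠ x in 𝓝 w, x - w ∈ sector σ a b → x ∉ B := by
  filter_upwards [h.mem_iff] with x hx hs hB
  exact sector_not_mem hs (hx.1 hB)

theorem eventually_mem_sector (h : IsTwoRayCorner B w a b) {σ : ℝ} (hσ : σ ≠ 0) :
    ∀ᶠ x in 𝓝 w, x ∉ B → x - w ∈ sector σ a b ∨ x - w ∈ sector (-σ) a b := by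
  filter_upwards [h.mem_iff] with x hx hB
  exact h.mem_sector_or hσ (fun h => hB (hx.2 h))

theorem frequently_sector (h : IsTwoRayCorner B w a b) {σ : ℝ} (hσ : σ ≠ 0) :
    ∃ᶠ x in 𝓝 w, x - w ∈ sector σ a b := by
  obtain ⟨u, hu1, hu2⟩ := h.exists_common hσ
  refine (tendsto_add_smul w u).frequently (Filter.Eventually.frequently ?_)
  filter_upwards [self_mem_nhdsWithin] with t ht
  have ht : 0 < t := ht
  left
  simp only [add_sub_cancel_left, wedge_smul_right]
  constructor <;> nlinarith [mul_pos ht hu1, mul_pos ht hu2]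

/-- If a component of `Bᶜ` has points in a sector of a corner, arbitrarily close to the vertex,
then it contains the sector near the vertex. -/
theorem eventually_mem_component (h : IsTwoRayCorner B w a b) {σ : ℝ} (hσ : σ ≠ 0) {y : Plane}
    (hK : ∃ᶠ x in 𝓝 w, x - w ∈ sector σ a b ∧ x ∈ connectedComponentIn Bᶜ y) :
    ∀ᶠ x in 𝓝 w, x - w ∈ sector σ a b → x ∈ connectedComponentIn Bᶜ y := by
  obtain ⟨ε, hε, hball⟩ := Metric.eventually_nhds_iff_ball.1 (h.eventually_not_mem σ)
  obtain ⟨x, ⟨hxs, hxK⟩, hxb⟩ := (hK.and_eventually (Metric.ball_mem_nhds w hε)).exists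
  filter_upwards [Metric.ball_mem_nhds w hε] with z hz hzs
  have hp := h.isPreconnected_sector hσ hε
  rw [connectedComponentIn_eq hxK]
  exact hp.subset_connectedComponentIn ⟨hxb, hxs⟩ (fun z hz => hball z hz.1 hz.2) ⟨hz, hzs⟩

theorem exists_component (h : IsTwoRayCorner B w a b) {σ : ℝ} (hσ : σ ≠ 0) :
    ∃ y ∉ B, ∀ᶠ x in 𝓝 w, x - w ∈ sector σ a b → x ∈ connectedComponentIn Bᶜ y := by
  obtain ⟨ε, hε, hball⟩ := Metric.eventually_nhds_iff_ball.1 (h.eventually_not_mem σ)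
  obtain ⟨y, hys, hyb⟩ := ((h.frequently_sector hσ).and_eventually
    (Metric.ball_mem_nhds w hε)).exists
  refine ⟨y, hball y hyb hys, ?_⟩
  filter_upwards [Metric.ball_mem_nhds w hε] with z hz hzs
  exact (h.isPreconnected_sector hσ hε).subset_connectedComponentIn ⟨hyb, hys⟩
    (fun z hz => hball z hz.1 hz.2) ⟨hz, hzs⟩

end IsTwoRayCorner

/-- A component on one side of a line at a point of a segment of the line is on that side at the
other points of the segment. -/
theorem frequently_side_of_segment {O W : Set Plane} (hO : IsOpen O) {q q' d : Plane}
    (hd : d ≠ 0) (hqq : segment ℝ q q' ⊆ O) {c : ℝ} (hc : q' - q = c • d) {σ : ℝ} (hσ : σ ≠ 0)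
    (hW : ∀ x ∈ O, 0 < σ * wedge d (x - q) → x ∈ W) {y : Plane}
    (hK : ∀ᶠ x in 𝓝 q, 0 < σ * wedge d (x - q) → x ∈ connectedComponentIn W y) :
    ∃ᶠ x in 𝓝 q', 0 < σ * wedge d (x - q') ∧ x ∈ connectedComponentIn W y := by
  have hcompact : IsCompact (segment ℝ q q') := by
    rw [← convexHull_pair]
    exact (Set.toFinite ({q, q'} : Set Plane)).isCompact_convexHull ℝ
  -- By compactness a slightly translated copy of the whole segment stays in `O`; this copy joins
  -- the two ends on the chosen side.
  obtain ⟨ε, hε, hεO⟩ := hcompact.exists_thickening_subset_open hO hqq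
  set u : Plane := σ • quarterTurn d with hu
  have hσ2 : 0 < σ * σ := mul_self_pos.2 hσ
  have hcu : 0 < σ * wedge d u := by
    rw [hu, wedge_smul_right]
    nlinarith [mul_pos hσ2 (wedge_quarterTurn_pos hd)]
  refine (tendsto_add_smul q' u).frequently (Filter.Eventually.frequently ?_)
  have hsmall : ∀ᶠ t : ℝ in 𝓝[>] 0, ‖t • u‖ < ε := by
    have : Filter.Tendsto (fun t : ℝ => ‖t • u‖) (𝓝[>] 0) (𝓝 0) := by
      have : Continuous (fun t : ℝ => ‖t • u‖) := by fun_prop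
      have := this.tendsto 0
      simp only [zero_smul, norm_zero] at this
      exact this.mono_left nhdsWithin_le_nhds
    exact this.eventually_lt_const hε
  filter_upwards [self_mem_nhdsWithin, hsmall, (tendsto_add_smul q u).eventually hK] with t ht hts hqt
  have ht : 0 < t := ht
  have hpos : 0 < σ * wedge d (t • u) := by
    rw [wedge_smul_right]; nlinarith [mul_pos ht hcu]
  refine ⟨by rwa [add_sub_cancel_left], ?_⟩
  have hq1 := hqt (by rwa [add_sub_cancel_left])
  rw [connectedComponentIn_eq hq1]
  refine (convex_segment (q + t • u) (q' + t • u)).isPreconnected.subset_connectedComponentIn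
    (left_mem_segment ℝ _ _) ?_ (right_mem_segment ℝ _ _)
  rintro z ⟨α, β, hα, hβ, hαβ, rfl⟩
  have hz : α • (q + t • u) + β • (q' + t • u) = (α • q + β • q') + t • u := by
    have : t • u = (α + β) • (t • u) := by rw [hαβ, one_smul]
    nth_rewrite 3 [this]
    module
  rw [hz]
  apply hW
  · apply hεO
    rw [Metric.mem_thickening_iff]
    exact ⟨_, ⟨α, β, hα, hβ, hαβ, rfl⟩, by simpa [dist_eq_norm] using hts⟩
  · have : α • q + β • q' + t • u - q = (β * c) • d + t • u := by
      have h1 : q' = q + c • d := by rw [← hc]; abel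
      have h2 : α = 1 - β := by linarith
      rw [h1, h2]; module
    rw [this, wedge_add_right, wedge_smul_right d d, wedge_self]
    simpa using hpos

theorem mem_sector_self {σ : ℝ} {a u : Plane} : u ∈ sector σ a a ↔ 0 < σ * wedge a u := by
  simp [sector, wedge_self]

theorem eventually_wedge_pos {σ : ℝ} {a w q : Plane} (h : 0 < σ * wedge a (q - w)) :
    ∀ᶠ x in 𝓝 q, 0 < σ * wedge a (x - w) := by
  have : Continuous fun x => σ * wedge a (x - w) := continuous_const.mul (continuous_wedge_sub a w)
  exact this.continuousAt.eventually_const_lt h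

/-- Near one of its inner points, a segment is a line. -/
theorem eventually_mem_segment_iff {p p' q : Plane} (hp : p ≠ p')
    (hq : q ∈ openSegment ℝ p p') : ∀ᶠ x in 𝓝 q, x ∈ segment ℝ p p' ↔
      (∃ s : ℝ, 0 ≤ s ∧ x - q = -(s • (p' - p))) ∨ ∃ s : ℝ, 0 ≤ s ∧ x - q = s • (p' - p) := by
  rw [openSegment_eq_image'] at hq
  obtain ⟨t, ⟨ht0, ht1⟩, rfl⟩ := hq
  have hpos : 0 < ‖p' - p‖ := norm_pos_iff.2 (sub_ne_zero.2 hp.symm)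
  filter_upwards [Metric.ball_mem_nhds _ (mul_pos hpos ht0),
    Metric.ball_mem_nhds _ (mul_pos hpos (sub_pos.2 ht1))] with x h1 h2
  rw [segment_eq_image']
  constructor
  · rintro ⟨s, ⟨h0, h1⟩, rfl⟩
    rcases le_total s t with hst | hst
    · exact Or.inl ⟨t - s, by linarith, by module⟩
    · exact Or.inr ⟨s - t, by linarith, by module⟩
  · rintro (⟨s, h0, hs⟩ | ⟨s, h0, hs⟩)
    · rw [mem_ball_iff_norm, hs, norm_neg, norm_smul, Real.norm_eq_abs, abs_of_nonneg h0] at h1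
      have : s < t := by nlinarith
      refine ⟨t - s, ⟨by linarith, by linarith⟩, ?_⟩
      rw [sub_eq_iff_eq_add'.1 hs]; module
    · rw [mem_ball_iff_norm, hs, norm_smul, Real.norm_eq_abs, abs_of_nonneg h0] at h2
      have : s < 1 - t := by nlinarith
      refine ⟨t + s, ⟨by linarith, by linarith⟩, ?_⟩
      rw [sub_eq_iff_eq_add'.1 hs]; module

/-! ### Following one side of the boundary around the polygon -/

namespace SimplePolygon

variable (P : SimplePolygon)

/-- The `i`-th edge, as a vector. -/
def edgeVec (i : Fin (P.m + 3)) : Plane := P.vertex (i + 1) - P.vertex i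

/-- The `i`-th edge, as a set. -/
def edge (i : Fin (P.m + 3)) : Set Plane := segment ℝ (P.vertex i) (P.vertex (i + 1))

theorem mem_boundary {x : Plane} : x ∈ P.boundary ↔ ∃ i, x ∈ P.edge i := by
  simp [boundary, edge]

theorem succ_ne (i : Fin (P.m + 3)) : i + 1 ≠ i := by
  simp

theorem edgeVec_ne (i : Fin (P.m + 3)) : P.edgeVec i ≠ 0 := fun h =>
  P.succ_ne i (P.vertex_injective (sub_eq_zero.1 h))

theorem mem_edge {i : Fin (P.m + 3)} {x : Plane} :
    x ∈ P.edge i ↔ ∃ s : ℝ, 0 ≤ s ∧ s ≤ 1 ∧ x = P.vertex i + s • P.edgeVec i := by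
  rw [edge, segment_eq_image']
  constructor
  · rintro ⟨s, ⟨h0, h1⟩, rfl⟩; exact ⟨s, h0, h1, rfl⟩
  · rintro ⟨s, h0, h1, rfl⟩; exact ⟨s, ⟨h0, h1⟩, rfl⟩

theorem mem_edge' {i : Fin (P.m + 3)} {x : Plane} :
    x ∈ P.edge i ↔ ∃ s : ℝ, 0 ≤ s ∧ s ≤ 1 ∧ x = P.vertex (i + 1) - s • P.edgeVec i := by
  rw [mem_edge]
  constructor
  · rintro ⟨s, h0, h1, rfl⟩
    exact ⟨1 - s, by linarith, by linarith, by simp only [edgeVec]; module⟩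
  · rintro ⟨s, h0, h1, rfl⟩
    exact ⟨1 - s, by linarith, by linarith, by simp only [edgeVec]; module⟩

theorem wedge_edgeVec_of_mem {i : Fin (P.m + 3)} {x q : Plane} (hx : x ∈ P.edge i)
    (hq : q ∈ P.edge i) : wedge (P.edgeVec i) (x - q) = 0 := by
  obtain ⟨s, -, -, rfl⟩ := P.mem_edge.1 hx
  obtain ⟨t, -, -, rfl⟩ := P.mem_edge.1 hq
  have : P.vertex i + s • P.edgeVec i - (P.vertex i + t • P.edgeVec i) = (s - t) • P.edgeVec i := by
    module
  rw [this, wedge_smul_right, wedge_self, mul_zero]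

theorem isClosed_edge (i : Fin (P.m + 3)) : IsClosed (P.edge i) := by
  rw [edge, ← convexHull_pair]
  exact (Set.toFinite _).isClosed_convexHull ℝ

theorem isCompact_edge (i : Fin (P.m + 3)) : IsCompact (P.edge i) := by
  rw [edge, ← convexHull_pair]
  exact (Set.toFinite _).isCompact_convexHull ℝ

theorem isCompact_boundary : IsCompact P.boundary := isCompact_iUnion P.isCompact_edge

theorem isOpen_compl_boundary : IsOpen P.boundaryᶜ := P.isCompact_boundary.isClosed.isOpen_compl

theorem vertex_mem_edge (i : Fin (P.m + 3)) : P.vertex i ∈ P.edge i := left_mem_segment ℝ _ _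

theorem vertex_succ_mem_edge (i : Fin (P.m + 3)) : P.vertex (i + 1) ∈ P.edge i :=
  right_mem_segment ℝ _ _

theorem vertex_mem_boundary (i : Fin (P.m + 3)) : P.vertex i ∈ P.boundary :=
  P.mem_boundary.2 ⟨i, P.vertex_mem_edge i⟩

theorem edge_inter_succ {i : Fin (P.m + 3)} {x : Plane} (h1 : x ∈ P.edge i)
    (h2 : x ∈ P.edge (i + 1)) : x = P.vertex (i + 1) := by
  have : x ∈ P.edge i ∩ P.edge (i + 1) := ⟨h1, h2⟩
  rw [edge, edge, P.consecutive_edges i] at this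
  exact this

theorem vertex_mem_edge_iff {i j : Fin (P.m + 3)} (h : P.vertex (i + 1) ∈ P.edge j) :
    j = i ∨ j = i + 1 := by
  by_contra! hn
  by_cases hij : i = j + 1
  · subst hij
    exact P.succ_ne _ (P.vertex_injective (P.edge_inter_succ h (P.vertex_succ_mem_edge _)))
  · exact Set.disjoint_left.1 (P.nonconsecutive_edges i j hn.1 hn.2 hij)
      (P.vertex_succ_mem_edge i) h

theorem openSegment_subset_edge (i : Fin (P.m + 3)) :
    openSegment ℝ (P.vertex i) (P.vertex (i + 1)) ⊆ P.edge i := openSegment_subset_segment ℝ _ _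

theorem vertex_ne_succ (i : Fin (P.m + 3)) : P.vertex i ≠ P.vertex (i + 1) := fun h =>
  P.succ_ne i (P.vertex_injective h).symm

theorem ne_of_mem_openSegment {i : Fin (P.m + 3)} {q : Plane}
    (hq : q ∈ openSegment ℝ (P.vertex i) (P.vertex (i + 1))) :
    q ≠ P.vertex i ∧ q ≠ P.vertex (i + 1) := by
  constructor
  · rintro rfl
    exact P.vertex_ne_succ i (left_mem_openSegment_iff.1 hq)
  · rintro rfl
    exact P.vertex_ne_succ i (right_mem_openSegment_iff.1 hq)

theorem eq_of_mem_openSegment {i j : Fin (P.m + 3)} {q : Plane}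
    (hq : q ∈ openSegment ℝ (P.vertex i) (P.vertex (i + 1))) (hj : q ∈ P.edge j) : j = i := by
  by_contra hn
  have hqi := P.openSegment_subset_edge i hq
  obtain ⟨h1, h2⟩ := P.ne_of_mem_openSegment hq
  by_cases hji : j = i + 1
  · subst hji
    exact h2 (P.edge_inter_succ hqi hj)
  by_cases hij : i = j + 1
  · subst hij
    exact h1 (P.edge_inter_succ hj hqi)
  · exact Set.disjoint_left.1 (P.nonconsecutive_edges i j hn hji hij) hqi hj

theorem mem_openSegment_of_mem_edge {i : Fin (P.m + 3)} {q : Plane} (hq : q ∈ P.edge i)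
    (h1 : q ≠ P.vertex i) (h2 : q ≠ P.vertex (i + 1)) :
    q ∈ openSegment ℝ (P.vertex i) (P.vertex (i + 1)) :=
  mem_openSegment_of_ne_left_right h1.symm h2.symm hq

theorem eventually_edge (w : Plane) : ∀ᶠ x in 𝓝 w, ∀ j, x ∈ P.edge j → w ∈ P.edge j := by
  rw [Filter.eventually_all]
  intro j
  by_cases hw : w ∈ P.edge j
  · simp [hw]
  · filter_upwards [(P.isClosed_edge j).isOpen_compl.mem_nhds hw] with x hx hxj
    exact absurd hxj hx

theorem eventually_mem_edge_left (i : Fin (P.m + 3)) : ∀ᶠ x in 𝓝 (P.vertex (i + 1)),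
    x ∈ P.edge i ↔ ∃ s : ℝ, 0 ≤ s ∧ x - P.vertex (i + 1) = -(s • P.edgeVec i) := by
  have hpos : 0 < ‖P.edgeVec i‖ := norm_pos_iff.2 (P.edgeVec_ne i)
  filter_upwards [Metric.ball_mem_nhds _ hpos] with x hx
  rw [mem_edge']
  constructor
  · rintro ⟨s, h0, -, rfl⟩; exact ⟨s, h0, by module⟩
  · rintro ⟨s, h0, hs⟩
    refine ⟨s, h0, ?_, by rw [sub_eq_iff_eq_add'.1 hs]; module⟩
    rw [mem_ball_iff_norm, hs, norm_neg, norm_smul, Real.norm_eq_abs, abs_of_nonneg h0] at hx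
    nlinarith

theorem eventually_mem_edge_right (i : Fin (P.m + 3)) : ∀ᶠ x in 𝓝 (P.vertex i),
    x ∈ P.edge i ↔ ∃ s : ℝ, 0 ≤ s ∧ x - P.vertex i = s • P.edgeVec i := by
  have hpos : 0 < ‖P.edgeVec i‖ := norm_pos_iff.2 (P.edgeVec_ne i)
  filter_upwards [Metric.ball_mem_nhds _ hpos] with x hx
  rw [mem_edge]
  constructor
  · rintro ⟨s, h0, -, rfl⟩; exact ⟨s, h0, by module⟩
  · rintro ⟨s, h0, hs⟩
    refine ⟨s, h0, ?_, sub_eq_iff_eq_add'.1 hs⟩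
    rw [mem_ball_iff_norm, hs, norm_smul, Real.norm_eq_abs, abs_of_nonneg h0] at hx
    nlinarith

theorem exists_pos_smul_of_wedge_eq_zero {i : Fin (P.m + 3)}
    (h : wedge (P.edgeVec i) (P.edgeVec (i + 1)) = 0) :
    ∃ s : ℝ, 0 < s ∧ P.edgeVec (i + 1) = s • P.edgeVec i := by
  obtain ⟨s, hs⟩ := exists_smul_of_wedge_eq_zero (P.edgeVec_ne i) h
  refine ⟨s, ?_, hs⟩
  by_contra! h0
  have hpos : 0 < 1 - s := by linarith
  -- If the second edge ran back along the first, this point would lie on both edges. The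
  -- denominator `1 - s` keeps both parameters, `1 / (1 - s)` and `-s / (1 - s)`, within `[0, 1]`.
  have h1 : P.vertex (i + 1) + (1 / (1 - s)) • P.edgeVec (i + 1) ∈ P.edge (i + 1) :=
    P.mem_edge.2 ⟨_, by positivity, by rw [div_le_one hpos]; linarith, rfl⟩
  have h2 : P.vertex (i + 1) + (1 / (1 - s)) • P.edgeVec (i + 1) ∈ P.edge i :=
    P.mem_edge'.2 ⟨-s / (1 - s), div_nonneg (by linarith) hpos.le,
      by rw [div_le_one hpos]; linarith, by
        rw [hs, smul_smul, sub_eq_add_neg (P.vertex (i + 1)), ← neg_smul]; congr 2; ring⟩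
  have h3 := P.edge_inter_succ h2 h1
  rw [add_eq_left, smul_eq_zero] at h3
  rcases h3 with h3 | h3
  · rw [one_div, inv_eq_zero] at h3; linarith
  · exact P.edgeVec_ne _ h3

theorem isTwoRayCorner_vertex (i : Fin (P.m + 3)) :
    IsTwoRayCorner P.boundary (P.vertex (i + 1)) (P.edgeVec i) (P.edgeVec (i + 1)) where
  left_ne := P.edgeVec_ne i
  right_ne := P.edgeVec_ne (i + 1)
  straight := P.exists_pos_smul_of_wedge_eq_zero
  mem_iff := by
    filter_upwards [P.eventually_mem_edge_left i, P.eventually_mem_edge_right (i + 1),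
      P.eventually_edge (P.vertex (i + 1))] with x h1 h2 h3
    rw [← h1, ← h2, mem_boundary]
    constructor
    · rintro ⟨j, hj⟩
      rcases P.vertex_mem_edge_iff (h3 j hj) with rfl | rfl
      · exact Or.inl hj
      · exact Or.inr hj
    · rintro (h | h)
      · exact ⟨_, h⟩
      · exact ⟨_, h⟩

theorem isTwoRayCorner_edge {i : Fin (P.m + 3)} {q : Plane}
    (hq : q ∈ openSegment ℝ (P.vertex i) (P.vertex (i + 1))) :
    IsTwoRayCorner P.boundary q (P.edgeVec i) (P.edgeVec i) where
  left_ne := P.edgeVec_ne i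
  right_ne := P.edgeVec_ne i
  straight := fun _ => ⟨1, one_pos, (one_smul _ _).symm⟩
  mem_iff := by
    filter_upwards [eventually_mem_segment_iff (P.vertex_ne_succ i) hq,
      P.eventually_edge q] with x h1 h3
    rw [mem_boundary, edgeVec, ← h1]
    constructor
    · rintro ⟨j, hj⟩
      rwa [P.eq_of_mem_openSegment hq (h3 j hj)] at hj
    · exact fun h => ⟨i, h⟩

/-- The component of `y` in the complement of the boundary. -/
abbrev comp (y : Plane) : Set Plane := connectedComponentIn P.boundaryᶜ y

/-- The component of `y` contains the side `σ` of the boundary near the end of the `i`-th edge. -/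
def VertexSide (σ : ℝ) (i : Fin (P.m + 3)) (y : Plane) : Prop :=
  ∀ᶠ x in 𝓝 (P.vertex (i + 1)),
    x - P.vertex (i + 1) ∈ sector σ (P.edgeVec i) (P.edgeVec (i + 1)) → x ∈ P.comp y

/-- The component of `y` contains the side `σ` of the `i`-th edge near its point `q`. -/
def EdgeSide (σ : ℝ) (i : Fin (P.m + 3)) (q y : Plane) : Prop :=
  ∀ᶠ x in 𝓝 q, 0 < σ * wedge (P.edgeVec i) (x - q) → x ∈ P.comp y

variable {P}

/-- Inner points of an edge keep away from all other edges, so the side can be followed along a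
parallel copy of the segment from `q` to `q'`. -/
theorem EdgeSide.transport {σ : ℝ} (hσ : σ ≠ 0) {i : Fin (P.m + 3)} {q q' y : Plane}
    (hq : q ∈ openSegment ℝ (P.vertex i) (P.vertex (i + 1)))
    (hq' : q' ∈ openSegment ℝ (P.vertex i) (P.vertex (i + 1))) (h : P.EdgeSide σ i q y) :
    P.EdgeSide σ i q' y := by
  have hO : IsOpen (⋃ j ∈ {j | j ≠ i}, P.edge j)ᶜ := by
    rw [isOpen_compl_iff]
    exact (Set.toFinite _).isClosed_biUnion fun j _ => P.isClosed_edge j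
  have hsub : segment ℝ q q' ⊆ (⋃ j ∈ {j | j ≠ i}, P.edge j)ᶜ := by
    intro x hx hxu
    have hx := (convex_openSegment (𝕜 := ℝ) (P.vertex i) (P.vertex (i + 1))).segment_subset hq hq' hx
    simp only [Set.mem_iUnion] at hxu
    obtain ⟨j, hj, hxj⟩ := hxu
    exact hj (P.eq_of_mem_openSegment hx hxj)
  obtain ⟨c, hc⟩ := exists_smul_of_wedge_eq_zero (P.edgeVec_ne i)
    (P.wedge_edgeVec_of_mem (P.openSegment_subset_edge i hq') (P.openSegment_subset_edge i hq))
  have := frequently_side_of_segment hO (P.edgeVec_ne i) hsub hc hσ (W := P.boundaryᶜ) (by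
    intro x hx hxs hxB
    obtain ⟨j, hj⟩ := P.mem_boundary.1 hxB
    by_cases hji : j = i
    · subst hji
      rw [P.wedge_edgeVec_of_mem hj (P.openSegment_subset_edge j hq), mul_zero] at hxs
      exact lt_irrefl _ hxs
    · exact hx (Set.mem_biUnion (show j ∈ {j | j ≠ i} from hji) hj)) h
  have h2 := (P.isTwoRayCorner_edge hq').eventually_mem_component hσ (y := y) (by
    simpa only [mem_sector_self] using this)
  simp only [mem_sector_self] at h2
  exact h2

/-- At a point of the outgoing edge close to the vertex, the side `σ` of that edge lies in the
sector: if the sector is a union this is immediate, and otherwise the point is strictly on the side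
`σ` of the incoming line, which is an open condition. -/
theorem VertexSide.exists_edgeSide {σ : ℝ} {i : Fin (P.m + 3)} {y : Plane}
    (h : P.VertexSide σ i y) :
    ∃ q ∈ openSegment ℝ (P.vertex (i + 1)) (P.vertex (i + 1 + 1)), P.EdgeSide σ (i + 1) q y := by
  have h1 := (tendsto_add_smul (P.vertex (i + 1)) (P.edgeVec (i + 1))).eventually
    (eventually_eventually_nhds.2 h)
  have h2 : ∀ᶠ s : ℝ in 𝓝[>] 0, s < 1 :=
    nhdsWithin_le_nhds (eventually_lt_nhds (by norm_num))
  obtain ⟨s, hs, hs1, hs0⟩ := (h1.and (h2.and self_mem_nhdsWithin)).exists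
  have hs0 : 0 < s := hs0
  refine ⟨P.vertex (i + 1) + s • P.edgeVec (i + 1), ?_, ?_⟩
  rotate_left
  · unfold EdgeSide
    by_cases hc : σ * wedge (P.edgeVec i) (P.edgeVec (i + 1)) ≤ 0
    · filter_upwards [hs] with x hx hxs
      refine hx (Or.inr ⟨hc, Or.inr ?_⟩)
      rw [← sub_sub, wedge_sub_right, wedge_smul_right, wedge_self] at hxs
      simpa using hxs
    · have : 0 < σ * wedge (P.edgeVec i)
          (P.vertex (i + 1) + s • P.edgeVec (i + 1) - P.vertex (i + 1)) := by
        rw [add_sub_cancel_left, wedge_smul_right]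
        nlinarith [mul_pos hs0 (not_le.1 hc)]
      filter_upwards [hs, eventually_wedge_pos this] with x hx hxa hxs
      refine hx (Or.inl ⟨hxa, ?_⟩)
      rw [← sub_sub, wedge_sub_right, wedge_smul_right, wedge_self] at hxs
      simpa using hxs
  · rw [openSegment_eq_image']
    exact ⟨s, ⟨hs0, hs1⟩, rfl⟩

theorem vertexSide_of_edgeSide {σ : ℝ} (hσ : σ ≠ 0) {i : Fin (P.m + 3)} {y : Plane}
    (h : ∀ q ∈ openSegment ℝ (P.vertex i) (P.vertex (i + 1)), P.EdgeSide σ i q y) :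
    P.VertexSide σ i y := by
  refine (P.isTwoRayCorner_vertex i).eventually_mem_component hσ ?_
  rw [Filter.frequently_iff]
  intro U hU
  have h1 := (tendsto_add_smul (P.vertex (i + 1)) (-P.edgeVec i)).eventually
    (eventually_eventually_nhds.2 hU)
  have h2 : ∀ᶠ s : ℝ in 𝓝[>] 0, s < 1 :=
    nhdsWithin_le_nhds (eventually_lt_nhds (by norm_num))
  obtain ⟨s, hs, hs1, hs0⟩ := (h1.and (h2.and self_mem_nhdsWithin)).exists
  have hs0 : 0 < s := hs0
  have hq : P.vertex (i + 1) + s • (-P.edgeVec i) ∈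
      openSegment ℝ (P.vertex i) (P.vertex (i + 1)) := by
    rw [openSegment_eq_image']
    exact ⟨1 - s, ⟨by linarith, by linarith⟩, by simp only [edgeVec]; module⟩
  have hE := h _ hq
  have hf := (P.isTwoRayCorner_edge hq).frequently_sector hσ
  simp only [mem_sector_self] at hf
  have key : ∀ x, wedge (P.edgeVec i) (x - (P.vertex (i + 1) + s • (-P.edgeVec i))) =
      wedge (P.edgeVec i) (x - P.vertex (i + 1)) := by
    intro x
    rw [← sub_sub, wedge_sub_right, wedge_smul_right, wedge_neg_right, wedge_self]; ring
  by_cases hc : σ * wedge (P.edgeVec i) (P.edgeVec (i + 1)) ≤ 0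
  · obtain ⟨x, hx, hxU, hxE⟩ := (hf.and_eventually (hs.and hE)).exists
    refine ⟨x, hxU, Or.inr ⟨hc, Or.inl ?_⟩, hxE hx⟩
    rwa [key] at hx
  · have : 0 < σ * wedge (P.edgeVec (i + 1))
        (P.vertex (i + 1) + s • (-P.edgeVec i) - P.vertex (i + 1)) := by
      rw [add_sub_cancel_left, wedge_smul_right, wedge_neg_right, wedge_swap (P.edgeVec (i + 1))]
      nlinarith [mul_pos hs0 (not_le.1 hc)]
    obtain ⟨x, hx, ⟨hxU, hxE⟩, hxb⟩ :=
      (hf.and_eventually ((hs.and hE).and (eventually_wedge_pos this))).exists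
    refine ⟨x, hxU, Or.inl ⟨?_, hxb⟩, hxE hx⟩
    rwa [key] at hx

theorem EdgeSide.vertexSide {σ : ℝ} (hσ : σ ≠ 0) {i : Fin (P.m + 3)} {q y : Plane}
    (hq : q ∈ openSegment ℝ (P.vertex i) (P.vertex (i + 1))) (h : P.EdgeSide σ i q y) :
    P.VertexSide σ i y :=
  vertexSide_of_edgeSide hσ fun _ hq' => h.transport hσ hq hq'

theorem VertexSide.succ {σ : ℝ} (hσ : σ ≠ 0) {i : Fin (P.m + 3)} {y : Plane}
    (h : P.VertexSide σ i y) : P.VertexSide σ (i + 1) y :=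
  let ⟨_, hq, hE⟩ := h.exists_edgeSide
  hE.vertexSide hσ hq

/-- The side passes from each vertex to the next along the edge between them, so going round reaches
every vertex. This is what limits the complement to two components. -/
theorem VertexSide.all {σ : ℝ} (hσ : σ ≠ 0) {i : Fin (P.m + 3)} {y : Plane}
    (h : P.VertexSide σ i y) (j : Fin (P.m + 3)) : P.VertexSide σ j y := by
  have : ∀ k : Fin (P.m + 3), P.VertexSide σ (i + k) y := by
    intro k
    induction k using Fin.induction with
    | zero => simpa using h
    | succ k ih =>
      have := ih.succ hσ
      rwa [add_assoc, Fin.coeSucc_eq_succ] at this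
  simpa using this (j - i)

end SimplePolygon

/-! ### Parity of crossings and the existence of two components -/

/-- The coordinate of `z` in the direction `d`. -/
def dotCoord (d z : Plane) : ℝ := d 0 * z 0 + d 1 * z 1

theorem continuous_dotCoord (d : Plane) : Continuous (dotCoord d) := by
  unfold dotCoord; fun_prop

theorem eq_of_coords {d x y : Plane} (hd : d ≠ 0) (h1 : dotCoord d x = dotCoord d y)
    (h2 : wedge d x = wedge d y) : x = y := by
  have hn := wedge_quarterTurn_pos hd
  simp only [wedge, quarterTurn, dotCoord] at *
  simp at hn
  have hn' : d 0 * d 0 + d 1 * d 1 ≠ 0 := by linarith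
  refine plane_ext (mul_left_cancel₀ hn' ?_) (mul_left_cancel₀ hn' ?_)
  · linear_combination d 0 * h1 - d 1 * h2
  · linear_combination d 1 * h1 + d 0 * h2

/-- The height over `z`, in coordinates along and across `d`, of the line through `p` and `q`. -/
noncomputable def lineHeight (d p q z : Plane) : ℝ :=
  wedge d p + (wedge d q - wedge d p) *
    ((dotCoord d z - dotCoord d p) / (dotCoord d q - dotCoord d p))

open Classical in
/-- The number modulo two of crossings of the segment `pq` with the ray from `z` upwards, in
coordinates along and across `d`. -/
noncomputable def crossing (d p q z : Plane) : ZMod 2 :=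
  if dotCoord d p ≤ dotCoord d z ↔ dotCoord d q ≤ dotCoord d z then 0
  else if wedge d z < lineHeight d p q z then 1 else 0

theorem lineHeight_comm (d p q z : Plane) (h : dotCoord d p ≠ dotCoord d q) :
    lineHeight d p q z = lineHeight d q p z := by
  have h1 := sub_ne_zero.2 h
  have h2 := sub_ne_zero.2 h.symm
  simp only [lineHeight]
  field_simp
  ring

theorem crossing_comm (d p q z : Plane) : crossing d p q z = crossing d q p z := by
  unfold crossing
  by_cases h : dotCoord d p = dotCoord d q
  · simp [h]
  · rw [lineHeight_comm d p q z h]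
    simp only [iff_comm]

theorem continuous_lineHeight (d p q : Plane) : Continuous (lineHeight d p q) := by
  unfold lineHeight
  have := continuous_dotCoord d
  fun_prop

theorem continuous_wedge_lineHeight (d p q : Plane) :
    Continuous fun z => lineHeight d p q z - wedge d z :=
  (continuous_lineHeight d p q).sub (continuous_wedge d)

theorem dotCoord_combo (d p q : Plane) (s : ℝ) :
    dotCoord d (p + s • (q - p)) = dotCoord d p + s * (dotCoord d q - dotCoord d p) := by
  simp only [dotCoord, PiLp.add_apply, PiLp.smul_apply, PiLp.sub_apply, smul_eq_mul]; ring

theorem wedge_combo (d p q : Plane) (s : ℝ) :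
    wedge d (p + s • (q - p)) = wedge d p + s * (wedge d q - wedge d p) := by
  simp only [wedge, PiLp.add_apply, PiLp.smul_apply, PiLp.sub_apply, smul_eq_mul]; ring

theorem lineHeight_ne {d p q z : Plane} (hd : d ≠ 0) (hz : z ∉ segment ℝ p q)
    (h : ¬ (dotCoord d p ≤ dotCoord d z ↔ dotCoord d q ≤ dotCoord d z)) :
    lineHeight d p q z ≠ wedge d z := by
  intro he
  apply hz
  have hne : dotCoord d q - dotCoord d p ≠ 0 := by
    intro h0
    exact h (by rw [sub_eq_zero.1 h0])
  rw [segment_eq_image']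
  refine ⟨(dotCoord d z - dotCoord d p) / (dotCoord d q - dotCoord d p), ?_, ?_⟩
  · rcases le_or_gt (dotCoord d p) (dotCoord d z) with hp | hp
    · have hq : dotCoord d z < dotCoord d q := by
        by_contra! hq; exact h ⟨fun _ => hq, fun _ => hp⟩
      exact ⟨div_nonneg (by linarith) (by linarith), by rw [div_le_one] <;> linarith⟩
    · have hq : dotCoord d q ≤ dotCoord d z := by
        by_contra! hq; exact h ⟨fun h => absurd h hp.not_ge, fun h => absurd h hq.not_ge⟩
      exact ⟨div_nonneg_of_nonpos (by linarith) (by linarith),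
        by rw [div_le_one_of_neg] <;> linarith⟩
  · refine eq_of_coords hd ?_ ?_
    · simp only [dotCoord_combo]; field_simp; ring
    · simp only [wedge_combo]; rw [← he, lineHeight]; ring

theorem eventually_lt_iff {f : Plane → ℝ} (hf : Continuous f) {z : Plane} (h : f z ≠ 0) :
    ∀ᶠ x in 𝓝 z, (0 < f x ↔ 0 < f z) := by
  rcases lt_or_gt_of_ne h with h | h
  · filter_upwards [hf.continuousAt.eventually_lt_const h] with x hx
    exact iff_of_false hx.not_gt h.not_gt
  · filter_upwards [hf.continuousAt.eventually_const_lt h] with x hx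
    exact iff_of_true hx h

theorem eventually_le_dotCoord_iff {d p z : Plane} (h : dotCoord d p ≠ dotCoord d z) :
    ∀ᶠ x in 𝓝 z, (dotCoord d p ≤ dotCoord d x ↔ dotCoord d p ≤ dotCoord d z) := by
  rcases lt_or_gt_of_ne h with h | h
  · filter_upwards [(continuous_dotCoord d).continuousAt.eventually_const_lt h] with x hx
    exact iff_of_true hx.le h.le
  · filter_upwards [(continuous_dotCoord d).continuousAt.eventually_lt_const h] with x hx
    exact iff_of_false hx.not_ge h.not_ge

theorem eventually_lt_lineHeight_iff {d p q z : Plane} (h : lineHeight d p q z ≠ wedge d z) :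
    ∀ᶠ x in 𝓝 z, (wedge d x < lineHeight d p q x ↔ wedge d z < lineHeight d p q z) := by
  simpa only [sub_pos] using eventually_lt_iff (continuous_wedge_lineHeight d p q) (sub_ne_zero.2 h)

/-- A vertical move does not change the crossings of a segment that it does not meet. -/
theorem eventually_crossing_eq_of_vertical {d p q z : Plane} (hd : d ≠ 0)
    (hz : z ∉ segment ℝ p q) :
    ∀ᶠ x in 𝓝 z, dotCoord d x = dotCoord d z → crossing d p q x = crossing d p q z := by
  by_cases h : dotCoord d p ≤ dotCoord d z ↔ dotCoord d q ≤ dotCoord d z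
  · refine Filter.Eventually.of_forall fun x hx => ?_
    simp [crossing, hx, h]
  · filter_upwards [eventually_lt_lineHeight_iff (lineHeight_ne hd hz h)] with x hx hxz
    simp only [crossing, hxz, hx]

open Classical in
/-- The change near `z` of the crossings of a segment with end `p`. -/
noncomputable def jump (d z p x : Plane) : ZMod 2 :=
  if dotCoord d p = dotCoord d z ∧ wedge d z < wedge d p then
    if dotCoord d p ≤ dotCoord d x then 1 else 0
  else 0

theorem eventually_crossing_add_jump_aux {d p q z : Plane} (hd : d ≠ 0) (hz : z ∉ segment ℝ p q)
    (hp : dotCoord d p = dotCoord d z) (hq : dotCoord d q ≠ dotCoord d z) :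
    ∀ᶠ x in 𝓝 z, crossing d p q x + (jump d z p x + jump d z q x) =
      crossing d p q z + (jump d z p z + jump d z q z) := by
  have hl : lineHeight d p q z = wedge d p := by simp [lineHeight, hp]
  have hne : lineHeight d p q z ≠ wedge d z := by
    rw [hl]
    intro h
    exact hz (by rw [← eq_of_coords hd hp h]; exact left_mem_segment ℝ _ _)
  filter_upwards [eventually_lt_lineHeight_iff hne, eventually_le_dotCoord_iff hq] with x h1 h2
  simp only [crossing, jump, h1, h2, hp, hl, hq, true_and, false_and, if_false, le_refl, true_iff]
  split_ifs <;> first | rfl | tauto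

/-- Off the segment, the crossing number changes near `z` only when the upward ray sweeps over an
end. The terms `jump` cancel exactly this change, so no general position of `d` is needed. -/
theorem eventually_crossing_add_jump {d p q z : Plane} (hd : d ≠ 0) (hz : z ∉ segment ℝ p q) :
    ∀ᶠ x in 𝓝 z, crossing d p q x + (jump d z p x + jump d z q x) =
      crossing d p q z + (jump d z p z + jump d z q z) := by
  by_cases hp : dotCoord d p = dotCoord d z
  · by_cases hq : dotCoord d q = dotCoord d z
    · refine Filter.Eventually.of_forall fun x => ?_
      have hside : wedge d z < wedge d p ↔ wedge d z < wedge d q := by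
        by_contra hn
        have hmem : ∃ s ∈ Set.Icc (0 : ℝ) 1,
            wedge d p + s * (wedge d q - wedge d p) = wedge d z := by
          have hne : wedge d q - wedge d p ≠ 0 := by
            intro h0; rw [sub_eq_zero.1 h0] at hn; exact hn Iff.rfl
          refine ⟨(wedge d z - wedge d p) / (wedge d q - wedge d p), ?_, by field_simp; ring⟩
          rcases lt_or_ge (wedge d z) (wedge d p) with h1 | h1
          · have : wedge d q ≤ wedge d z := by
              by_contra! h; exact hn ⟨fun _ => h, fun _ => h1⟩
            exact ⟨div_nonneg_of_nonpos (by linarith) (by linarith),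
              by rw [div_le_one_of_neg] <;> linarith⟩
          · have : wedge d z < wedge d q := by
              by_contra! h; exact hn ⟨fun h' => absurd h' h1.not_gt, fun h' => absurd h' h.not_gt⟩
            exact ⟨div_nonneg (by linarith) (by linarith), by rw [div_le_one] <;> linarith⟩
        obtain ⟨s, hs, hsw⟩ := hmem
        apply hz
        rw [segment_eq_image']
        refine ⟨s, hs, eq_of_coords hd ?_ ?_⟩
        · simp only [dotCoord_combo, hp, hq]; ring
        · simp only [wedge_combo, hsw]
      simp only [crossing, jump, hp, hq, hside, true_and, CharTwo.add_self_eq_zero]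
      simp
    · exact eventually_crossing_add_jump_aux hd hz hp hq
  · by_cases hq : dotCoord d q = dotCoord d z
    · rw [segment_symm] at hz
      filter_upwards [eventually_crossing_add_jump_aux hd hz hq hp] with x hx
      rw [crossing_comm d p q, crossing_comm d p q, add_comm (jump d z p x),
        add_comm (jump d z p z), hx]
    · by_cases h : dotCoord d p ≤ dotCoord d z ↔ dotCoord d q ≤ dotCoord d z
      · filter_upwards [eventually_le_dotCoord_iff hp, eventually_le_dotCoord_iff hq] with x h1 h2
        simp [crossing, jump, hp, hq, h1, h2, h]
      · filter_upwards [eventually_le_dotCoord_iff hp, eventually_le_dotCoord_iff hq,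
          eventually_lt_lineHeight_iff (lineHeight_ne hd hz h)] with x h1 h2 h3
        simp [crossing, jump, hp, hq, h1, h2, h3]

namespace SimplePolygon

variable (P : SimplePolygon)

/-- The parity of the number of edges above a point, in coordinates along and across `d`. -/
noncomputable def parity (d z : Plane) : ZMod 2 :=
  ∑ i, crossing d (P.vertex i) (P.vertex (i + 1)) z

/-- Every vertex is an end of two edges, so in the sum over all edges its `jump` occurs twice and
vanishes modulo two. -/
theorem eventually_parity_eq {d z : Plane} (hd : d ≠ 0) (hz : z ∉ P.boundary) :
    ∀ᶠ x in 𝓝 z, P.parity d z = P.parity d x := by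
  have hall : ∀ᶠ x in 𝓝 z, ∀ i, crossing d (P.vertex i) (P.vertex (i + 1)) x +
      (jump d z (P.vertex i) x + jump d z (P.vertex (i + 1)) x) =
      crossing d (P.vertex i) (P.vertex (i + 1)) z +
      (jump d z (P.vertex i) z + jump d z (P.vertex (i + 1)) z) := by
    rw [Filter.eventually_all]
    exact fun i => eventually_crossing_add_jump hd fun h => hz (P.mem_boundary.2 ⟨i, h⟩)
  have hsum : ∀ x, ∑ i, (crossing d (P.vertex i) (P.vertex (i + 1)) x +
      (jump d z (P.vertex i) x + jump d z (P.vertex (i + 1)) x)) = P.parity d x := by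
    intro x
    have := Equiv.sum_comp (Equiv.addRight (1 : Fin (P.m + 3))) (fun i => jump d z (P.vertex i) x)
    simp only [Equiv.coe_addRight] at this
    rw [Finset.sum_add_distrib, Finset.sum_add_distrib, this,
      CharTwo.add_self_eq_zero, add_zero, parity]
  filter_upwards [hall] with x hx
  rw [← hsum z, ← hsum x]
  exact Finset.sum_congr rfl fun i _ => (hx i).symm

theorem parity_eq_of_mem_comp {d x y : Plane} (hd : d ≠ 0) (hx : x ∈ P.comp y) :
    P.parity d y = P.parity d x := by
  have hy : y ∈ P.boundaryᶜ := by
    by_contra h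
    rw [comp, connectedComponentIn_eq_empty h] at hx
    exact hx
  refine (isPreconnected_connectedComponentIn (x := y) (F := P.boundaryᶜ)).induction₂
    (fun a b => P.parity d a = P.parity d b) (fun z hz => ?_) (fun _ _ _ _ _ _ => Eq.trans)
    (fun _ _ _ _ => Eq.symm) (mem_connectedComponentIn hy) hx
  exact nhdsWithin_le_nhds (P.eventually_parity_eq hd (connectedComponentIn_subset _ _ hz))

/-- Moving across an edge at its midpoint, at right angles to it, changes the crossing number of
that edge and of no other. The two ends of the move differ in parity, while parity is constant on
components. -/
theorem exists_comp_ne : ∃ y y', y ∉ P.boundary ∧ y' ∉ P.boundary ∧ P.comp y ≠ P.comp y' := by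
  set d := P.edgeVec 0 with hd
  have hd0 : d ≠ 0 := P.edgeVec_ne 0
  have hJ := wedge_quarterTurn_pos hd0
  set z : Plane := P.vertex 0 + (1 / 2 : ℝ) • d with hz
  have hzo : z ∈ openSegment ℝ (P.vertex 0) (P.vertex (0 + 1)) := by
    rw [openSegment_eq_image']
    exact ⟨1 / 2, by norm_num, rfl⟩
  have hcor := P.isTwoRayCorner_edge hzo
  have hothers : ∀ᶠ x in 𝓝 z, ∀ i, i ≠ 0 → dotCoord d x = dotCoord d z →
      crossing d (P.vertex i) (P.vertex (i + 1)) x = crossing d (P.vertex i) (P.vertex (i + 1)) z := by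
    rw [Filter.eventually_all]
    intro i
    by_cases hi : i = 0
    · simp [hi]
    · filter_upwards [eventually_crossing_eq_of_vertical hd0 (p := P.vertex i)
        (q := P.vertex (i + 1)) (z := z) (fun h => hi (P.eq_of_mem_openSegment hzo h))] with x hx _
      exact hx
  have hgood := hothers.and ((hcor.eventually_not_mem 1).and (hcor.eventually_not_mem (-1)))
  obtain ⟨t, ⟨⟨h1, h1', -⟩, h2, -, h2'⟩, ht⟩ := (((tendsto_add_smul z (quarterTurn d)).eventually
    hgood).and ((tendsto_add_smul z (-quarterTurn d)).eventually hgood) |>.and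
      self_mem_nhdsWithin).exists
  have ht : 0 < t := ht
  have htJ := mul_pos ht hJ
  have hX : dotCoord d (z + t • quarterTurn d) = dotCoord d z := by
    simp [dotCoord, quarterTurn]; ring
  have hX' : dotCoord d (z + t • -quarterTurn d) = dotCoord d z := by
    simp [dotCoord, quarterTurn]; ring
  refine ⟨z + t • quarterTurn d, z + t • -quarterTurn d, h1' ?_, h2' ?_, fun heq => ?_⟩
  · rw [mem_sector_self, add_sub_cancel_left, wedge_smul_right]; linarith
  · rw [mem_sector_self, add_sub_cancel_left, wedge_smul_right, wedge_neg_right]; linarith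
  have hnB' : z + t • -quarterTurn d ∉ P.boundary := h2' (by
    rw [mem_sector_self, add_sub_cancel_left, wedge_smul_right, wedge_neg_right]; linarith)
  have hpar := P.parity_eq_of_mem_comp (x := z + t • -quarterTurn d) hd0
    (by rw [heq]; exact mem_connectedComponentIn hnB')
  rw [parity, parity, ← Finset.add_sum_erase _ _ (Finset.mem_univ 0),
    ← Finset.add_sum_erase _ _ (Finset.mem_univ 0)] at hpar
  rw [Finset.sum_congr rfl (fun i hi => (h1 i (Finset.ne_of_mem_erase hi) hX).trans
    (h2 i (Finset.ne_of_mem_erase hi) hX').symm), add_left_inj] at hpar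
  have hdd : 0 < dotCoord d d := by
    simp only [wedge, quarterTurn, dotCoord] at *
    simp at hJ; linarith
  have hv1 : P.vertex (0 + 1) = P.vertex 0 + d := by rw [hd, edgeVec]; abel
  have hXz : dotCoord d z = dotCoord d (P.vertex 0) + 1 / 2 * dotCoord d d := by
    rw [hz]; simp [dotCoord]; ring
  have hX1 : dotCoord d (P.vertex (0 + 1)) = dotCoord d (P.vertex 0) + dotCoord d d := by
    rw [hv1]; simp [dotCoord]; ring
  have hl : ∀ x, lineHeight d (P.vertex 0) (P.vertex (0 + 1)) x = wedge d z := by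
    intro x
    rw [lineHeight, hv1, hz, wedge_add_right, wedge_add_right, wedge_smul_right, wedge_self]
    ring
  have hiff : ¬ (dotCoord d (P.vertex 0) ≤ dotCoord d z ↔
      dotCoord d (P.vertex (0 + 1)) ≤ dotCoord d z) := by
    rw [hXz, hX1]
    intro h
    have := h.1 (by linarith)
    linarith
  simp only [crossing, hX, hX', hiff, if_false, hl, wedge_add_right, wedge_smul_right,
    wedge_neg_right] at hpar
  rw [if_neg (by linarith), if_pos (by linarith)] at hpar
  exact absurd hpar (by decide)

end SimplePolygon

/-! ### Inside and outside; reflex vertices as turns -/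

theorem isPreconnected_norm_gt {R : ℝ} (hR : 0 ≤ R) : IsPreconnected {x : Plane | R < ‖x‖} := by
  have hrank : 1 < Module.rank ℝ Plane := by
    rw [← Module.finrank_eq_rank, finrank_euclideanSpace_fin]
    norm_num
  have h : {x : Plane | R < ‖x‖} =
      (fun p : ℝ × Plane => p.1 • p.2) '' (Set.Ioi R ×ˢ Metric.sphere (0 : Plane) 1) := by
    ext x
    simp only [Set.mem_ofPred_eq, Set.mem_image, Set.mem_prod, Set.mem_Ioi, mem_sphere_zero_iff_norm,
      Prod.exists]
    constructor
    · intro hx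
      have hx0 : ‖x‖ ≠ 0 := by linarith
      refine ⟨‖x‖, ‖x‖⁻¹ • x, ⟨hx, ?_⟩, ?_⟩
      · rw [norm_smul, norm_inv, norm_norm, inv_mul_cancel₀ hx0]
      · rw [smul_smul, mul_inv_cancel₀ hx0, one_smul]
    · rintro ⟨r, u, ⟨hr, hu⟩, rfl⟩
      rw [norm_smul, hu, mul_one]
      exact hr.trans_le (Real.le_norm_self r)
  rw [h]
  exact (isPreconnected_Ioi.prod (isConnected_sphere hrank 0 zero_le_one).isPreconnected).image _
    (by fun_prop)

namespace SimplePolygon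

variable {P : SimplePolygon}

theorem comp_subset (y : Plane) : P.comp y ⊆ P.boundaryᶜ := connectedComponentIn_subset _ _

theorem mem_comp {y : Plane} (hy : y ∉ P.boundary) : y ∈ P.comp y := mem_connectedComponentIn hy

theorem isOpen_comp (y : Plane) : IsOpen (P.comp y) := P.isOpen_compl_boundary.connectedComponentIn

theorem comp_eq {x y : Plane} (h : x ∈ P.comp y) : P.comp x = P.comp y :=
  (connectedComponentIn_eq h).symm

theorem exists_vertexSide_of_frequently {y w : Plane} (hw : w ∈ P.boundary)
    (hfr : ∃ᶠ x in 𝓝 w, x ∈ P.comp y) :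
    ∃ σ : ℝ, (σ = 1 ∨ σ = -1) ∧ ∀ i, P.VertexSide σ i y := by
  have key : ∀ a b, IsTwoRayCorner P.boundary w a b → ∃ σ : ℝ, (σ = 1 ∨ σ = -1) ∧
      ∀ᶠ x in 𝓝 w, x - w ∈ sector σ a b → x ∈ P.comp y := by
    intro a b hc
    have h1 : ∃ᶠ x in 𝓝 w, (x - w ∈ sector 1 a b ∧ x ∈ P.comp y) ∨
        (x - w ∈ sector (-1) a b ∧ x ∈ P.comp y) := by
      refine (hfr.and_eventually (hc.eventually_mem_sector one_ne_zero)).mono ?_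
      rintro x ⟨hx, hs⟩
      exact (hs (P.comp_subset y hx)).imp (⟨·, hx⟩) (⟨·, hx⟩)
    rcases Filter.frequently_or_distrib.1 h1 with h | h
    · exact ⟨1, Or.inl rfl, hc.eventually_mem_component one_ne_zero h⟩
    · exact ⟨-1, Or.inr rfl, hc.eventually_mem_component (by norm_num) h⟩
  have hne : ∀ σ : ℝ, (σ = 1 ∨ σ = -1) → σ ≠ 0 := by rintro σ (rfl | rfl) <;> norm_num
  have hvert : ∀ i, w = P.vertex (i + 1) →
      ∃ σ : ℝ, (σ = 1 ∨ σ = -1) ∧ ∀ i, P.VertexSide σ i y := by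
    rintro i rfl
    obtain ⟨σ, hσ, h⟩ := key _ _ (P.isTwoRayCorner_vertex i)
    exact ⟨σ, hσ, VertexSide.all (hne σ hσ) h⟩
  obtain ⟨i, hi⟩ := P.mem_boundary.1 hw
  by_cases h1 : w = P.vertex i
  · exact hvert (i - 1) (by rw [sub_add_cancel, h1])
  by_cases h2 : w = P.vertex (i + 1)
  · exact hvert i h2
  have ho := P.mem_openSegment_of_mem_edge hi h1 h2
  obtain ⟨σ, hσ, h⟩ := key _ _ (P.isTwoRayCorner_edge ho)
  simp only [mem_sector_self] at h
  exact ⟨σ, hσ, VertexSide.all (hne σ hσ) (EdgeSide.vertexSide (hne σ hσ) ho h)⟩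

/-- A component is neither empty nor the whole plane, so it has a frontier point. That point is on
the polygon, since off it a neighbourhood belongs to a single component. Near it the component meets
one of the two sectors. -/
theorem exists_side_of_not_mem_boundary {y : Plane} (hy : y ∉ P.boundary) :
    ∃ σ : ℝ, (σ = 1 ∨ σ = -1) ∧ ∀ i, P.VertexSide σ i y := by
  have hne : P.comp y ≠ Set.univ := fun h =>
    P.comp_subset y (h ▸ Set.mem_univ (P.vertex 0)) (P.vertex_mem_boundary 0)
  obtain ⟨w, hw⟩ := nonempty_frontier_iff.2 ⟨⟨y, mem_comp hy⟩, hne⟩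
  have hfr : ∃ᶠ x in 𝓝 w, x ∈ P.comp y := mem_closure_iff_frequently.1 hw.1
  refine exists_vertexSide_of_frequently (w := w) ?_ hfr
  by_contra hwB
  obtain ⟨x, hxy, hxw⟩ := (hfr.and_eventually
    ((P.isOpen_comp w).mem_nhds (mem_comp hwB))).exists
  refine hw.2 ?_
  rw [(P.isOpen_comp y).interior_eq, ← comp_eq hxy, comp_eq hxw]
  exact mem_comp hwB

theorem VertexSide.comp_eq {σ : ℝ} (hσ : σ ≠ 0) {i : Fin (P.m + 3)} {y y' : Plane}
    (h : P.VertexSide σ i y) (h' : P.VertexSide σ i y') : P.comp y = P.comp y' := by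
  obtain ⟨x, hx, hxy, hxy'⟩ := (((P.isTwoRayCorner_vertex i).frequently_sector hσ).and_eventually
    (h.and h')).exists
  rw [← SimplePolygon.comp_eq (hxy hx), SimplePolygon.comp_eq (hxy' hx)]

/-- The inside of a simple polygon is the component of the complement of the boundary that lies on
one of the two sides of the boundary; the other side lies in the other component. -/
theorem exists_inside_side (P : SimplePolygon) : ∃ σ : ℝ, (σ = 1 ∨ σ = -1) ∧ ∃ y y',
    y ∉ P.boundary ∧ y' ∉ P.boundary ∧ (∀ i, P.VertexSide σ i y) ∧ (∀ i, P.VertexSide (-σ) i y') ∧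
    P.inside = P.comp y ∧ Disjoint (P.comp y) (P.comp y') := by
  obtain ⟨y₁, y₂, hy₁, hy₂, hne⟩ := P.exists_comp_ne
  have hne0 : ∀ σ : ℝ, (σ = 1 ∨ σ = -1) → σ ≠ 0 := by rintro σ (rfl | rfl) <;> norm_num
  have hsides : ∃ z₁ z₂, z₁ ∉ P.boundary ∧ z₂ ∉ P.boundary ∧ P.comp z₁ ≠ P.comp z₂ ∧
      (∀ i, P.VertexSide 1 i z₁) ∧ ∀ i, P.VertexSide (-1) i z₂ := by
    obtain ⟨σ₁, hσ₁, h₁⟩ := exists_side_of_not_mem_boundary hy₁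
    obtain ⟨σ₂, hσ₂, h₂⟩ := exists_side_of_not_mem_boundary hy₂
    rcases hσ₁ with rfl | rfl <;> rcases hσ₂ with rfl | rfl
    · exact absurd (VertexSide.comp_eq (by norm_num) (h₁ 0) (h₂ 0)) hne
    · exact ⟨y₁, y₂, hy₁, hy₂, hne, h₁, h₂⟩
    · exact ⟨y₂, y₁, hy₂, hy₁, hne.symm, h₂, h₁⟩
    · exact absurd (VertexSide.comp_eq (by norm_num) (h₁ 0) (h₂ 0)) hne
  clear hne hy₁ hy₂ y₁ y₂
  obtain ⟨z₁, z₂, hz₁, hz₂, hne, h₁, h₂⟩ := hsides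
  have hcover : ∀ x ∉ P.boundary, P.comp x = P.comp z₁ ∨ P.comp x = P.comp z₂ := by
    intro x hx
    obtain ⟨σ, hσ, h⟩ := exists_side_of_not_mem_boundary hx
    rcases hσ with rfl | rfl
    · exact Or.inl (VertexSide.comp_eq (by norm_num) (h 0) (h₁ 0))
    · exact Or.inr (VertexSide.comp_eq (by norm_num) (h 0) (h₂ 0))
  have hdisj : Disjoint (P.comp z₁) (P.comp z₂) := by
    rw [Set.disjoint_left]
    intro x hx hx'
    exact hne (by rw [← comp_eq hx, comp_eq hx'])
  -- Not both components are bounded, because with the boundary they cover the plane; not both are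
  -- unbounded, because the complement of a large disc is connected and misses the boundary.
  have hunb : ¬ (Bornology.IsBounded (P.comp z₁) ∧ Bornology.IsBounded (P.comp z₂)) := by
    rintro ⟨hb₁, hb₂⟩
    have := (hb₁.union hb₂).union P.isCompact_boundary.isBounded
    refine NormedSpace.unbounded_univ ℝ Plane (this.subset fun x _ => ?_)
    by_cases hx : x ∈ P.boundary
    · exact Or.inr hx
    · rcases hcover x hx with h | h
      · exact Or.inl (Or.inl (h ▸ mem_comp hx))
      · exact Or.inl (Or.inr (h ▸ mem_comp hx))
  have hbdd : Bornology.IsBounded (P.comp z₁) ∨ Bornology.IsBounded (P.comp z₂) := by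
    by_contra! hn
    obtain ⟨R, hR0, hR⟩ := P.isCompact_boundary.isBounded.exists_pos_norm_le
    have hfar : ∀ z, ¬ Bornology.IsBounded (P.comp z) → ∃ x ∈ P.comp z, R < ‖x‖ := by
      intro z hz
      by_contra! h
      exact hz (isBounded_iff_forall_norm_le.2 ⟨R, h⟩)
    obtain ⟨x₁, hx₁, hR₁⟩ := hfar _ hn.1
    obtain ⟨x₂, hx₂, hR₂⟩ := hfar _ hn.2
    have := (isPreconnected_norm_gt hR0.le).subset_connectedComponentIn (F := P.boundaryᶜ) hR₁
      (fun x hx hxB => (hR x hxB).not_gt hx) hR₂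
    exact hne (by rw [← comp_eq hx₁, ← comp_eq hx₂, comp_eq this])
  have hinside : ∀ z z', (∀ x ∉ P.boundary, P.comp x = P.comp z ∨ P.comp x = P.comp z') →
      Bornology.IsBounded (P.comp z) → ¬ Bornology.IsBounded (P.comp z') →
      P.inside = P.comp z := by
    intro z z' hc hb hub
    ext x
    constructor
    · rintro ⟨hx, hxb⟩
      rcases hc x hx with h | h
      · exact h ▸ mem_comp hx
      · exact absurd (h ▸ hxb) hub
    · intro hx
      refine ⟨P.comp_subset z hx, ?_⟩
      change Bornology.IsBounded (P.comp x)
      rwa [comp_eq hx]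
  rcases hbdd with hb | hb
  · exact ⟨1, Or.inl rfl, z₁, z₂, hz₁, hz₂, h₁, h₂, hinside z₁ z₂ hcover hb
      (fun h => hunb ⟨hb, h⟩), hdisj⟩
  · exact ⟨-1, Or.inr rfl, z₂, z₁, hz₂, hz₁, h₂, by simpa using h₁, hinside z₂ z₁
      (fun x hx => (hcover x hx).symm) hb (fun h => hunb ⟨h, hb⟩), hdisj.symm⟩

theorem angle_eq_pi_iff (i : Fin (P.m + 3)) :
    EuclideanGeometry.angle (P.vertex i) (P.vertex (i + 1)) (P.vertex (i + 1 + 1)) = Real.pi ↔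
      wedge (P.edgeVec i) (P.edgeVec (i + 1)) = 0 := by
  have h1 : P.vertex i - P.vertex (i + 1) = -P.edgeVec i := by simp [edgeVec]
  have h2 : P.vertex (i + 1 + 1) - P.vertex (i + 1) = P.edgeVec (i + 1) := rfl
  rw [EuclideanGeometry.angle, vsub_eq_sub, vsub_eq_sub, h1, h2,
    InnerProductGeometry.angle_eq_pi_iff]
  constructor
  · rintro ⟨-, r, hr, h⟩
    rw [h, wedge_smul_right, wedge_neg_right, wedge_self]; simp
  · intro h
    obtain ⟨s, hs, h⟩ := P.exists_pos_smul_of_wedge_eq_zero h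
    exact ⟨neg_ne_zero.2 (P.edgeVec_ne i), -s, by linarith, by rw [h]; simp⟩

theorem lineMap_midpoint_eq (i : Fin (P.m + 3)) (t : ℝ) :
    AffineMap.lineMap (P.vertex (i + 1)) (midpoint ℝ (P.vertex i) (P.vertex (i + 1 + 1))) t =
      P.vertex (i + 1) + t • ((1 / 2 : ℝ) • (P.edgeVec (i + 1) - P.edgeVec i)) := by
  rw [AffineMap.lineMap_apply_module', midpoint_eq_smul_add, edgeVec, edgeVec, invOf_eq_inv]
  module

theorem VertexSide.eventually_lineMap_mem {σ : ℝ} {i : Fin (P.m + 3)} {y : Plane}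
    (h : P.VertexSide σ i y) (hpos : 0 < σ * wedge (P.edgeVec i) (P.edgeVec (i + 1))) :
    ∀ᶠ t : ℝ in 𝓝[>] 0, AffineMap.lineMap (P.vertex (i + 1))
      (midpoint ℝ (P.vertex i) (P.vertex (i + 1 + 1))) t ∈ P.comp y := by
  filter_upwards [(tendsto_add_smul (P.vertex (i + 1))
    ((1 / 2 : ℝ) • (P.edgeVec (i + 1) - P.edgeVec i))).eventually h, self_mem_nhdsWithin] with t ht ht0
  have ht0 : 0 < t := ht0
  rw [lineMap_midpoint_eq]
  refine ht (Or.inl ?_)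
  rw [add_sub_cancel_left]
  simp only [wedge_smul_right, wedge_sub_right, wedge_self, wedge_swap (P.edgeVec (i + 1))
    (P.edgeVec i)]
  constructor <;> nlinarith [mul_pos ht0 hpos]

/-- A vertex is reflex when the boundary turns away from the inside. -/
theorem isReflex_iff {σ : ℝ} (hσ : σ ≠ 0) {y y' : Plane} {i : Fin (P.m + 3)}
    (h : P.VertexSide σ i y) (h' : P.VertexSide (-σ) i y') (hin : P.inside = P.comp y)
    (hdisj : Disjoint (P.comp y) (P.comp y')) :
    P.IsReflex (i + 1) ↔ σ * wedge (P.edgeVec i) (P.edgeVec (i + 1)) < 0 := by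
  rw [IsReflex, interiorAngle, add_sub_cancel_right, hin]
  have hle := EuclideanGeometry.angle_le_pi (P.vertex i) (P.vertex (i + 1)) (P.vertex (i + 1 + 1))
  rcases lt_trichotomy (σ * wedge (P.edgeVec i) (P.edgeVec (i + 1))) 0 with hs | hs | hs
  · refine iff_of_true ?_ hs
    rw [if_neg]
    · have hne : EuclideanGeometry.angle (P.vertex i) (P.vertex (i + 1)) (P.vertex (i + 1 + 1)) ≠
          Real.pi := by
        rw [Ne, angle_eq_pi_iff]
        intro h0
        simp [h0] at hs
      have := lt_of_le_of_ne hle hne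
      linarith
    -- At a turn away from the inside, the direction towards the midpoint of the neighbours lies in
    -- the sector of the other component.
    · intro hev
      obtain ⟨t, h1, h2⟩ := (hev.and (h'.eventually_lineMap_mem (by linarith))).exists
      exact Set.disjoint_left.1 hdisj h1 h2
  · refine iff_of_false ?_ hs.not_lt
    have h0 : wedge (P.edgeVec i) (P.edgeVec (i + 1)) = 0 := by simpa [hσ] using hs
    rw [(angle_eq_pi_iff i).2 h0]
    split_ifs <;> linarith
  · refine iff_of_false ?_ hs.not_gt
    rw [if_pos (h.eventually_lineMap_mem hs)]
    exact hle.not_gt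

end SimplePolygon

/-! ### From local to global convexity -/

/-- If `W` contains a half-disc around `w`, then it does not meet the line bounding the half-disc
near `w`. -/
def IsConvexPoint (W : Set Plane) (w : Plane) : Prop :=
  ∀ d ≠ 0, (∀ᶠ x in 𝓝 w, 0 < wedge d (x - w) → x ∈ W) → ∀ᶠ x in 𝓝 w, wedge d (x - w) = 0 → x ∉ W

theorem IsConvexPoint.mono {W W' : Set Plane} {w : Plane} (h : IsConvexPoint W w) (hW : W' ⊆ W) :
    IsConvexPoint W' w := fun d hd h' => by
  filter_upwards [h d hd (h'.mono fun x hx hxd => hW (hx hxd))] with x hx hxd hxW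
  exact hx hxd (hW hxW)

/-- A half-disc in `W` can contain neither ray, so both rays lie on its bounding line, and together
with `w` they fill that line near `w`. -/
theorem isConvexPoint_of_opposite_rays {W : Set Plane} {w b : Plane} (hb : b ≠ 0) (hw : w ∉ W)
    (h₁ : ∀ᶠ t : ℝ in 𝓝[>] 0, w + t • b ∉ W) (h₂ : ∀ᶠ t : ℝ in 𝓝[>] 0, w + t • -b ∉ W) :
    IsConvexPoint W w := by
  intro d hd hhalf
  have key : ∀ c, (∀ᶠ t : ℝ in 𝓝[>] 0, w + t • c ∉ W) → wedge d c ≤ 0 := by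
    intro c hc
    by_contra! hpos
    obtain ⟨t, ⟨h1, h2⟩, ht⟩ := ((((tendsto_add_smul w c).eventually hhalf).and hc).and
      self_mem_nhdsWithin).exists
    have ht : 0 < t := ht
    exact h2 (h1 (by rw [add_sub_cancel_left, wedge_smul_right]; positivity))
  have hdb : wedge d b = 0 := by
    have h3 := key b h₁
    have h4 := key (-b) h₂
    rw [wedge_neg_right] at h4
    linarith
  obtain ⟨ε₁, hε₁, h₁⟩ := mem_nhdsGT_iff_exists_Ioo_subset.1 h₁
  obtain ⟨ε₂, hε₂, h₂⟩ := mem_nhdsGT_iff_exists_Ioo_subset.1 h₂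
  have hε₁ : 0 < ε₁ := hε₁
  have hε₂ : 0 < ε₂ := hε₂
  have hbn : 0 < ‖b‖ := norm_pos_iff.2 hb
  filter_upwards [Metric.ball_mem_nhds w (mul_pos hε₁ hbn), Metric.ball_mem_nhds w (mul_pos hε₂ hbn)]
    with x hx₁ hx₂ hxd
  obtain ⟨s, rfl⟩ := exists_smul_of_wedge_eq_zero hd hdb
  have hs : s ≠ 0 := by rintro rfl; simp at hb
  obtain ⟨r, hr⟩ := exists_smul_of_wedge_eq_zero hd hxd
  have hx : x = w + (r / s) • s • d := by
    rw [smul_smul, div_mul_cancel₀ _ hs, ← hr]; abel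
  rw [mem_ball_iff_norm] at hx₁ hx₂
  rw [hx, add_sub_cancel_left, norm_smul, Real.norm_eq_abs, mul_lt_mul_iff_left₀ hbn, abs_lt]
    at hx₁ hx₂
  rw [hx]
  rcases lt_trichotomy (r / s) 0 with h | h | h
  · have : w + (-(r / s)) • -(s • d) ∉ W := h₂ ⟨by linarith, by linarith⟩
    rwa [smul_neg, neg_smul, neg_neg] at this
  · rwa [h, zero_smul, add_zero]
  · exact h₁ ⟨h, by linarith⟩

theorem isOpen_segment_subset {W : Set Plane} (hW : IsOpen W) (x : Plane) :
    IsOpen {p | segment ℝ x p ⊆ W} := by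
  have h : {p | segment ℝ x p ⊆ W} = {p | ∀ s ∈ Set.Icc (0 : ℝ) 1, x + s • (p - x) ∈ W} := by
    ext p
    simp only [Set.mem_ofPred_eq, segment_eq_image', Set.image_subset_iff]
    rfl
  rw [h, isOpen_iff_mem_nhds]
  intro p hp
  refine isCompact_Icc.eventually_forall_of_forall_eventually fun s hs => ?_
  have hcont : Continuous fun z : Plane × ℝ => x + z.2 • (z.1 - x) := by fun_prop
  exact hcont.continuousAt.eventually_mem (hW.mem_nhds (hp s hs))

/-- Let the far end of a segment from `x` sweep from `y` to `z`. At the first moment when the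
segment is not contained in `W`, let `w` be its first point outside `W`. The earlier segments fill a
half-disc at `w`, while the part of the current segment just before `w` lies in `W` and on the
bounding line: `w` is not a convex point. -/
theorem segment_subset_of_isConvexPoint {W : Set Plane} (hW : IsOpen W)
    (hgood : ∀ w ∉ W, IsConvexPoint W w) {x y z : Plane} (hxy : segment ℝ x y ⊆ W)
    (hyz : segment ℝ y z ⊆ W) : segment ℝ x z ⊆ W := by
  by_contra hxz
  set g : ℝ → Plane := fun t => y + t • (z - y) with hg
  have hgc : Continuous g := by fun_prop
  set Bad : Set ℝ := Set.Icc 0 1 ∩ {t | ¬ segment ℝ x (g t) ⊆ W} with hBad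
  have hBadc : IsClosed Bad :=
    isClosed_Icc.inter ((isOpen_segment_subset hW x).preimage hgc).isClosed_compl
  have hBadn : Bad.Nonempty := ⟨1, ⟨by norm_num, by norm_num⟩, by simpa [hg] using hxz⟩
  have hBadb : BddBelow Bad := ⟨0, fun t ht => ht.1.1⟩
  set T := sInf Bad with hT
  have hTmem : T ∈ Bad := hBadc.csInf_mem hBadn hBadb
  have hbefore : ∀ t, 0 ≤ t → t < T → segment ℝ x (g t) ⊆ W := by
    intro t h0 h1
    by_contra h
    exact (csInf_le hBadb ⟨⟨h0, h1.le.trans hTmem.1.2⟩, h⟩).not_gt h1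
  have hT0 : 0 < T := by
    refine lt_of_le_of_ne hTmem.1.1 fun h => hTmem.2 ?_
    rw [← h]; simpa [hg] using hxy
  have hgT : segment ℝ y (g T) ⊆ W := by
    refine Set.Subset.trans ((convex_segment y z).segment_subset (left_mem_segment ℝ _ _) ?_) hyz
    rw [segment_eq_image']
    exact ⟨T, hTmem.1, rfl⟩
  set D := g T - x with hD
  set E : Set ℝ := Set.Icc 0 1 ∩ {s | x + s • D ∉ W} with hE
  have hEc : IsClosed E :=
    isClosed_Icc.inter (hW.preimage (by fun_prop : Continuous fun s : ℝ => x + s • D)).isClosed_compl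
  have hEn : E.Nonempty := by
    obtain ⟨p, hp, hpW⟩ := Set.not_subset.1 hTmem.2
    rw [segment_eq_image'] at hp
    obtain ⟨s, hs, rfl⟩ := hp
    exact ⟨s, hs, hpW⟩
  have hEb : BddBelow E := ⟨0, fun t ht => ht.1.1⟩
  set s := sInf E with hs
  have hsmem : s ∈ E := hEc.csInf_mem hEn hEb
  have hxW : x ∈ W := hxy (left_mem_segment ℝ _ _)
  have hs0 : 0 < s := by
    refine lt_of_le_of_ne hsmem.1.1 fun h => hsmem.2 ?_
    rw [← h]; simpa using hxW
  have hs1 : s < 1 := by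
    refine lt_of_le_of_ne hsmem.1.2 fun h => hsmem.2 ?_
    rw [h, hD]; simpa using hgT (right_mem_segment ℝ _ _)
  have hwW : x + s • D ∉ W := hsmem.2
  have hD0 : D ≠ 0 := by
    intro h; rw [h] at hwW; simp [hxW] at hwW
  -- In the degenerate case the segment in question is covered by the segments from `x` to `y` and
  -- from `y` to `g T`, both in `W`.
  by_cases hc : wedge D (y - x) = 0
  · obtain ⟨r, hr⟩ := exists_smul_of_wedge_eq_zero hD0 hc
    rcases le_or_gt s r with hsr | hsr
    · refine hwW (hxy ?_)
      have hr0 : 0 < r := by linarith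
      rw [segment_eq_image']
      refine ⟨s / r, ⟨by positivity, by rw [div_le_one hr0]; exact hsr⟩, ?_⟩
      simp only [hr, smul_smul, div_mul_cancel₀ _ hr0.ne']
    · refine hwW (hgT ?_)
      have h1r : 0 < 1 - r := by linarith
      have hyx : y = x + r • D := by rw [← hr]; abel
      have hgy : g T - y = (1 - r) • D := by
        have : g T = x + D := by rw [hD]; abel
        rw [this, hyx]; module
      rw [segment_eq_image']
      refine ⟨(s - r) / (1 - r), ⟨div_nonneg (by linarith) h1r.le,
        by rw [div_le_one h1r]; linarith⟩, ?_⟩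
      simp only [hgy, smul_smul, div_mul_cancel₀ _ h1r.ne']
      rw [hyx]; module
  · have hc2 : 0 < wedge D (y - x) * wedge D (y - x) := mul_self_pos.2 hc
    set c := wedge D (y - x) with hcdef
    set w := x + s • D with hw
    have hαc : Continuous fun p => wedge D (p - x) / c :=
      (continuous_wedge_sub D x).div_const c
    have hβc : Continuous fun p => wedge (p - x) (y - x) / c := by
      unfold wedge; fun_prop
    have hα0 : wedge D (w - x) / c = 0 := by
      rw [hw, add_sub_cancel_left, wedge_smul_right, wedge_self]; simp
    have hβ0 : wedge (w - x) (y - x) / c = s := by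
      rw [hw, add_sub_cancel_left, wedge_smul_left, ← hcdef]; field_simp
    -- The factor `c` orients the line so that `y` is on the positive side, whatever the sign of
    -- `wedge D (y - x)`.
    have hhalf : ∀ᶠ p in 𝓝 w, 0 < wedge (c • D) (p - w) → p ∈ W := by
      have e1 : ∀ᶠ p in 𝓝 w, 0 < wedge (p - x) (y - x) / c :=
        hβc.continuousAt.eventually_const_lt (by beta_reduce; rw [hβ0]; exact hs0)
      have e2 : ∀ᶠ p in 𝓝 w, wedge D (p - x) / c + wedge (p - x) (y - x) / c < 1 :=
        (hαc.add hβc).continuousAt.eventually_lt_const (by rw [Pi.add_apply]; beta_reduce; rw [hα0, hβ0]; linarith)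
      filter_upwards [e1, e2] with p hβ hαβ hpos
      have hα : 0 < wedge D (p - x) / c := by
        have : wedge D (p - x) / c = wedge (c • D) (p - w) / (c * c) := by
          rw [hw, ← sub_sub, wedge_smul_left, wedge_sub_right D (p - x), wedge_smul_right,
            wedge_self]
          field_simp; ring
        rw [this]; positivity
      have hp : p - x = (wedge D (p - x) / c) • (y - x) + (wedge (p - x) (y - x) / c) • D := by
        have hc' : D 0 * (y 1 - x 1) - D 1 * (y 0 - x 0) ≠ 0 := hc
        rw [hcdef]
        refine plane_ext ?_ ?_ <;>
        · simp only [wedge, PiLp.add_apply, PiLp.sub_apply, PiLp.smul_apply, smul_eq_mul]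
          field_simp; ring
      set α := wedge D (p - x) / c
      set β := wedge (p - x) (y - x) / c
      have hab : 0 < α + β := by linarith
      have hτ : β / (α + β) < 1 := by rw [div_lt_one hab]; linarith
      -- With `p - x = α (y - x) + β D`, the line from `x` through `p` meets the side from `y` to `g
      -- T` at the time `β / (α + β) * T`, and `p` divides that segment in the ratio given by `α + β
      -- < 1`.
      refine hbefore (β / (α + β) * T) (by positivity) (by nlinarith) ?_
      rw [segment_eq_image']
      refine ⟨α + β, ⟨hab.le, hαβ.le⟩, ?_⟩
      have h1 : g (β / (α + β) * T) - x = (1 - β / (α + β)) • (y - x) + (β / (α + β)) • D := by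
        simp only [hD, hg]; module
      have h2 : p = x + (p - x) := by abel
      beta_reduce
      rw [h1, h2, hp, smul_add, smul_smul, smul_smul]
      congr 3 <;> (field_simp; try ring)
    have hline := hgood w hwW (c • D) (smul_ne_zero hc hD0) hhalf
    have hlt : ∀ᶠ t : ℝ in 𝓝[>] 0, t < s := nhdsWithin_le_nhds (eventually_lt_nhds hs0)
    obtain ⟨t, ⟨h1, h2⟩, ht⟩ := ((((tendsto_add_smul w (-D)).eventually hline).and hlt).and
      self_mem_nhdsWithin).exists
    have ht : 0 < t := ht
    have hnot := h1 (by
      rw [add_sub_cancel_left, wedge_smul_left, wedge_smul_right, wedge_neg_right, wedge_self]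
      simp)
    have heq : w + t • -D = x + (s - t) • D := by rw [hw]; module
    rw [heq] at hnot
    have := csInf_le hEb (⟨⟨by linarith, by linarith⟩, hnot⟩ : s - t ∈ E)
    linarith

/-- Mutual visibility within `W` is transitive by the preceding lemma and holds locally in an open
set, so it holds throughout a component. -/
theorem convex_connectedComponentIn {W : Set Plane} (hW : IsOpen W)
    (hgood : ∀ w ∉ W, IsConvexPoint W w) (x₀ : Plane) : Convex ℝ (connectedComponentIn W x₀) := by
  rw [convex_iff_segment_subset]
  intro x hx y hy
  have hsub : segment ℝ x y ⊆ W := by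
    refine (isPreconnected_connectedComponentIn (x := x₀) (F := W)).induction₂
      (fun a b => segment ℝ a b ⊆ W) (fun z hz => ?_)
      (fun a b c _ _ _ => segment_subset_of_isConvexPoint hW hgood)
      (fun a b _ _ h => by rwa [segment_symm]) hx hy
    obtain ⟨ε, hε, hball⟩ := Metric.isOpen_iff.1 hW z (connectedComponentIn_subset _ _ hz)
    refine nhdsWithin_le_nhds ?_
    filter_upwards [Metric.ball_mem_nhds z hε] with b hb
    exact ((convex_ball z ε).segment_subset (Metric.mem_ball_self hε) hb).trans hball
  rw [connectedComponentIn_eq hx]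
  exact (convex_segment x y).isPreconnected.subset_connectedComponentIn
    (left_mem_segment ℝ _ _) hsub

theorem eventually_mem_or_not_mem_of_ordConnected {A : Set ℝ} (hA : A.OrdConnected) :
    (∀ᶠ t in 𝓝[>] 0, t ∈ A) ∨ ∀ᶠ t in 𝓝[>] 0, t ∉ A := by
  by_cases h : ∃ᶠ t in 𝓝[>] (0 : ℝ), t ∈ A
  · left
    obtain ⟨t₁, h1, ht₁⟩ := (h.and_eventually self_mem_nhdsWithin).exists
    have ht₁ : 0 < t₁ := ht₁
    filter_upwards [Ioo_mem_nhdsGT ht₁] with t ht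
    obtain ⟨t₂, h2, ht₂⟩ := (h.and_eventually (Ioo_mem_nhdsGT ht.1)).exists
    exact hA.out h2 h1 ⟨ht₂.2.le, ht.2.le⟩
  · exact Or.inr (Filter.not_frequently.1 h)

theorem eventually_ray_mem_or_not_mem {C : Set Plane} (hC : Convex ℝ C) (v d : Plane) :
    (∀ᶠ t : ℝ in 𝓝[>] 0, v + t • d ∈ C) ∨ ∀ᶠ t : ℝ in 𝓝[>] 0, v + t • d ∉ C := by
  refine eventually_mem_or_not_mem_of_ordConnected (A := {t : ℝ | v + t • d ∈ C}) ?_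
  refine ⟨fun t₁ h₁ t₂ h₂ t ht => ?_⟩
  rcases eq_or_lt_of_le (ht.1.trans ht.2) with h | h
  · have : t = t₁ := le_antisymm (h ▸ ht.2) ht.1
    rwa [this]
  · have hpos : 0 < t₂ - t₁ := by linarith
    have := hC h₁ h₂ (a := (t₂ - t) / (t₂ - t₁)) (b := (t - t₁) / (t₂ - t₁))
      (div_nonneg (by linarith [ht.2]) hpos.le) (div_nonneg (by linarith [ht.1]) hpos.le)
      (by field_simp; ring)
    change v + t • d ∈ C
    convert this using 1
    have e : (t₂ - t) / (t₂ - t₁) = 1 - (t - t₁) / (t₂ - t₁) := by field_simp; ring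
    have e2 : t = t₁ + (t - t₁) / (t₂ - t₁) * (t₂ - t₁) := by field_simp; ring
    rw [e]
    nth_rewrite 1 [e2]
    module

/-! ### Cutting an open set into convex pieces -/

/-- A bounded open set in the course of its subdivision into convex sets: it has at most `k`
components, and its complement is made of convex points, except for those in `R`, from which the
set can be cut along the extension of a segment of the complement. -/
structure IsCutting (W : Set Plane) (k : ℕ) (R : Finset Plane) : Prop where
  isOpen : IsOpen W
  isBounded : Bornology.IsBounded W
  components : ∃ F : Finset Plane, F.card ≤ k ∧ ∀ y ∈ W, ∃ x ∈ F, y ∈ connectedComponentIn W x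
  -- This tameness decides whether the extension of an edge at a reflex vertex enters `W` or stays
  -- outside near the vertex.
  ray : ∀ v d : Plane, (∀ᶠ t : ℝ in 𝓝[>] 0, v + t • d ∈ W) ∨ ∀ᶠ t : ℝ in 𝓝[>] 0, v + t • d ∉ W
  convexPoint : ∀ w ∉ W, w ∉ R → IsConvexPoint W w
  not_mem : ∀ w ∈ R, w ∉ W
  exists_ray : ∀ w ∈ R, ∃ b : Plane, b ≠ 0 ∧ ∀ᶠ t : ℝ in 𝓝[>] 0, w + t • b ∉ W

/-- A ray that starts inside a bounded open set leaves it. -/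
theorem exists_exit_point {W : Set Plane} (hW : IsOpen W) (hb : Bornology.IsBounded W)
    {v d : Plane} (hd : d ≠ 0) (hray : ∀ᶠ t : ℝ in 𝓝[>] 0, v + t • d ∈ W) :
    ∃ T : ℝ, 0 < T ∧ v + T • d ∉ W ∧ ∀ t, 0 < t → t < T → v + t • d ∈ W := by
  obtain ⟨ε, hε, hsub⟩ := mem_nhdsGT_iff_exists_Ioo_subset.1 hray
  have hε : 0 < ε := hε
  -- Searching from `ε / 2` on keeps the infimum away from `0`, where `v` itself may lie outside
  -- `W`.
  set A : Set ℝ := Set.Ici (ε / 2) ∩ {t | v + t • d ∉ W} with hA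
  have hAc : IsClosed A :=
    isClosed_Ici.inter (hW.preimage (by fun_prop : Continuous fun t : ℝ => v + t • d)).isClosed_compl
  have hAb : BddBelow A := ⟨ε / 2, fun t ht => ht.1⟩
  have hAn : A.Nonempty := by
    obtain ⟨R, hR⟩ := hb.exists_norm_le
    have hdn : 0 < ‖d‖ := norm_pos_iff.2 hd
    refine ⟨max (ε / 2) ((R + ‖v‖ + 1) / ‖d‖), Set.mem_Ici.2 (le_max_left _ _), fun hmem => ?_⟩
    have h1 := hR _ hmem
    set t := max (ε / 2) ((R + ‖v‖ + 1) / ‖d‖) with ht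
    have ht0 : 0 ≤ t := le_max_of_le_left (by linarith)
    have h2 : R + ‖v‖ + 1 ≤ t * ‖d‖ := by
      rw [← div_le_iff₀ hdn]; exact le_max_right _ _
    have h3 : ‖t • d‖ ≤ ‖v + t • d‖ + ‖v‖ := by
      have := norm_sub_le (v + t • d) v
      rwa [add_sub_cancel_left] at this
    rw [norm_smul, Real.norm_eq_abs, abs_of_nonneg ht0] at h3
    linarith
  have hmem := hAc.csInf_mem hAn hAb
  refine ⟨sInf A, by have : ε / 2 ≤ sInf A := hmem.1; linarith, hmem.2, fun t h0 h1 => ?_⟩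
  by_cases ht : t < ε / 2
  · exact hsub ⟨h0, by linarith⟩
  · by_contra hn
    exact (csInf_le hAb ⟨not_lt.1 ht, hn⟩).not_gt h1

section cut

variable {W : Set Plane} {v e : Plane}

theorem isTwoRayCorner_cut (hW : IsOpen W) (hve : v ≠ e) (hsub : openSegment ℝ v e ⊆ W) {q : Plane}
    (hq : q ∈ openSegment ℝ v e) : IsTwoRayCorner (W \ segment ℝ v e)ᶜ q (e - v) (e - v) where
  left_ne := sub_ne_zero.2 hve.symm
  right_ne := sub_ne_zero.2 hve.symm
  straight := fun _ => ⟨1, one_pos, (one_smul _ _).symm⟩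
  mem_iff := by
    filter_upwards [eventually_mem_segment_iff hve hq, hW.mem_nhds (hsub hq)] with x h1 h2
    rw [← h1]
    simp [h2]

theorem isOpen_cut (hW : IsOpen W) : IsOpen (W \ segment ℝ v e) := by
  have : IsClosed (segment ℝ v e) := by
    rw [← convexHull_pair]
    exact (Set.toFinite _).isClosed_convexHull ℝ
  exact hW.sdiff this

theorem mem_openSegment_of_cut (hv : v ∉ W) (he : e ∉ W) {x : Plane} (hx : x ∈ W)
    (hxs : x ∈ segment ℝ v e) : x ∈ openSegment ℝ v e :=
  mem_openSegment_of_ne_left_right (fun h => hv (h ▸ hx)) (fun h => he (h ▸ hx)) hxs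

/-- Ensures that no vertex of the polygon is lost from the closure of the pieces while cutting. -/
theorem subset_closure_cut (hW : IsOpen W) (hve : v ≠ e) (hv : v ∉ W) (he : e ∉ W)
    (hsub : openSegment ℝ v e ⊆ W) : W ⊆ closure (W \ segment ℝ v e) := by
  intro x hx
  by_cases hxs : x ∈ segment ℝ v e
  · have hc := isTwoRayCorner_cut hW hve hsub (mem_openSegment_of_cut hv he hx hxs)
    rw [mem_closure_iff_frequently]
    refine ((hc.frequently_sector one_ne_zero).and_eventually (hc.eventually_not_mem 1)).mono ?_
    rintro z ⟨h1, h2⟩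
    exact Set.notMem_compl_iff.1 (h2 h1)
  · exact subset_closure ⟨hx, hxs⟩

theorem frequently_side_cut (hve : v ≠ e) (hsub : openSegment ℝ v e ⊆ W)
    {q q' : Plane} (hq : q ∈ openSegment ℝ v e) (hq' : q' ∈ openSegment ℝ v e) {σ : ℝ} (hσ : σ ≠ 0)
    {y : Plane} (hK : ∀ᶠ x in 𝓝 q, 0 < σ * wedge (e - v) (x - q) →
      x ∈ connectedComponentIn (W \ segment ℝ v e) y) (hW : IsOpen W) :
    ∀ᶠ x in 𝓝 q', 0 < σ * wedge (e - v) (x - q') →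
      x ∈ connectedComponentIn (W \ segment ℝ v e) y := by
  have hline : ∀ x ∈ segment ℝ v e, wedge (e - v) (x - q) = 0 := by
    intro x hx
    have hq := openSegment_subset_segment ℝ _ _ hq
    rw [segment_eq_image'] at hx hq
    obtain ⟨s, -, rfl⟩ := hx
    obtain ⟨t, -, rfl⟩ := hq
    have : v + s • (e - v) - (v + t • (e - v)) = (s - t) • (e - v) := by module
    simp only [this, wedge_smul_right, wedge_self, mul_zero]
  obtain ⟨c, hc⟩ := exists_smul_of_wedge_eq_zero (sub_ne_zero.2 hve.symm)
    (hline q' (openSegment_subset_segment ℝ _ _ hq'))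
  have := frequently_side_of_segment (W := W \ segment ℝ v e) hW (sub_ne_zero.2 hve.symm)
    (((convex_openSegment v e).segment_subset hq hq').trans hsub) hc hσ (fun x hx hpos => ⟨hx,
      fun hxs => by rw [hline x hxs, mul_zero] at hpos; exact lt_irrefl _ hpos⟩) hK
  have hcor := isTwoRayCorner_cut hW hve hsub hq'
  have h2 := hcor.eventually_mem_component hσ (y := y) (by
    simpa only [mem_sector_self, compl_compl] using this)
  simpa only [mem_sector_self, compl_compl] using h2

/-- Cutting an open set along a chord increases the number of components by at most one. -/
theorem components_cut (hW : IsOpen W) (hve : v ≠ e) (hv : v ∉ W) (he : e ∉ W)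
    (hsub : openSegment ℝ v e ⊆ W) {k : ℕ}
    (hF : ∃ F : Finset Plane, F.card ≤ k ∧ ∀ y ∈ W, ∃ x ∈ F, y ∈ connectedComponentIn W x) :
    ∃ F : Finset Plane, F.card ≤ k + 1 ∧
      ∀ y ∈ W \ segment ℝ v e, ∃ x ∈ F, y ∈ connectedComponentIn (W \ segment ℝ v e) x := by
  classical
  obtain ⟨F, hFk, hF⟩ := hF
  set W' := W \ segment ℝ v e with hW'
  have hW'o : IsOpen W' := isOpen_cut hW
  obtain ⟨q, hq⟩ : (openSegment ℝ v e).Nonempty :=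
    ⟨midpoint ℝ v e, midpoint_mem_openSegment v e⟩
  have hcor := isTwoRayCorner_cut hW hve hsub hq
  obtain ⟨y₁, hy₁, h₁⟩ := hcor.exists_component one_ne_zero
  obtain ⟨y₂, hy₂, h₂⟩ := hcor.exists_component (σ := -1) (by norm_num)
  simp only [mem_sector_self, compl_compl] at h₁ h₂
  rw [← hW', Set.notMem_compl_iff] at hy₁ hy₂
  obtain ⟨x₀, hx₀F, hqx₀⟩ := hF q (hsub hq)
  have hsegC : openSegment ℝ v e ⊆ connectedComponentIn W x₀ := by
    rw [connectedComponentIn_eq hqx₀]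
    exact (convex_openSegment v e).isPreconnected.subset_connectedComponentIn hq hsub
  -- The component containing the chord consists of the chord and the components on its two sides:
  -- that union is open, and relatively closed in the old component.
  have hcover : connectedComponentIn W x₀ ⊆ connectedComponentIn W' y₁ ∪
      connectedComponentIn W' y₂ ∪ openSegment ℝ v e := by
    refine isPreconnected_connectedComponentIn.subset_of_closure_inter_subset ?_
      ⟨q, hqx₀, Or.inr hq⟩ ?_
    · rw [isOpen_iff_mem_nhds]
      rintro a ((ha | ha) | ha)
      · filter_upwards [hW'o.connectedComponentIn.mem_nhds ha] with x hx using Or.inl (Or.inl hx)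
      · filter_upwards [hW'o.connectedComponentIn.mem_nhds ha] with x hx using Or.inl (Or.inr hx)
      · have hca := isTwoRayCorner_cut hW hve hsub ha
        filter_upwards [frequently_side_cut hve hsub hq ha one_ne_zero h₁ hW,
          frequently_side_cut hve hsub hq ha (by norm_num) h₂ hW,
          hca.eventually_mem_sector one_ne_zero, hW.mem_nhds (hsub ha)] with x hx₁ hx₂ hx₃ hxW
        simp only [mem_sector_self] at hx₃
        by_cases hxs : x ∈ segment ℝ v e
        · exact Or.inr (mem_openSegment_of_cut hv he hxW hxs)
        · rcases hx₃ (by simp [hxW, hxs]) with h | h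
          · exact Or.inl (Or.inl (hx₁ h))
          · exact Or.inl (Or.inr (hx₂ h))
    · rintro z ⟨hz, hzC⟩
      have hzW := connectedComponentIn_subset _ _ hzC
      by_cases hzs : z ∈ segment ℝ v e
      · exact Or.inr (mem_openSegment_of_cut hv he hzW hzs)
      · have hzW' : z ∈ W' := ⟨hzW, hzs⟩
        obtain ⟨a, haz, ha⟩ := mem_closure_iff_nhds.1 hz _
          (hW'o.connectedComponentIn.mem_nhds (mem_connectedComponentIn hzW'))
        have hback : ∀ y, a ∈ connectedComponentIn W' y → z ∈ connectedComponentIn W' y := by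
          intro y hay
          rw [connectedComponentIn_eq hay, ← connectedComponentIn_eq haz]
          exact mem_connectedComponentIn hzW'
        rcases ha with (ha | ha) | ha
        · exact Or.inl (Or.inl (hback _ ha))
        · exact Or.inl (Or.inr (hback _ ha))
        · exact absurd (openSegment_subset_segment ℝ _ _ ha) (connectedComponentIn_subset _ _ haz).2
  -- The representative of the divided component is replaced by one for each side; the other
  -- components do not meet the chord.
  refine ⟨insert y₁ (insert y₂ (F.erase x₀)), ?_, ?_⟩
  · have h1 := Finset.card_insert_le y₁ (insert y₂ (F.erase x₀))
    have h2 := Finset.card_insert_le y₂ (F.erase x₀)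
    have h3 := Finset.card_erase_add_one hx₀F
    omega
  · intro y hy
    obtain ⟨x, hxF, hyx⟩ := hF y hy.1
    by_cases hx : connectedComponentIn W x = connectedComponentIn W x₀
    · rw [hx] at hyx
      rcases hcover hyx with (h | h) | h
      · exact ⟨y₁, by simp, h⟩
      · exact ⟨y₂, by simp, h⟩
      · exact absurd (openSegment_subset_segment ℝ _ _ h) hy.2
    · refine ⟨x, ?_, ?_⟩
      · refine Finset.mem_insert_of_mem (Finset.mem_insert_of_mem (Finset.mem_erase.2 ⟨?_, hxF⟩))
        rintro rfl; exact hx rfl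
      · have hxW : x ∈ W := by
          by_contra h
          rw [connectedComponentIn_eq_empty h] at hyx
          exact hyx
        refine isPreconnected_connectedComponentIn.subset_connectedComponentIn (F := W')
          (mem_connectedComponentIn hxW) (fun z hz => ⟨connectedComponentIn_subset _ _ hz,
            fun hzs => hx ?_⟩) hyx
        have := hsegC (mem_openSegment_of_cut hv he (connectedComponentIn_subset _ _ hz) hzs)
        rw [connectedComponentIn_eq hz, connectedComponentIn_eq this]

end cut

/-- Extending the ray `b` of the complement backwards through `v` gives `v` two opposite rays of the
complement, which makes it a convex point. If the extension already avoids `W` near `v`, nothing has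
to be cut; otherwise the cut runs to the first exit point. New points of the complement lie inside
the cut and have opposite rays along it. -/
theorem IsCutting.step {W : Set Plane} {k : ℕ} {R : Finset Plane} {v : Plane}
    (h : IsCutting W k (insert v R)) :
    ∃ W' ⊆ W, IsCutting W' (k + 1) R ∧ W ⊆ closure W' := by
  have hvW := h.not_mem v (Finset.mem_insert_self _ _)
  obtain ⟨b, hb, hbray⟩ := h.exists_ray v (Finset.mem_insert_self _ _)
  rcases h.ray v (-b) with hr | hr
  · obtain ⟨T, hT0, hTW, hTin⟩ := exists_exit_point h.isOpen h.isBounded (neg_ne_zero.2 hb) hr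
    set e := v + T • -b with he
    have hev : e - v = T • -b := by rw [he]; abel
    have hve : v ≠ e := by
      intro hve
      rw [← hve, sub_self, eq_comm, smul_eq_zero] at hev
      rcases hev with h | h
      · exact hT0.ne' h
      · exact hb (neg_eq_zero.1 h)
    have hsub : openSegment ℝ v e ⊆ W := by
      rw [openSegment_eq_image']
      rintro _ ⟨s, ⟨h0, h1⟩, rfl⟩
      simp only [hev, smul_smul]
      exact hTin _ (by positivity) (by nlinarith)
    refine ⟨W \ segment ℝ v e, Set.sdiff_subset, ⟨isOpen_cut h.isOpen,
      h.isBounded.subset Set.sdiff_subset,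
      components_cut h.isOpen hve hvW hTW hsub h.components, ?_, ?_, ?_, ?_⟩,
      subset_closure_cut h.isOpen hve hvW hTW hsub⟩
    · intro w d
      rcases h.ray w d with h1 | h1
      · rcases eventually_ray_mem_or_not_mem (convex_segment v e) w d with h2 | h2
        · exact Or.inr (h2.mono fun t ht h => h.2 ht)
        · exact Or.inl ((h1.and h2).mono fun t ht => ht)
      · exact Or.inr (h1.mono fun t ht h => ht h.1)
    · intro w hw hwR
      by_cases hwW : w ∈ W
      · have hws : w ∈ segment ℝ v e := by
          by_contra hws; exact hw ⟨hwW, hws⟩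
        have hwo := mem_openSegment_of_cut hvW hTW hwW hws
        rw [openSegment_eq_image'] at hwo
        obtain ⟨s, ⟨h0, h1⟩, rfl⟩ := hwo
        refine isConvexPoint_of_opposite_rays (sub_ne_zero.2 hve.symm) hw ?_ ?_
        · filter_upwards [Ioo_mem_nhdsGT (sub_pos.2 h1)] with t ht h
          refine h.2 ?_
          rw [segment_eq_image']
          exact ⟨s + t, ⟨by linarith [ht.1], by linarith [ht.2]⟩, by module⟩
        · filter_upwards [Ioo_mem_nhdsGT h0] with t ht h
          refine h.2 ?_
          rw [segment_eq_image']
          exact ⟨s - t, ⟨by linarith [ht.2], by linarith [ht.1]⟩, by module⟩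
      · by_cases hwv : w = v
        · subst hwv
          refine isConvexPoint_of_opposite_rays hb hw (hbray.mono fun t ht h => ht h.1) ?_
          filter_upwards [Ioo_mem_nhdsGT hT0] with t ht h
          refine h.2 ?_
          rw [segment_eq_image']
          refine ⟨t / T, ⟨div_nonneg ht.1.le hT0.le, by rw [div_le_one hT0]; exact ht.2.le⟩, ?_⟩
          simp only [hev, smul_smul, div_mul_cancel₀ _ hT0.ne']
        · exact (h.convexPoint w hwW (by simp [hwv, hwR])).mono Set.sdiff_subset
    · exact fun w hw hwW => h.not_mem w (Finset.mem_insert_of_mem hw) hwW.1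
    · intro w hw
      obtain ⟨b, hb, hr⟩ := h.exists_ray w (Finset.mem_insert_of_mem hw)
      exact ⟨b, hb, hr.mono fun t ht h => ht h.1⟩
  · refine ⟨W, subset_rfl, ⟨h.isOpen, h.isBounded, ?_, h.ray, ?_, ?_, ?_⟩, subset_closure⟩
    · obtain ⟨F, hFk, hF⟩ := h.components
      exact ⟨F, by omega, hF⟩
    · intro w hw hwR
      by_cases hwv : w = v
      · subst hwv
        exact isConvexPoint_of_opposite_rays hb hw hbray hr
      · exact h.convexPoint w hw (by simp [hwv, hwR])
    · exact fun w hw => h.not_mem w (Finset.mem_insert_of_mem hw)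
    · exact fun w hw => h.exists_ray w (Finset.mem_insert_of_mem hw)

theorem IsCutting.exists_convex {R : Finset Plane} : ∀ {W : Set Plane} {k : ℕ}, IsCutting W k R →
    ∃ W' ⊆ W, IsCutting W' (k + R.card) ∅ ∧ W ⊆ closure W' := by
  classical
  induction R using Finset.induction_on with
  | empty => exact fun h => ⟨_, subset_rfl, h, subset_closure⟩
  | insert v R hv ih =>
    intro W k h
    obtain ⟨W₁, h₁W, h₁, hc₁⟩ := h.step
    obtain ⟨W₂, h₂W, h₂, hc₂⟩ := ih h₁
    refine ⟨W₂, h₂W.trans h₁W, ?_, hc₁.trans (closure_minimal hc₂ isClosed_closure)⟩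
    rw [Finset.card_insert_of_notMem hv, show k + (R.card + 1) = k + 1 + R.card by ring]
    exact h₂

/-! ### Convex pieces of the inside of a polygon -/

namespace SimplePolygon

variable {P : SimplePolygon}

theorem ray_mem_comp_or_not_mem (y v d : Plane) :
    (∀ᶠ t : ℝ in 𝓝[>] 0, v + t • d ∈ P.comp y) ∨ ∀ᶠ t : ℝ in 𝓝[>] 0, v + t • d ∉ P.comp y := by
  by_cases h : ∃ i, ∀ᶠ t : ℝ in 𝓝[>] 0, v + t • d ∈ P.edge i
  · obtain ⟨i, hi⟩ := h
    exact Or.inr (hi.mono fun t ht h => P.comp_subset y h (P.mem_boundary.2 ⟨i, ht⟩))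
  · have hB : ∀ᶠ t : ℝ in 𝓝[>] 0, v + t • d ∉ P.boundary := by
      have : ∀ᶠ t : ℝ in 𝓝[>] 0, ∀ i, v + t • d ∉ P.edge i := by
        rw [Filter.eventually_all]
        intro i
        exact (eventually_ray_mem_or_not_mem (convex_segment _ _) v d).resolve_left
          fun h' => h ⟨i, h'⟩
      filter_upwards [this] with t ht hB
      obtain ⟨i, hi⟩ := P.mem_boundary.1 hB
      exact ht i hi
    obtain ⟨ε, hε, hsub⟩ := mem_nhdsGT_iff_exists_Ioo_subset.1 hB
    have hpre : IsPreconnected ((fun t : ℝ => v + t • d) '' Set.Ioo 0 ε) :=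
      isPreconnected_Ioo.image _ (by fun_prop)
    have himg : (fun t : ℝ => v + t • d) '' Set.Ioo 0 ε ⊆ P.boundaryᶜ := by
      rintro _ ⟨t, ht, rfl⟩
      exact hsub ht
    by_cases hex : ∃ t ∈ Set.Ioo 0 ε, v + t • d ∈ P.comp y
    · left
      obtain ⟨t, ht, hty⟩ := hex
      filter_upwards [Ioo_mem_nhdsGT (Set.mem_Ioi.1 hε)] with s hs
      rw [← comp_eq hty]
      exact hpre.subset_connectedComponentIn ⟨t, ht, rfl⟩ himg ⟨s, hs, rfl⟩
    · right
      filter_upwards [Ioo_mem_nhdsGT (Set.mem_Ioi.1 hε)] with s hs h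
      exact hex ⟨s, hs, h⟩

theorem eventually_ray_mem_edge (i : Fin (P.m + 3)) :
    ∀ᶠ t : ℝ in 𝓝[>] 0, P.vertex i + t • P.edgeVec i ∈ P.edge i := by
  filter_upwards [Ioo_mem_nhdsGT (zero_lt_one' ℝ)] with t ht
  exact P.mem_edge.2 ⟨t, ht.1.le, ht.2.le, rfl⟩

theorem eventually_ray_mem_edge_neg (i : Fin (P.m + 3)) :
    ∀ᶠ t : ℝ in 𝓝[>] 0, P.vertex (i + 1) + t • -P.edgeVec i ∈ P.edge i := by
  filter_upwards [Ioo_mem_nhdsGT (zero_lt_one' ℝ)] with t ht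
  exact P.mem_edge'.2 ⟨t, ht.1.le, ht.2.le, by module⟩

theorem not_mem_comp_of_mem_edge {i : Fin (P.m + 3)} {x : Plane} (y : Plane) (h : x ∈ P.edge i) :
    x ∉ P.comp y := fun hx => P.comp_subset y hx (P.mem_boundary.2 ⟨i, h⟩)

/-- At a straight vertex the two edges give opposite rays. At a strictly convex one no half-disc
fits into the component: its normal would point into the sector of the other component, which is
wider than a half-plane. -/
theorem isConvexPoint_vertex {σ : ℝ} {y y' : Plane} {i : Fin (P.m + 3)}
    (h' : P.VertexSide (-σ) i y') (hdisj : Disjoint (P.comp y) (P.comp y'))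
    (hpos : 0 ≤ σ * wedge (P.edgeVec i) (P.edgeVec (i + 1))) (hσ : σ ≠ 0) :
    IsConvexPoint (P.comp y) (P.vertex (i + 1)) := by
  have hray₁ := (eventually_ray_mem_edge_neg i).mono fun t ht => not_mem_comp_of_mem_edge y ht
  have hray₂ := (eventually_ray_mem_edge (i + 1)).mono fun t ht => not_mem_comp_of_mem_edge y ht
  rcases eq_or_lt_of_le hpos with h0 | h0
  · have h0 : wedge (P.edgeVec i) (P.edgeVec (i + 1)) = 0 := by simpa [hσ] using h0.symm
    obtain ⟨s, hs, hsv⟩ := P.exists_pos_smul_of_wedge_eq_zero h0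
    refine isConvexPoint_of_opposite_rays (P.edgeVec_ne i)
      (not_mem_comp_of_mem_edge y (P.vertex_mem_edge _)) ?_ hray₁
    filter_upwards [Ioo_mem_nhdsGT hs] with t ht
    refine not_mem_comp_of_mem_edge (i := i + 1) y (P.mem_edge.2 ⟨t / s, div_nonneg ht.1.le hs.le,
      by rw [div_le_one hs]; exact ht.2.le, ?_⟩)
    rw [hsv, smul_smul, div_mul_cancel₀ _ hs.ne']
  · intro d hd hhalf
    exfalso
    set a := P.edgeVec i
    set b := P.edgeVec (i + 1)
    have key : ∀ c, (∀ᶠ t : ℝ in 𝓝[>] 0, P.vertex (i + 1) + t • c ∉ P.comp y) → wedge d c ≤ 0 := by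
      intro c hc
      by_contra! hpos
      obtain ⟨t, ⟨h1, h2⟩, ht⟩ := ((((tendsto_add_smul _ c).eventually hhalf).and hc).and
        self_mem_nhdsWithin).exists
      have ht : 0 < t := ht
      exact h2 (h1 (by rw [add_sub_cancel_left, wedge_smul_right]; positivity))
    have ha := key _ hray₁
    have hb := key _ hray₂
    rw [wedge_neg_right] at ha
    have hn := wedge_quarterTurn_pos hd
    set n := quarterTurn d
    have hid : wedge a b * wedge d n = wedge a n * wedge d b - wedge b n * wedge d a := by
      simp only [wedge]; ring
    have hsec : ∀ t : ℝ, 0 < t → t • n ∈ sector (-σ) a b := by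
      intro t ht
      refine Or.inr ⟨by linarith, ?_⟩
      simp only [wedge_smul_right]
      have : 0 < -σ * wedge a n ∨ 0 < -σ * wedge b n := by
        by_contra! hcon
        have h1 : 0 < (σ * wedge a b) * wedge d n := mul_pos h0 hn
        have h2 : (σ * wedge a b) * wedge d n =
            (-σ * wedge a n) * (-wedge d b) + (-σ * wedge b n) * wedge d a := by
          rw [mul_assoc, hid]; ring
        have h3 : (-σ * wedge a n) * (-wedge d b) ≤ 0 :=
          mul_nonpos_of_nonpos_of_nonneg hcon.1 (by linarith)
        have h4 : (-σ * wedge b n) * wedge d a ≤ 0 :=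
          mul_nonpos_of_nonpos_of_nonneg hcon.2 (by linarith)
        linarith
      refine this.imp (fun h => ?_) (fun h => ?_) <;> nlinarith [mul_pos ht h]
    obtain ⟨t, ⟨h1, h2⟩, ht⟩ := ((((tendsto_add_smul (P.vertex (i + 1)) n).eventually hhalf).and
      ((tendsto_add_smul (P.vertex (i + 1)) n).eventually h')).and self_mem_nhdsWithin).exists
    have ht : 0 < t := ht
    rw [add_sub_cancel_left] at h1 h2
    exact Set.disjoint_left.1 hdisj (h1 (by rw [wedge_smul_right]; positivity)) (h2 (hsec t ht))

theorem isConvexPoint_of_mem_openSegment {i : Fin (P.m + 3)} {w : Plane} (y : Plane)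
    (hw : w ∈ openSegment ℝ (P.vertex i) (P.vertex (i + 1))) : IsConvexPoint (P.comp y) w := by
  have hwe := P.openSegment_subset_edge i hw
  rw [openSegment_eq_image'] at hw
  obtain ⟨s, ⟨h0, h1⟩, rfl⟩ := hw
  refine isConvexPoint_of_opposite_rays (P.edgeVec_ne i) (not_mem_comp_of_mem_edge y hwe) ?_ ?_
  · filter_upwards [Ioo_mem_nhdsGT (sub_pos.2 h1)] with t ht
    exact not_mem_comp_of_mem_edge y (P.mem_edge.2
      ⟨s + t, by linarith [ht.1], by linarith [ht.2], by simp only [edgeVec]; module⟩)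
  · filter_upwards [Ioo_mem_nhdsGT h0] with t ht
    exact not_mem_comp_of_mem_edge y (P.mem_edge.2
      ⟨s - t, by linarith [ht.2], by linarith [ht.1], by simp only [edgeVec]; module⟩)

theorem exists_wedge_pos_near {d : Plane} (hd : d ≠ 0) (w : Plane) :
    ∃ᶠ x in 𝓝 w, 0 < wedge d (x - w) := by
  refine (tendsto_add_smul w (quarterTurn d)).frequently (Filter.Eventually.frequently ?_)
  filter_upwards [self_mem_nhdsWithin] with t ht
  have ht : 0 < t := ht
  rw [add_sub_cancel_left, wedge_smul_right]
  exact mul_pos ht (wedge_quarterTurn_pos hd)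

/-- A simple polygon with `r` reflex vertices can be cut into at most `r + 1` convex pieces. -/
theorem exists_convex_pieces (P : SimplePolygon) : ∃ F : Finset Plane, ∃ C : Plane → Set Plane,
    F.card ≤ P.reflexCount + 1 ∧ (∀ x, IsOpen (C x) ∧ Convex ℝ (C x) ∧ C x ⊆ P.boundaryᶜ) ∧
    ∀ i, ∃ x ∈ F, P.vertex i ∈ closure (C x) := by
  classical
  obtain ⟨σ, hσ1, y, y', hy, hy', hs, hs', hin, hdisj⟩ := P.exists_inside_side
  have hσ : σ ≠ 0 := by rcases hσ1 with rfl | rfl <;> norm_num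
  have hreflex : ∀ i, P.IsReflex (i + 1) ↔ σ * wedge (P.edgeVec i) (P.edgeVec (i + 1)) < 0 :=
    fun i => isReflex_iff hσ (hs i) (hs' i) hin hdisj
  set R : Finset Plane := (Finset.univ.filter fun i => P.IsReflex i).image P.vertex with hR
  have hRcard : R.card ≤ P.reflexCount := by
    refine Finset.card_image_le.trans ?_
    rw [reflexCount, Set.ncard_eq_toFinset_card', Set.toFinset_ofPred]
  have hcut : IsCutting (P.comp y) 1 R := by
    refine ⟨isOpen_comp y, ?_, ⟨{y}, by simp, fun z hz => ⟨y, by simp, ?_⟩⟩,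
      ray_mem_comp_or_not_mem y, ?_, ?_, ?_⟩
    · have : y ∈ P.inside := hin ▸ mem_comp hy
      exact this.2
    · have hyy : IsPreconnected (P.comp y) := isPreconnected_connectedComponentIn
      exact hyy.subset_connectedComponentIn (mem_comp hy) subset_rfl hz
    · intro w hw hwR
      by_cases hwB : w ∈ P.boundary
      · obtain ⟨i, hi⟩ := P.mem_boundary.1 hwB
        have hvert : ∀ j, w = P.vertex (j + 1) → IsConvexPoint (P.comp y) w := by
          rintro j rfl
          refine isConvexPoint_vertex (hs' j) hdisj ?_ hσ
          by_contra! hneg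
          exact hwR (Finset.mem_image.2 ⟨j + 1, by simpa using (hreflex j).2 hneg, rfl⟩)
        by_cases h1 : w = P.vertex i
        · exact hvert (i - 1) (by rw [sub_add_cancel, h1])
        by_cases h2 : w = P.vertex (i + 1)
        · exact hvert i h2
        exact isConvexPoint_of_mem_openSegment y (P.mem_openSegment_of_mem_edge hi h1 h2)
      · intro d hd hhalf
        exfalso
        obtain ⟨x, hx, hxy, hxw⟩ := ((exists_wedge_pos_near hd w).and_eventually
          (hhalf.and ((isOpen_comp w).mem_nhds (mem_comp hwB)))).exists
        exact hw (by rw [← comp_eq (hxy hx), comp_eq hxw]; exact mem_comp hwB)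
    · intro w hw
      obtain ⟨i, -, rfl⟩ := Finset.mem_image.1 hw
      exact not_mem_comp_of_mem_edge y (P.vertex_mem_edge i)
    · intro w hw
      obtain ⟨i, -, rfl⟩ := Finset.mem_image.1 hw
      exact ⟨P.edgeVec i, P.edgeVec_ne i, (eventually_ray_mem_edge i).mono
        fun t ht => not_mem_comp_of_mem_edge y ht⟩
  obtain ⟨W, hWy, hW, hcl⟩ := hcut.exists_convex
  obtain ⟨F, hFk, hF⟩ := hW.components
  refine ⟨F, connectedComponentIn W, by omega, fun x => ⟨hW.isOpen.connectedComponentIn,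
    convex_connectedComponentIn hW.isOpen (fun w hw => hW.convexPoint w hw (by simp)) x,
    (connectedComponentIn_subset _ _).trans (hWy.trans (P.comp_subset y))⟩, fun i => ?_⟩
  have hvy : P.vertex i ∈ closure (P.comp y) := by
    obtain ⟨j, rfl⟩ : ∃ j, i = j + 1 := ⟨i - 1, by rw [sub_add_cancel]⟩
    rw [mem_closure_iff_frequently]
    exact (((P.isTwoRayCorner_vertex j).frequently_sector hσ).and_eventually (hs j)).mono
      fun x hx => hx.2 hx.1
  have hvW : P.vertex i ∈ closure (⋃ x ∈ F, connectedComponentIn W x) := by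
    refine closure_mono ?_ (closure_minimal hcl isClosed_closure hvy)
    intro z hz
    obtain ⟨x, hx, hzx⟩ := hF z hz
    exact Set.mem_biUnion hx hzx
  rw [Finset.closure_biUnion] at hvW
  obtain ⟨x, hx, hxv⟩ := Set.mem_iUnion₂.1 hvW
  exact ⟨x, hx, hxv⟩

end SimplePolygon

/-! ### The lower bound: pairs on a parabola -/

/-- A convex open set contains the open triangles whose vertices lie in its closure. -/
theorem mem_of_mem_triangle {C : Set Plane} (hC : IsOpen C) (hconv : Convex ℝ C) {p q r z : Plane}
    (hp : p ∈ closure C) (hq : q ∈ closure C) (hr : r ∈ closure C)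
    (h₁ : 0 < wedge (p - z) (q - z)) (h₂ : 0 < wedge (q - z) (r - z))
    (h₃ : 0 < wedge (r - z) (p - z)) : z ∈ C := by
  have hne : (interior C).Nonempty := by
    rw [hC.interior_eq]
    exact closure_nonempty_iff.1 ⟨p, hp⟩
  rw [← hC.interior_eq, ← hconv.interior_closure_eq_interior_of_nonempty_interior hne,
    mem_interior]
  refine ⟨{z | 0 < wedge (p - z) (q - z) ∧ 0 < wedge (q - z) (r - z) ∧ 0 < wedge (r - z) (p - z)},
    ?_, ?_, h₁, h₂, h₃⟩
  · rintro z ⟨h₁, h₂, h₃⟩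
    set γ := wedge (p - z) (q - z) with hγ
    set α := wedge (q - z) (r - z) with hα
    set β := wedge (r - z) (p - z) with hβ
    have hs : 0 < α + β + γ := by linarith
    -- Barycentric coordinates are the areas of the three triangles with apex `z`, normalized. It
    -- suffices to place a neighbourhood in the closure, since a convex open set is the interior of
    -- its closure.
    have hz : z = (α / (α + β + γ)) • p + (β / (α + β + γ)) • q + (γ / (α + β + γ)) • r := by
      refine plane_ext ?_ ?_ <;>
      · simp only [PiLp.add_apply, PiLp.smul_apply, smul_eq_mul]
        field_simp
        simp only [hα, hβ, hγ, wedge, PiLp.sub_apply]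
        ring
    have hab : 0 < α + β := by linarith
    have hpq := hconv.closure hp hq (a := α / (α + β)) (b := β / (α + β)) (by positivity)
      (by positivity) (by field_simp)
    have := hconv.closure hpq hr (a := (α + β) / (α + β + γ)) (b := γ / (α + β + γ)) (by positivity)
      (by positivity) (by field_simp)
    rw [hz]
    convert this using 1
    rw [smul_add, smul_smul, smul_smul]
    congr 3 <;> field_simp
  · have hc : ∀ a b : Plane, Continuous fun z => wedge (a - z) (b - z) := by
      intro a b; unfold wedge; fun_prop
    exact (isOpen_lt continuous_const (hc p q)).inter
      ((isOpen_lt continuous_const (hc q r)).inter (isOpen_lt continuous_const (hc r p)))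

/-- The point of the parabola `y = -x²` with abscissa `t`. -/
noncomputable def parabolaPt (t : ℝ) : Plane := !₂[t, -t ^ 2]

/-- The point at depth `h` below the point of the parabola `y = -x²` with abscissa `c`. -/
noncomputable def belowPt (c h : ℝ) : Plane := !₂[c, -c ^ 2 - h]

/-- The chord over `c + s` and `c + t` passes the abscissa `c` at depth `-(s * t)` below the
parabola, so the sign of `h + s * t` tells whether the point at depth `h` is below or above the
chord. -/
theorem wedge_parabolaPt (c h s t : ℝ) :
    wedge (parabolaPt (c + s) - belowPt c h) (parabolaPt (c + t) - belowPt c h) =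
      (s - t) * (h + s * t) := by
  simp [wedge, parabolaPt, belowPt]
  ring

section lowerBoundSet

variable {C : Set Plane} {c δ h : ℝ}

/-- The point is below the chord of the pair, at depth `δ ^ 2`, and above the chord from the left
point of the pair to the third point, at depth `δ * t`; the latter holds exactly for `t > δ + 1 /
2`. -/
theorem belowPt_mem_of_pair_of_right (hC : IsOpen C) (hconv : Convex ℝ C) {t : ℝ} (hδ : 0 < δ)
    (h₁ : parabolaPt (c + -δ) ∈ closure C) (h₂ : parabolaPt (c + δ) ∈ closure C)
    (h₃ : parabolaPt (c + t) ∈ closure C) (ht : δ + 1 / 2 < t) :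
    belowPt c (δ ^ 2 + δ / 2) ∈ C := by
  refine mem_of_mem_triangle hC hconv h₁ h₃ h₂ ?_ ?_ ?_ <;> rw [wedge_parabolaPt]
  · exact mul_pos_of_neg_of_neg (by linarith) (by nlinarith)
  · exact mul_pos (by linarith) (by nlinarith)
  · exact mul_pos (by linarith) (by nlinarith)

theorem belowPt_mem_of_pair_of_left (hC : IsOpen C) (hconv : Convex ℝ C) {t : ℝ} (hδ : 0 < δ)
    (h₁ : parabolaPt (c + -δ) ∈ closure C) (h₂ : parabolaPt (c + δ) ∈ closure C)
    (h₃ : parabolaPt (c + t) ∈ closure C) (ht : δ + 1 / 2 < -t) :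
    belowPt c (δ ^ 2 + δ / 2) ∈ C := by
  refine mem_of_mem_triangle hC hconv h₃ h₂ h₁ ?_ ?_ ?_ <;> rw [wedge_parabolaPt]
  · exact mul_pos_of_neg_of_neg (by linarith) (by nlinarith)
  · exact mul_pos (by linarith) (by nlinarith)
  · exact mul_pos (by linarith) (by nlinarith)

/-- The long chord is at depth at least `9 / 16 > 1 / 2` over `c`. The bounds on `|x| * -u` and `|x|
* v` put the point below the lines of the two short chords. -/
theorem belowPt_mem_of_three (hC : IsOpen C) (hconv : Convex ℝ C) {u x v : ℝ}
    (h₁ : parabolaPt (c + u) ∈ closure C) (h₂ : parabolaPt (c + x) ∈ closure C)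
    (h₃ : parabolaPt (c + v) ∈ closure C) (hu : u ≤ -(3 / 4)) (hv : 3 / 4 ≤ v)
    (hx : |x| < 1 / 4) (hux : |x| * -u < 1 / 2) (hvx : |x| * v < 1 / 2) :
    belowPt c (1 / 2) ∈ C := by
  have hx1 := le_abs_self x
  have hx2 := neg_abs_le x
  refine mem_of_mem_triangle hC hconv h₁ h₃ h₂ ?_ ?_ ?_ <;> rw [wedge_parabolaPt]
  · exact mul_pos_of_neg_of_neg (by linarith) (by nlinarith)
  · exact mul_pos (by linarith) (by nlinarith)
  · exact mul_pos (by linarith) (by nlinarith)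

/-- The abscissas of the points of the lower bound construction that lie on the parabola. -/
noncomputable def pairAbscissa (δ : ℝ) (j : ℕ) : ℝ := (j / 2 : ℕ) + if j % 2 = 0 then -δ else δ

theorem abs_pairAbscissa_sub (hδ : 0 < δ) (j : ℕ) : |pairAbscissa δ j - (j / 2 : ℕ)| = δ := by
  unfold pairAbscissa
  split_ifs <;> simp [hδ.le]

/-- Three points on the parabola enclose one of the points below the parabola. -/
theorem exists_belowPt_mem {k j₁ j₂ j₃ : ℕ} (hC : IsOpen C) (hconv : Convex ℝ C)
    (h₁₂ : j₁ < j₂) (h₂₃ : j₂ < j₃) (hk : j₃ < 2 * (k + 1)) (hδ0 : 0 < δ)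
    (hδ : δ * (k + 2) ≤ 1 / 4)
    (h₁ : parabolaPt (pairAbscissa δ j₁) ∈ closure C)
    (h₂ : parabolaPt (pairAbscissa δ j₂) ∈ closure C)
    (h₃ : parabolaPt (pairAbscissa δ j₃) ∈ closure C) :
    (∃ c ∈ Finset.range (k + 1), belowPt c (δ ^ 2 + δ / 2) ∈ C) ∨
      ∃ c ∈ Finset.range (k - 1), belowPt (c + 1 : ℕ) (1 / 2) ∈ C := by
  have hδ8 : δ ≤ 1 / 8 := by nlinarith [(Nat.cast_nonneg k : (0 : ℝ) ≤ k)]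
  have habs : ∀ j : ℕ, (j / 2 : ℕ) - δ ≤ pairAbscissa δ j ∧ pairAbscissa δ j ≤ (j / 2 : ℕ) + δ := by
    intro j
    have := abs_le.1 (abs_pairAbscissa_sub hδ0 j).le
    constructor <;> linarith
  have hcast : ∀ a b : ℕ, a + 1 ≤ b → (a : ℝ) + 1 ≤ b := fun a b h => by exact_mod_cast h
  have hsplit : ∀ (c : ℕ) (j : ℕ), parabolaPt (pairAbscissa δ j) =
      parabolaPt (c + (pairAbscissa δ j - c)) := by
    intro c j; congr 1; ring
  have hpair : ∀ i j : ℕ, i < j → i / 2 = j / 2 → pairAbscissa δ i = (i / 2 : ℕ) + -δ ∧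
      pairAbscissa δ j = (i / 2 : ℕ) + δ := by
    intro i j hij he
    constructor
    · rw [pairAbscissa, if_pos (by omega)]
    · rw [pairAbscissa, if_neg (by omega), he]
  by_cases h12 : j₁ / 2 = j₂ / 2
  · obtain ⟨e1, e2⟩ := hpair j₁ j₂ h₁₂ h12
    rw [e1] at h₁
    rw [e2] at h₂
    rw [hsplit (j₁ / 2)] at h₃
    refine Or.inl ⟨j₁ / 2, Finset.mem_range.2 (by omega),
      belowPt_mem_of_pair_of_right hC hconv hδ0 h₁ h₂ h₃ ?_⟩
    have := hcast (j₁ / 2) (j₃ / 2) (by omega)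
    have := (habs j₃).1
    linarith
  by_cases h23 : j₂ / 2 = j₃ / 2
  · obtain ⟨e1, e2⟩ := hpair j₂ j₃ h₂₃ h23
    rw [e1] at h₂
    rw [e2] at h₃
    rw [hsplit (j₂ / 2)] at h₁
    refine Or.inl ⟨j₂ / 2, Finset.mem_range.2 (by omega),
      belowPt_mem_of_pair_of_left hC hconv hδ0 h₂ h₃ h₁ ?_⟩
    have := hcast (j₁ / 2) (j₂ / 2) (by omega)
    have := (habs j₁).2
    linarith
  -- The three points belong to different pairs, so the middle pair is neither the first nor the
  -- last, and a deep point lies below it.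
  · right
    rw [hsplit (j₂ / 2)] at h₁ h₂ h₃
    refine ⟨j₂ / 2 - 1, Finset.mem_range.2 (by omega), ?_⟩
    rw [show j₂ / 2 - 1 + 1 = j₂ / 2 by omega]
    have e1 := hcast (j₁ / 2) (j₂ / 2) (by omega)
    have e2 := hcast (j₂ / 2) (j₃ / 2) (by omega)
    have e3 : ((j₃ / 2 : ℕ) : ℝ) ≤ k := by exact_mod_cast (by omega : j₃ / 2 ≤ k)
    have e4 : (0 : ℝ) ≤ (j₁ / 2 : ℕ) := Nat.cast_nonneg _
    have e5 := (habs j₁).1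
    have e6 := (habs j₁).2
    have e7 := (habs j₃).1
    have e8 := (habs j₃).2
    refine belowPt_mem_of_three hC hconv h₁ h₂ h₃ (by linarith) (by linarith) ?_ ?_ ?_ <;>
      rw [abs_pairAbscissa_sub hδ0]
    · linarith
    · nlinarith
    · nlinarith

end lowerBoundSet

/-- There are sets of `4 k + 2` points whose Steiner reflexivity is at least `k`. -/
theorem exists_finset_le_reflexCount {k : ℕ} (hk : 1 ≤ k) : ∃ S : Finset Plane,
    S.card ≤ 4 * k + 2 ∧
      ∀ P : SimplePolygon, (S : Set Plane) ⊆ P.vertexSet → k ≤ P.reflexCount := by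
  classical
  -- Small compared with the width of the whole configuration: a chord from any point to a point of
  -- the middle pair must pass above depth `1 / 2` at the centre of that pair.
  set δ : ℝ := 1 / (4 * (k + 2)) with hδdef
  have hδ0 : 0 < δ := by positivity
  have hδ : δ * (k + 2) ≤ 1 / 4 := by
    rw [hδdef]; field_simp; rfl
  set S₁ := (Finset.range (2 * (k + 1))).image fun j => parabolaPt (pairAbscissa δ j) with hS₁
  set S₂ := (Finset.range (k + 1)).image fun c : ℕ => belowPt c (δ ^ 2 + δ / 2) with hS₂
  set S₃ := (Finset.range (k - 1)).image fun c : ℕ => belowPt (c + 1 : ℕ) (1 / 2) with hS₃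
  refine ⟨S₁ ∪ S₂ ∪ S₃, ?_, fun P hP => ?_⟩
  · have h₁ : S₁.card ≤ 2 * (k + 1) := Finset.card_image_le.trans (by simp)
    have h₂ : S₂.card ≤ k + 1 := Finset.card_image_le.trans (by simp)
    have h₃ : S₃.card ≤ k - 1 := Finset.card_image_le.trans (by simp)
    have h₄ := Finset.card_union_le (S₁ ∪ S₂) S₃
    have h₅ := Finset.card_union_le S₁ S₂
    omega
  · obtain ⟨F, C, hF, hC, hcov⟩ := P.exists_convex_pieces
    have hnot : ∀ z ∈ S₁ ∪ S₂ ∪ S₃, ∀ x, z ∉ C x := by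
      intro z hz x hzx
      obtain ⟨i, rfl⟩ := hP hz
      exact (hC x).2.2 hzx (P.vertex_mem_boundary i)
    have hpiece : ∀ j ∈ Finset.range (2 * (k + 1)),
        ∃ x ∈ F, parabolaPt (pairAbscissa δ j) ∈ closure (C x) := by
      intro j hj
      have : parabolaPt (pairAbscissa δ j) ∈ S₁ ∪ S₂ ∪ S₃ := by
        simp only [Finset.mem_union]
        exact Or.inl (Or.inl (Finset.mem_image_of_mem _ hj))
      obtain ⟨i, hi⟩ := hP this
      rw [← hi]
      exact hcov i
    choose! f hfF hfC using hpiece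
    by_contra! hlt
    -- At most `k` pieces for `2 (k + 1)` points on the parabola: some piece receives three.
    obtain ⟨x, -, hx⟩ := Finset.exists_lt_card_fiber_of_mul_lt_card_of_maps_to
      (s := Finset.range (2 * (k + 1))) (t := F) (f := f) (n := 2) hfF (by
        rw [Finset.card_range]; omega)
    set A := (Finset.range (2 * (k + 1))).filter fun j => f j = x with hA
    have hmem : ∀ i, A.orderEmbOfFin rfl i ∈ A := fun i => Finset.orderEmbOfFin_mem A rfl i
    set j₁ := A.orderEmbOfFin rfl ⟨0, by omega⟩
    set j₂ := A.orderEmbOfFin rfl ⟨1, by omega⟩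
    set j₃ := A.orderEmbOfFin rfl ⟨2, by omega⟩
    have h12 : j₁ < j₂ := (A.orderEmbOfFin rfl).strictMono (by simp)
    have h23 : j₂ < j₃ := (A.orderEmbOfFin rfl).strictMono (by simp)
    have hcl : ∀ j ∈ A, j ∈ Finset.range (2 * (k + 1)) ∧
        parabolaPt (pairAbscissa δ j) ∈ closure (C x) := by
      intro j hj
      obtain ⟨hj1, hj2⟩ := Finset.mem_filter.1 hj
      exact ⟨hj1, hj2 ▸ hfC j hj1⟩
    rcases exists_belowPt_mem (hC x).1 (hC x).2.1 h12 h23 (Finset.mem_range.1 (hcl _ (hmem _)).1)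
      hδ0 hδ (hcl _ (hmem _)).2 (hcl _ (hmem _)).2 (hcl _ (hmem _)).2 with ⟨c, hc, hcC⟩ | ⟨c, hc, hcC⟩
    · refine hnot _ ?_ x hcC
      simp only [Finset.mem_union]
      exact Or.inl (Or.inr (Finset.mem_image_of_mem _ hc))
    · refine hnot _ ?_ x hcC
      simp only [Finset.mem_union]
      exact Or.inr (Finset.mem_image_of_mem (fun c : ℕ => belowPt (c + 1 : ℕ) (1 / 2)) hc)

/-! ### Orientation of a polygon on one side of an edge -/

namespace SimplePolygon

variable {P : SimplePolygon}

theorem boundary_subset_of_convex {A : Set Plane} (hA : Convex ℝ A) (h : ∀ i, P.vertex i ∈ A) :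
    P.boundary ⊆ A := by
  intro x hx
  obtain ⟨i, hi⟩ := P.mem_boundary.1 hx
  exact hA.segment_subset (h i) (h _) hi

/-- If a polygon lies to the left of one of its edges, then its reflex vertices are those at which
it turns right. -/
theorem isReflex_iff_of_left (j : Fin (P.m + 3))
    (h : ∀ i, 0 ≤ wedge (P.edgeVec j) (P.vertex i - P.vertex j)) (i : Fin (P.m + 3)) :
    P.IsReflex (i + 1) ↔ wedge (P.edgeVec i) (P.edgeVec (i + 1)) < 0 := by
  obtain ⟨σ, hσ, y, y', hy, hy', hs, hs', hin, hdisj⟩ := P.exists_inside_side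
  rcases hσ with rfl | rfl
  · simpa using isReflex_iff one_ne_zero (hs i) (hs' i) hin hdisj
  -- Otherwise the inside would be on the right of edge `j`. The open half-plane to the right of
  -- this edge misses the boundary, so it would belong to the inside, which is bounded.
  exfalso
  set H : Set Plane := {x | 0 < (-1) * wedge (P.edgeVec j) (x - P.vertex j)} with hH
  have hHB : H ⊆ P.boundaryᶜ := by
    intro x hx hxB
    have hconv : Convex ℝ Hᶜ := by
      have : Hᶜ = {x | wedge (P.edgeVec j) (P.vertex j) ≤ wedge (P.edgeVec j) x} := by
        ext x
        simp only [hH, Set.mem_compl_iff, Set.mem_ofPred_eq, wedge_sub_right, not_lt]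
        constructor <;> intro h <;> linarith
      rw [this]
      exact convex_halfSpace_ge ⟨wedge_add_right _, fun c x => wedge_smul_right _ x c⟩ _
    refine boundary_subset_of_convex hconv (fun i hi => ?_) hxB hx
    have h1 : 0 < (-1) * wedge (P.edgeVec j) (P.vertex i - P.vertex j) := hi
    linarith [h i]
  have hside := hs (j - 1)
  obtain ⟨q, hq, hE⟩ := hside.exists_edgeSide
  rw [sub_add_cancel] at hq hE
  have hqj : ∀ x, wedge (P.edgeVec j) (x - q) = wedge (P.edgeVec j) (x - P.vertex j) := by
    intro x
    have := P.wedge_edgeVec_of_mem (P.openSegment_subset_edge j hq) (P.vertex_mem_edge j)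
    rw [wedge_sub_right] at this ⊢
    rw [wedge_sub_right]
    linarith
  have hfr := (P.isTwoRayCorner_edge hq).frequently_sector (σ := -1) (by norm_num)
  simp only [mem_sector_self] at hfr
  obtain ⟨x, hx, hxE⟩ := (hfr.and_eventually hE).exists
  have hxy := hxE hx
  rw [hqj] at hx
  have hHy : H ⊆ P.comp y := by
    rw [← comp_eq hxy]
    exact (convex_wedge_pos (-1) (P.edgeVec j) (P.vertex j)).isPreconnected.subset_connectedComponentIn
      hx hHB
  have hb : Bornology.IsBounded (P.comp y) := by
    have : y ∈ P.inside := hin ▸ mem_comp hy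
    exact this.2
  obtain ⟨T, hT0, hT, -⟩ := exists_exit_point (isOpen_comp y) hb (v := P.vertex j)
    (d := -quarterTurn (P.edgeVec j)) (by
      intro h0
      have := wedge_quarterTurn_pos (P.edgeVec_ne j)
      rw [neg_eq_zero.1 h0, wedge_zero_right] at this
      exact lt_irrefl _ this) (by
      filter_upwards [self_mem_nhdsWithin] with t ht
      have ht : 0 < t := ht
      refine hHy ?_
      have := mul_pos ht (wedge_quarterTurn_pos (P.edgeVec_ne j))
      simp only [hH, Set.mem_ofPred_eq, add_sub_cancel_left, wedge_smul_right, wedge_neg_right]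
      linarith)
  refine hT (hHy ?_)
  have := mul_pos hT0 (wedge_quarterTurn_pos (P.edgeVec_ne j))
  simp only [hH, Set.mem_ofPred_eq, add_sub_cancel_left, wedge_smul_right, wedge_neg_right]
  linarith

end SimplePolygon

/-! ### Simple paths and their closure to polygons -/

/-- The union of the segments of a polygonal path. -/
def pathSet : List Plane → Set Plane
  | [] => ∅
  | [p] => {p}
  | p :: q :: t => segment ℝ p q ∪ pathSet (q :: t)

/-- The path is simple: each segment meets the rest of the path only in its end. -/
def IsSimplePath : List Plane → Prop
  | p :: q :: t => p ≠ q ∧ segment ℝ p q ∩ pathSet (q :: t) ⊆ {q} ∧ IsSimplePath (q :: t)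
  | _ => True

theorem mem_pathSet_of_mem : ∀ {l : List Plane} {p : Plane}, p ∈ l → p ∈ pathSet l
  | [_], _, h => by simpa [pathSet] using h
  | p :: q :: t, r, h => by
    rcases List.mem_cons.1 h with rfl | h
    · exact Or.inl (left_mem_segment ℝ _ _)
    · exact Or.inr (mem_pathSet_of_mem h)

theorem segment_subset_pathSet : ∀ {l : List Plane} {i : ℕ}, i + 1 < l.length →
    segment ℝ (l.getD i 0) (l.getD (i + 1) 0) ⊆ pathSet l
  | [], _, h => by simp at h
  | [_], _, h => by simp at h
  | p :: q :: t, 0, _ => Set.subset_union_left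
  | p :: q :: t, i + 1, h => by
    have := segment_subset_pathSet (l := q :: t) (i := i) (by simpa using h)
    exact this.trans Set.subset_union_right

theorem getD_mem {l : List Plane} {i : ℕ} (h : i < l.length) : l.getD i 0 ∈ l := by
  rw [List.getD_eq_getElem _ _ h]
  exact List.getElem_mem h

theorem IsSimplePath.ne : ∀ {l : List Plane}, IsSimplePath l → ∀ {i j : ℕ}, i < j → j < l.length →
    l.getD i 0 ≠ l.getD j 0
  | [], _, _, _, _, h => by simp at h
  | [_], _, i, j, h, h' => by simp at h'; omega
  | p :: q :: t, hs, 0, j + 1, _, h' => by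
    intro he
    have he : p = (q :: t).getD j 0 := he
    have hp : p ∈ pathSet (q :: t) := by
      rw [he]; exact mem_pathSet_of_mem (getD_mem (by simpa using h'))
    exact hs.1 (hs.2.1 ⟨left_mem_segment ℝ _ _, hp⟩)
  | p :: q :: t, hs, i + 1, j + 1, h, h' =>
    IsSimplePath.ne (l := q :: t) hs.2.2 (by omega) (by simpa using h')

theorem IsSimplePath.inter : ∀ {l : List Plane}, IsSimplePath l → ∀ {i j : ℕ}, i < j →
    j + 1 < l.length → ∀ {x}, x ∈ segment ℝ (l.getD i 0) (l.getD (i + 1) 0) →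
    x ∈ segment ℝ (l.getD j 0) (l.getD (j + 1) 0) → j = i + 1 ∧ x = l.getD j 0
  | [], _, _, _, _, h, _, _, _ => by simp at h
  | [_], _, _, _, _, h, _, _, _ => by simp at h
  | p :: q :: t, hs, i + 1, j + 1, h, h', x, hi, hj => by
    have := IsSimplePath.inter (l := q :: t) hs.2.2 (i := i) (j := j) (by omega) (by simpa using h')
      hi hj
    exact ⟨by omega, this.2⟩
  | p :: q :: t, hs, 0, j + 1, _, h', x, hi, hj => by
    have hj' : x ∈ segment ℝ ((q :: t).getD j 0) ((q :: t).getD (j + 1) 0) := hj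
    have hxq : x = q := hs.2.1 ⟨hi, segment_subset_pathSet (by simpa using h') hj'⟩
    rcases Nat.eq_zero_or_pos j with rfl | hjpos
    · exact ⟨rfl, hxq⟩
    · exfalso
      have := IsSimplePath.inter (l := q :: t) hs.2.2 (i := 0) (j := j) hjpos (by simpa using h')
        (x := x) (by rw [hxq]; exact left_mem_segment ℝ _ _) hj'
      refine IsSimplePath.ne (l := q :: t) hs.2.2 (i := 0) (j := j) hjpos (by simp at h'; simp; omega) ?_
      rw [← this.2, hxq]; rfl

theorem fin_val_add_one {m : ℕ} (i : Fin (m + 3)) :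
    ((i + 1 : Fin (m + 3)) : ℕ) = i + 1 ∧ (i : ℕ) < m + 2 ∨ ((i + 1 : Fin (m + 3)) : ℕ) = 0 ∧ (i : ℕ) = m + 2 := by
  rcases eq_or_ne i (Fin.last (m + 2)) with rfl | h
  · right; simp
  · left
    have h1 : (i : ℕ) ≠ m + 2 := fun h' => h (Fin.ext h')
    have h2 := i.isLt
    refine ⟨?_, by omega⟩
    rw [Fin.val_add_one, if_neg h]

/-- The simple polygon obtained by closing a simple path. -/
theorem exists_simplePolygon_of_path {l : List Plane} {m : ℕ} (hm : l.length = m + 3)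
    (hs : IsSimplePath l)
    (hc : ∀ x ∈ segment ℝ (l.getD (m + 2) 0) (l.getD 0 0), x ∈ pathSet l →
      x = l.getD (m + 2) 0 ∨ x = l.getD 0 0) :
    ∃ (P : SimplePolygon) (_ : P.m = m), ∀ i : Fin (P.m + 3), P.vertex i = l.getD i 0 := by
  have hinj : ∀ i j : ℕ, i < m + 3 → j < m + 3 → l.getD i 0 = l.getD j 0 → i = j := by
    intro i j hi hj h
    rcases lt_trichotomy i j with hij | hij | hij
    · exact absurd h (hs.ne hij (by omega))
    · exact hij
    · exact absurd h.symm (hs.ne hij (by omega))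
  have hlast : ∀ x ∈ segment ℝ (l.getD (m + 2) 0) (l.getD 0 0), ∀ i : ℕ, i < m + 2 →
      x ∈ segment ℝ (l.getD i 0) (l.getD (i + 1) 0) →
      (i = 0 ∧ x = l.getD 0 0) ∨ (i = m + 1 ∧ x = l.getD (m + 2) 0) := by
    intro x hx i hi hxi
    rcases hc x hx (segment_subset_pathSet (by omega) hxi) with rfl | rfl
    · right
      refine ⟨?_, rfl⟩
      by_contra hne
      have := hs.inter (i := i) (j := m + 1) (by omega) (by omega) hxi (right_mem_segment ℝ _ _)
      exact hs.ne (i := m + 1) (j := m + 2) (by omega) (by omega) this.2.symm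
    · left
      refine ⟨?_, rfl⟩
      by_contra hne
      have := hs.inter (i := 0) (j := i) (by omega) (by omega) (left_mem_segment ℝ _ _) hxi
      exact hs.ne (i := 0) (j := i) (by omega) (by omega) this.2
  refine ⟨⟨m, fun i => l.getD i 0, fun i j h => Fin.ext (hinj i j i.isLt j.isLt h), ?_, ?_⟩, rfl,
    fun i => rfl⟩
  · intro i
    refine Set.Subset.antisymm ?_ (by
      rintro _ rfl; exact ⟨right_mem_segment ℝ _ _, left_mem_segment ℝ _ _⟩)
    rintro x ⟨h1, h2⟩
    have hi := i.isLt
    rw [Set.mem_singleton_iff]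
    -- The cases tell which indices wrap around; an edge that starts at the last vertex is the
    -- closing segment, which is treated by `hlast`.
    rcases fin_val_add_one i with ⟨e1, hi1⟩ | ⟨e1, hi1⟩ <;>
      rcases fin_val_add_one (i + 1) with ⟨e2, hi2⟩ | ⟨e2, hi2⟩ <;>
      rw [e1] at h1 <;> rw [e2] at h2 <;> rw [e1] at h2 hi2 ⊢
    · exact (hs.inter (by omega) (by omega) h1 h2).2
    · rw [hi2] at h2 ⊢
      rcases hlast x h2 i (by omega) h1 with h | h
      · omega
      · exact h.2
    · rw [hi1] at h1
      rcases hlast x h1 0 (by omega) h2 with h | h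
      · exact h.2
      · omega
    · omega
  · intro i j hji hj1 hi1
    rw [Set.disjoint_left]
    intro x h1 h2
    have hii := i.isLt
    have hjj := j.isLt
    have hji' : (j : ℕ) ≠ i := fun h => hji (Fin.ext h)
    have hj1' : (j : ℕ) ≠ (i + 1 : Fin (m + 3)) := fun h => hj1 (Fin.ext h)
    have hi1' : (i : ℕ) ≠ (j + 1 : Fin (m + 3)) := fun h => hi1 (Fin.ext h)
    rcases fin_val_add_one i with ⟨e1, h1i⟩ | ⟨e1, h1i⟩ <;>
      rcases fin_val_add_one j with ⟨e2, h2j⟩ | ⟨e2, h2j⟩ <;>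
      rw [e1] at h1 hj1' <;> rw [e2] at h2 hi1'
    · rcases lt_or_gt_of_ne hji' with h | h
      · have := hs.inter h (by omega) h2 h1
        omega
      · have := hs.inter h (by omega) h1 h2
        omega
    · rw [h2j] at h2
      rcases hlast x h2 i (by omega) h1 with h | h <;> omega
    · rw [h1i] at h1
      rcases hlast x h1 j (by omega) h2 with h | h <;> omega
    · omega

/-- Applied to the two lines from the apex through the ends of a path: the path touches such a line
only in its end, so the edges at the apex do not cross it. -/
theorem pathSet_pos {a Z q : Plane} (hq : wedge a (q - Z) = 0) :
    ∀ {l : List Plane}, (∀ p ∈ l, p = q ∨ 0 < wedge a (p - Z)) →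
      ∀ x ∈ pathSet l, x = q ∨ 0 < wedge a (x - Z)
  | [], _, x, hx => absurd hx (by simp [pathSet])
  | [p], h, x, hx => by
    rw [show x = p by simpa [pathSet] using hx]
    exact h p (by simp)
  | p :: r :: t, h, x, hx => by
    rcases hx with hx | hx
    · obtain ⟨s, t, hs, ht, hst, rfl⟩ := hx
      have hlin : wedge a (s • p + t • r - Z) = s * wedge a (p - Z) + t * wedge a (r - Z) := by
        have hZ : Z = (s + t) • Z := by rw [hst, one_smul]
        have : s • p + t • r - Z = s • (p - Z) + t • (r - Z) := by
          nth_rewrite 1 [hZ]; module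
        rw [this, wedge_add_right, wedge_smul_right, wedge_smul_right]
      rw [hlin]
      rcases eq_or_lt_of_le hs with hs0 | hs0
      · have ht1 : t = 1 := by linarith
        subst ht1; rw [← hs0]
        simpa using h r (by simp)
      rcases eq_or_lt_of_le ht with ht0 | ht0
      · have hs1 : s = 1 := by linarith
        subst hs1; rw [← ht0]
        simpa using h p (by simp)
      rcases h p (by simp) with rfl | hp <;> rcases h r (by simp) with rfl | hr
      · left; rw [← add_smul, hst, one_smul]
      · right; rw [hq]; have := mul_pos ht0 hr; linarith
      · right; rw [hq]; have := mul_pos hs0 hp; linarith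
      · right; have := mul_pos ht0 hr; have := mul_pos hs0 hp; linarith
    · exact pathSet_pos hq (fun p hp => h p (List.mem_cons_of_mem _ hp)) x hx

/-- The path turns left, or goes straight on, at each inner vertex that is not in `bad`. -/
def TurnsLeft (bad : Plane → Prop) : List Plane → Prop
  | p :: q :: r :: t => (¬ bad q → 0 ≤ wedge (q - p) (r - q)) ∧ TurnsLeft bad (q :: r :: t)
  | _ => True

theorem TurnsLeft.getD {bad : Plane → Prop} : ∀ {l : List Plane}, TurnsLeft bad l → ∀ {i : ℕ},
    i + 2 < l.length → ¬ bad (l.getD (i + 1) 0) →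
    0 ≤ wedge (l.getD (i + 1) 0 - l.getD i 0) (l.getD (i + 2) 0 - l.getD (i + 1) 0)
  | [], _, _, h, _ => by simp at h
  | [_], _, _, h, _ => by simp at h
  | [_, _], _, _, h, _ => by simp at h
  | _ :: _ :: _ :: _, ht, 0, _, hb => ht.1 hb
  | p :: q :: r :: t, ht, i + 1, h, hb =>
    TurnsLeft.getD (l := q :: r :: t) ht.2 (i := i) (by simpa using h) hb

open Classical in
/-- A simple path that winds around the point `Z` is closed by `Z` to a simple polygon. -/
theorem exists_simplePolygon_of_apex {bad : Plane → Prop} {w : List Plane} {Z : Plane} {k : ℕ}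
    (hk : w.length = k + 2) (hs : IsSimplePath w)
    (hlow : ∀ p ∈ w, p = w.getD 0 0 ∨ 0 < wedge (w.getD 0 0 - Z) (p - Z))
    (hhigh : ∀ p ∈ w, p = w.getD (k + 1) 0 ∨ 0 < wedge (p - Z) (w.getD (k + 1) 0 - Z))
    (ht : TurnsLeft bad w) :
    ∃ P : SimplePolygon, (∀ p ∈ w, p ∈ P.vertexSet) ∧
      P.reflexCount ≤ (w.filter fun p => bad p).length := by
  set a := w.getD 0 0 with ha
  set b := w.getD (k + 1) 0 with hb
  have hhigh' : ∀ p ∈ w, p = b ∨ 0 < wedge (-(b - Z)) (p - Z) := by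
    intro p hp
    refine (hhigh p hp).imp_right fun h => ?_
    rwa [wedge_neg_left, ← wedge_swap]
  have hab : 0 < wedge (a - Z) (b - Z) :=
    (hlow b (getD_mem (by omega))).resolve_left fun h => hs.ne (i := 0) (j := k + 1) (by omega)
      (by omega) h.symm
  have hset_low := pathSet_pos (wedge_self (a - Z)) hlow
  have hset_high := pathSet_pos (a := -(b - Z)) (Z := Z) (q := b)
    (by rw [wedge_neg_left, wedge_self, neg_zero]) hhigh'
  have hcons : Z :: w = Z :: a :: w.tail := by
    cases w with
    | nil => simp at hk
    | cons c t => rfl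
  have hw : w = a :: w.tail := (List.cons.inj hcons).2
  have hpathZ : pathSet (Z :: w) = segment ℝ Z a ∪ pathSet w := by
    rw [hcons, pathSet, ← hw]
  have hsZ : IsSimplePath (Z :: w) := by
    rw [hcons, IsSimplePath, ← hw]
    refine ⟨?_, ?_, hs⟩
    · intro h
      rw [h, sub_self] at hab
      simp [wedge] at hab
    · rintro x ⟨hx1, hx2⟩
      rcases hset_low x hx2 with h | h
      · exact h
      · exfalso
        rw [segment_eq_image'] at hx1
        obtain ⟨s, -, rfl⟩ := hx1
        rw [add_sub_cancel_left, wedge_smul_right, wedge_self, mul_zero] at h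
        exact lt_irrefl _ h
  have hg : ∀ i, (Z :: w).getD (i + 1) 0 = w.getD i 0 := fun i => rfl
  obtain ⟨P, hPm, hPv⟩ := exists_simplePolygon_of_path (l := Z :: w) (m := k) (by simp [hk]) hsZ (by
    intro x hx hxp
    rw [hg, ← hb] at hx ⊢
    change x = b ∨ x = Z
    have hx : x ∈ segment ℝ b Z := hx
    rw [segment_symm, segment_eq_image'] at hx
    obtain ⟨s, ⟨h0, h1⟩, rfl⟩ := hx
    rw [hpathZ] at hxp
    rcases hxp with hxp | hxp
    · right
      rw [segment_eq_image'] at hxp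
      obtain ⟨r, -, hr⟩ := hxp
      have hr : r • (a - Z) = s • (b - Z) := add_left_cancel hr
      have h2 : s * wedge (a - Z) (b - Z) = 0 := by
        rw [← wedge_smul_right, ← hr, wedge_smul_right, wedge_self, mul_zero]
      have : s = 0 := by simpa [hab.ne'] using h2
      simp [this]
    · left
      refine (hset_high _ hxp).resolve_right fun h => ?_
      rw [add_sub_cancel_left, wedge_smul_right, wedge_neg_left, wedge_self] at h
      simp at h)
  subst hPm
  have hval0 : ((0 : Fin (P.m + 3)) : ℕ) = 0 := rfl
  have hval1 : ((0 + 1 : Fin (P.m + 3)) : ℕ) = 1 := by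
    rcases fin_val_add_one (0 : Fin (P.m + 3)) with h | h
    · rw [h.1, hval0]
    · rw [hval0] at h; omega
  have hv0 : P.vertex 0 = Z := by rw [hPv, hval0]; rfl
  have hv1 : P.vertex (0 + 1) = a := by rw [hPv, hval1]; rfl
  have hmemv : ∀ i, P.vertex i = Z ∨ P.vertex i ∈ w := by
    intro i
    rw [hPv, ← List.mem_cons]
    exact getD_mem (by simp only [List.length_cons, hk]; exact i.isLt)
  have hleft : ∀ i, 0 ≤ wedge (P.edgeVec 0) (P.vertex i - P.vertex 0) := by
    intro i
    rw [SimplePolygon.edgeVec, hv1, hv0]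
    rcases hmemv i with h | h
    · rw [h, sub_self, wedge_zero_right]
    · rcases hlow _ h with h | h
      · rw [h, wedge_self]
      · exact h.le
  have hbad : ∀ i, P.IsReflex i → P.vertex i ∈ w ∧ bad (P.vertex i) := by
    intro i
    obtain ⟨i, rfl⟩ : ∃ j, i = j + 1 := ⟨i - 1, by rw [sub_add_cancel]⟩
    intro hr
    have hlt := (SimplePolygon.isReflex_iff_of_left 0 hleft i).1 hr
    rw [SimplePolygon.edgeVec, SimplePolygon.edgeVec, hPv, hPv, hPv] at hlt
    rw [hPv]
    have hi := i.isLt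
    -- The vertex is an inner vertex of the path, its first vertex `a`, its last vertex `b`, or the
    -- apex `Z`. The angular conditions force left turns at the last three, which leaves only bad
    -- inner vertices.
    rcases fin_val_add_one i with ⟨e1, h1⟩ | ⟨e1, h1⟩ <;>
      rcases fin_val_add_one (i + 1) with ⟨e2, h2⟩ | ⟨e2, h2⟩ <;>
      rw [e2] at hlt <;> rw [e1] at hlt h2 ⊢
    · rcases Nat.eq_zero_or_pos (i : ℕ) with h0 | h0
      · exfalso
        rw [h0] at hlt
        change wedge (a - Z) (w.getD 1 0 - a) < 0 at hlt
        have h3 := (hlow (w.getD 1 0) (getD_mem (by omega))).resolve_left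
          (hs.ne (i := 0) (j := 1) (by omega) (by omega)).symm
        have h4 : w.getD 1 0 - a = (w.getD 1 0 - Z) - (a - Z) := by abel
        rw [h4, wedge_sub_right, wedge_self] at hlt
        linarith
      · obtain ⟨n, hn⟩ : ∃ n, (i : ℕ) = n + 1 := ⟨i - 1, by omega⟩
        rw [hn] at hlt h2 ⊢
        rw [hg, hg, hg] at hlt
        rw [hg]
        refine ⟨getD_mem (by omega), ?_⟩
        by_contra hnb
        exact hlt.not_ge (ht.getD (by omega) hnb)
    · exfalso
      obtain ⟨n, hn⟩ : ∃ n, (i : ℕ) = n + 1 := ⟨i - 1, by omega⟩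
      rw [hn, hg, hg] at hlt
      have hnk : n = P.m := by omega
      rw [hnk, ← hb] at hlt
      change wedge (b - w.getD P.m 0) (Z - b) < 0 at hlt
      have h3 := (hhigh (w.getD P.m 0) (getD_mem (by omega))).resolve_left
        (hs.ne (i := P.m) (j := P.m + 1) (by omega) (by omega))
      have h4 : b - w.getD P.m 0 = (b - Z) - (w.getD P.m 0 - Z) := by abel
      have h5 : Z - b = -(b - Z) := by abel
      rw [h4, h5, wedge_neg_right, wedge_sub_left, wedge_self] at hlt
      linarith
    · exfalso
      rw [h1] at hlt
      rw [hg (P.m + 1), ← hb] at hlt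
      change wedge (Z - b) (a - Z) < 0 at hlt
      have h5 : Z - b = -(b - Z) := by abel
      rw [h5, wedge_neg_left, wedge_swap, neg_neg] at hlt
      linarith
    · omega
  refine ⟨P, fun p hp => ?_, ?_⟩
  · obtain ⟨n, hn, rfl⟩ := List.getElem_of_mem hp
    refine ⟨⟨n + 1, by omega⟩, ?_⟩
    rw [hPv, hg, List.getD_eq_getElem _ _ hn]
  · rw [SimplePolygon.reflexCount]
    calc Set.ncard {i | P.IsReflex i} ≤
        Set.ncard ((w.filter fun p => bad p).toFinset : Set Plane) := by
          refine Set.ncard_le_ncard_of_injOn P.vertex (fun i hi => ?_)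
            P.vertex_injective.injOn (Finset.finite_toSet _)
          simpa using hbad i hi
      _ ≤ (w.filter fun p => bad p).length := by
          rw [Set.ncard_coe_finset]
          exact List.toFinset_card_le _

/-! ### Sheared coordinates and monotone paths -/

/-- A linear coordinate on the plane which together with the ordinate forms a sheared coordinate
system. -/
def shear (ε : ℝ) (p : Plane) : ℝ := p 0 + ε * p 1

/-- The point with given sheared coordinates. -/
noncomputable def shearPoint (ε x y : ℝ) : Plane := !₂[x - ε * y, y]

@[simp] theorem shear_shearPoint (ε x y : ℝ) : shear ε (shearPoint ε x y) = x := by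
  simp [shear, shearPoint]

@[simp] theorem shearPoint_one (ε x y : ℝ) : shearPoint ε x y 1 = y := by
  simp [shearPoint]

theorem shear_sub (ε : ℝ) (p q : Plane) : shear ε (p - q) = shear ε p - shear ε q := by
  simp only [shear, PiLp.sub_apply]; ring

theorem wedge_eq_shear (ε : ℝ) (p q : Plane) :
    wedge p q = shear ε p * q 1 - p 1 * shear ε q := by
  simp only [shear, wedge]; ring

theorem shear_ext {ε : ℝ} {p q : Plane} (h : shear ε p = shear ε q) (h' : p 1 = q 1) : p = q := by
  simp only [shear, h'] at h
  exact plane_ext (by linarith) h'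

theorem exists_shear_of_mem_segment (ε : ℝ) {p q z : Plane} (h : z ∈ segment ℝ p q) :
    ∃ t : ℝ, 0 ≤ t ∧ t ≤ 1 ∧ shear ε z = (1 - t) * shear ε p + t * shear ε q ∧
      z 1 = (1 - t) * p 1 + t * q 1 ∧ (t = 0 → z = p) ∧ (t = 1 → z = q) := by
  obtain ⟨a, t, ha, ht, hat, rfl⟩ := h
  obtain rfl : a = 1 - t := by linarith
  refine ⟨t, ht, by linarith, ?_, ?_, ?_, ?_⟩
  · simp only [shear, PiLp.add_apply, PiLp.smul_apply, smul_eq_mul]; ring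
  · simp
  · rintro rfl; simp
  · rintro rfl; simp

/-- The points of the list have increasing sheared abscissas. -/
abbrev ShearSorted (ε : ℝ) (l : List Plane) : Prop :=
  l.Pairwise fun p q => shear ε p < shear ε q

theorem ShearSorted.of_cons {ε : ℝ} {p : Plane} {l : List Plane} (h : ShearSorted ε (p :: l)) :
    ShearSorted ε l :=
  List.Pairwise.of_cons h

theorem ShearSorted.eq_or_lt {ε : ℝ} : ∀ {p : Plane} {l : List Plane}, ShearSorted ε (p :: l) →
    ∀ {z : Plane}, z ∈ pathSet (p :: l) → z = p ∨ shear ε p < shear ε z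
  | p, [], _, z, hz => Or.inl (by simpa [pathSet] using hz)
  | p, q :: t, h, z, hz => by
    have hpq : shear ε p < shear ε q := List.rel_of_pairwise_cons h (by simp)
    rcases hz with hz | hz
    · obtain ⟨s, hs, hs1, hx, -, h0, -⟩ := exists_shear_of_mem_segment ε hz
      rcases hs.eq_or_lt with rfl | hs
      · exact Or.inl (h0 rfl)
      · right; rw [hx]; nlinarith
    · right
      rcases (ShearSorted.of_cons h).eq_or_lt hz with rfl | hz
      · exact hpq
      · exact hpq.trans hz

theorem ShearSorted.isSimplePath {ε : ℝ} : ∀ {l : List Plane}, ShearSorted ε l → IsSimplePath l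
  | [], _ => trivial
  | [_], _ => trivial
  | p :: q :: t, h => by
    have hpq : shear ε p < shear ε q := List.rel_of_pairwise_cons h (by simp)
    refine ⟨fun e => by simp [e] at hpq, ?_, (ShearSorted.of_cons h).isSimplePath⟩
    rintro z ⟨hz, hz'⟩
    rcases (ShearSorted.of_cons h).eq_or_lt hz' with h1 | h1
    · exact h1
    obtain ⟨s, hs, hs1, hx, -⟩ := exists_shear_of_mem_segment ε hz
    nlinarith

/-- The vertices of a monotone path are moved one by one to the front of a path already built. The
third hypothesis is the invariant: what remains meets what is built only at abscissas up to that of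
`c`, hence only in `c`. -/
theorem isSimplePath_reverseAux {ε : ℝ} : ∀ {l : List Plane} {c : Plane} {acc : List Plane},
    ShearSorted ε (c :: l) → IsSimplePath (c :: acc) →
    (∀ z ∈ pathSet (c :: l), z ∈ pathSet (c :: acc) → shear ε z ≤ shear ε c) →
    IsSimplePath (l.reverseAux (c :: acc))
  | [], _, _, _, h, _ => h
  | q :: t, c, acc, hl, hs, hd => by
    have hcq : shear ε c < shear ε q := List.rel_of_pairwise_cons hl (by simp)
    refine isSimplePath_reverseAux (l := t) (c := q) (acc := c :: acc) (ShearSorted.of_cons hl)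
      ⟨fun e => by simp [e] at hcq, ?_, hs⟩ ?_
    · rintro z ⟨hz, hz'⟩
      have hz1 : z ∈ pathSet (c :: q :: t) := Or.inl (by rwa [segment_symm])
      have := hd z hz1 hz'
      rcases hl.eq_or_lt hz1 with h1 | h1
      · exact h1
      · linarith
    · rintro z hz (hz' | hz')
      · obtain ⟨s, hs, hs1, hx, -⟩ := exists_shear_of_mem_segment ε hz'
        nlinarith
      · have := hd z (Or.inr hz) hz'
        linarith

theorem isSimplePath_reverse_append {ε : ℝ} {c d : Plane} {l m : List Plane}
    (hl : ShearSorted ε (c :: l)) (hm : ShearSorted ε (d :: m)) (hcd : shear ε c = shear ε d)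
    (hd : Disjoint (pathSet (c :: l)) (pathSet (d :: m))) :
    IsSimplePath (l.reverseAux (c :: d :: m)) := by
  refine isSimplePath_reverseAux hl ⟨?_, ?_, hm.isSimplePath⟩ ?_
  · rintro rfl
    exact Set.disjoint_left.1 hd (mem_pathSet_of_mem List.mem_cons_self)
      (mem_pathSet_of_mem List.mem_cons_self)
  · rintro z ⟨hz, hz'⟩
    obtain ⟨s, hs, hs1, hx, -⟩ := exists_shear_of_mem_segment ε hz
    rcases hm.eq_or_lt hz' with h1 | h1
    · exact h1
    · rw [hcd] at hx; nlinarith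
  · rintro z hz (hz' | hz')
    · obtain ⟨s, hs, hs1, hx, -⟩ := exists_shear_of_mem_segment ε hz'
      rw [hcd] at hx ⊢; nlinarith
    · exact (Set.disjoint_left.1 hd hz hz').elim

/-- The path turns right or is straight (for `σ = 1`), or turns left or is straight (for
`σ = -1`), at all its inner vertices except perhaps the bad ones. -/
def Turns (σ : ℝ) (bad : Plane → Prop) : List Plane → Prop
  | p :: q :: r :: t => (¬ bad q → σ * wedge (q - p) (r - q) ≤ 0) ∧ Turns σ bad (q :: r :: t)
  | _ => True

theorem Turns.of_cons {σ : ℝ} {bad : Plane → Prop} : ∀ {p : Plane} {l : List Plane},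
    Turns σ bad (p :: l) → Turns σ bad l
  | _, [], _ => trivial
  | _, [_], _ => trivial
  | _, _ :: _ :: _, h => h.2

theorem Turns.turnsLeft {bad : Plane → Prop} : ∀ {l : List Plane},
    Turns (-1) bad l → TurnsLeft bad l
  | [], _ => trivial
  | [_], _ => trivial
  | [_, _], _ => trivial
  | p :: q :: r :: t, h => ⟨fun hq => by linarith [h.1 hq], turnsLeft h.2⟩

/-- Traversing a path backwards exchanges right and left turns. -/
theorem turnsLeft_reverseAux {bad : Plane → Prop} : ∀ {t : List Plane} {c q : Plane}
    {acc : List Plane}, Turns 1 bad (c :: q :: t) → TurnsLeft bad (q :: c :: acc) →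
    TurnsLeft bad (t.reverseAux (q :: c :: acc))
  | [], _, _, _, _, h => h
  | r :: t, c, q, acc, ht, h => by
    refine turnsLeft_reverseAux (t := t) (c := q) (q := r) (acc := c :: acc) ht.2 ⟨fun hq => ?_, h⟩
    have := ht.1 hq
    rw [wedge_swap, ← neg_sub q c, ← neg_sub r q, wedge_neg_left, wedge_neg_right]
    linarith

/-! ### The zigzag path through groups of points -/

/-- The path that starts at abscissa `x`, visits the groups of points, from each group on goes
steeply down to the ordinate `-σ * H` and up to the next, and ends at the ordinate `-σ * (2 * H)`. -/
noncomputable def zigzag (ε σ H δ : ℝ) : ℝ → List (List Plane) → List Plane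
  | x, [] => [shearPoint ε x (-σ * (2 * H))]
  | x, g :: gs => shearPoint ε x (-σ * H) ::
      (g ++ zigzag ε σ H δ (shear ε (g.getLastD 0) + δ) gs)

/-- A group of one, two or three points. -/
def IsGroup (g : List Plane) : Prop :=
  (∃ a, g = [a]) ∨ (∃ a b, g = [a, b]) ∨ ∃ a b c, g = [a, b, c]

theorem exists_groups : ∀ l : List Plane, ∃ gs : List (List Plane), gs.flatten = l ∧
    3 * gs.length ≤ l.length + 2 ∧ ∀ g ∈ gs, IsGroup g
  | [] => ⟨[], by simp⟩
  | [a] => ⟨[[a]], by simp [IsGroup]⟩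
  | [a, b] => ⟨[[a, b]], by simp [IsGroup]⟩
  | a :: b :: c :: t => by
    obtain ⟨gs, h1, h2, h3⟩ := exists_groups t
    refine ⟨[a, b, c] :: gs, by simp [h1], by simp; omega, ?_⟩
    intro g hg
    rcases List.mem_cons.1 hg with rfl | hg
    · simp [IsGroup]
    · exact h3 g hg

/-- Up to three points have at most one inner vertex, hence turn consistently; this is the source of
the factor three. -/
theorem IsGroup.turns {bad : Plane → Prop} {g : List Plane} (hg : IsGroup g) :
    Turns 1 bad g ∨ Turns (-1) bad g := by
  rcases hg with ⟨a, rfl⟩ | ⟨a, b, rfl⟩ | ⟨a, b, c, rfl⟩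
  · simp [Turns]
  · simp [Turns]
  · rcases le_total (wedge (b - a) (c - b)) 0 with h | h
    · left; simp [Turns, h]
    · right; simp [Turns, h]

/-- The conditions on the groups under which the zigzag path is well behaved. -/
structure Fits (ε σ H δ M W x : ℝ) (gs : List (List Plane)) : Prop where
  isGroup : ∀ g ∈ gs, IsGroup g
  turns : ∀ g ∈ gs, Turns σ (fun _ => False) g
  gap : ∀ g ∈ gs, g.Pairwise fun p q => shear ε p + 2 * δ ≤ shear ε q
  gaps : gs.Pairwise fun g g' => ∀ p ∈ g, ∀ q ∈ g', shear ε p + 2 * δ ≤ shear ε q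
  bound : ∀ g ∈ gs, ∀ p ∈ g, |p 1| ≤ M
  left : ∀ g ∈ gs, ∀ p ∈ g, x + δ ≤ shear ε p
  right : ∀ g ∈ gs, ∀ p ∈ g, shear ε p ≤ x + W

theorem IsGroup.getLastD_mem {g : List Plane} (hg : IsGroup g) : g.getLastD 0 ∈ g := by
  rcases hg with ⟨a, rfl⟩ | ⟨a, b, rfl⟩ | ⟨a, b, c, rfl⟩ <;> simp

section zigzag

variable {ε σ H δ M W x : ℝ} {g : List Plane} {gs : List (List Plane)}

theorem Fits.tail (hδ : 0 < δ) (h : Fits ε σ H δ M W x (g :: gs)) :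
    Fits ε σ H δ M W (shear ε (g.getLastD 0) + δ) gs where
  isGroup := fun a ha => h.isGroup a (List.mem_cons_of_mem _ ha)
  turns := fun a ha => h.turns a (List.mem_cons_of_mem _ ha)
  gap := fun a ha => h.gap a (List.mem_cons_of_mem _ ha)
  gaps := h.gaps.of_cons
  bound := fun a ha => h.bound a (List.mem_cons_of_mem _ ha)
  left := fun a ha p hp => by
    have := List.rel_of_pairwise_cons h.gaps ha _ (h.isGroup g (by simp)).getLastD_mem p hp
    linarith
  right := fun a ha p hp => by
    have := h.right a (List.mem_cons_of_mem _ ha) p hp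
    have := h.left g (by simp) _ (h.isGroup g (by simp)).getLastD_mem
    linarith

theorem zigzag_eq_cons (ε σ H δ x : ℝ) (gs : List (List Plane)) : ∃ y t,
    zigzag ε σ H δ x gs = shearPoint ε x (-σ * y) :: t ∧ (y = H ∨ y = 2 * H ∧ t = []) := by
  cases gs with
  | nil => exact ⟨2 * H, [], rfl, Or.inr ⟨rfl, rfl⟩⟩
  | cons g gs => exact ⟨H, _, rfl, Or.inl rfl⟩

theorem zigzag_eq_append (ε σ H δ : ℝ) : ∀ (gs : List (List Plane)) (x : ℝ), ∃ t x',
    zigzag ε σ H δ x gs = t ++ [shearPoint ε x' (-σ * (2 * H))] ∧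
      ∀ p ∈ t, p 1 = -σ * H ∨ ∃ g ∈ gs, p ∈ g
  | [], x => ⟨[], x, rfl, by simp⟩
  | g :: gs, x => by
    obtain ⟨t, x', h, h'⟩ := zigzag_eq_append ε σ H δ gs (shear ε (g.getLastD 0) + δ)
    refine ⟨shearPoint ε x (-σ * H) :: (g ++ t), x', by rw [zigzag, h]; simp, ?_⟩
    intro p hp
    rcases List.mem_cons.1 hp with rfl | hp
    · simp
    rcases List.mem_append.1 hp with hp | hp
    · exact Or.inr ⟨g, by simp, hp⟩
    rcases h' p hp with h' | ⟨g', hg', hp⟩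
    · exact Or.inl h'
    · exact Or.inr ⟨g', List.mem_cons_of_mem _ hg', hp⟩

theorem mem_zigzag (ε σ H δ : ℝ) {p : Plane} (hp : p ∈ g) : ∀ (gs : List (List Plane)) (x : ℝ),
    g ∈ gs → p ∈ zigzag ε σ H δ x gs
  | g' :: gs, x, hg => by
    rcases List.mem_cons.1 hg with rfl | hg
    · simp [zigzag, hp]
    · simp [zigzag, mem_zigzag ε σ H δ hp gs _ hg]

theorem le_shear_of_mem_zigzag (hδ : 0 < δ) {p : Plane} : ∀ {gs : List (List Plane)} {x : ℝ},
    Fits ε σ H δ M W x gs → p ∈ zigzag ε σ H δ x gs → x ≤ shear ε p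
  | [], x, h, hp => by simp [zigzag] at hp; simp [hp]
  | g :: gs, x, h, hp => by
    rcases List.mem_cons.1 hp with rfl | hp
    · simp
    rcases List.mem_append.1 hp with hp | hp
    · linarith [h.left g (by simp) p hp]
    · have := le_shear_of_mem_zigzag hδ (h.tail hδ) hp
      linarith [h.left g (by simp) _ (h.isGroup g (by simp)).getLastD_mem]

theorem IsGroup.le_getLastD (hδ : 0 < δ) (hg : IsGroup g)
    (h : g.Pairwise fun p q => shear ε p + 2 * δ ≤ shear ε q) {p : Plane} (hp : p ∈ g) :
    shear ε p ≤ shear ε (g.getLastD 0) := by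
  rcases hg with ⟨a, rfl⟩ | ⟨a, b, rfl⟩ | ⟨a, b, c, rfl⟩ <;> simp at hp h ⊢
  · rw [hp]
  · rcases hp with rfl | rfl <;> linarith
  · rcases hp with rfl | rfl | rfl <;> linarith

theorem shearSorted_zigzag (hδ : 0 < δ) : ∀ {gs : List (List Plane)} {x : ℝ},
    Fits ε σ H δ M W x gs → ShearSorted ε (zigzag ε σ H δ x gs)
  | [], x, h => by simp [zigzag]
  | g :: gs, x, h => by
    have hl := h.left g (by simp)
    have hg := h.isGroup g (by simp)
    have hgap := h.gap g (by simp)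
    refine List.Pairwise.cons (fun p hp => ?_) (List.pairwise_append.2
      ⟨hgap.imp fun hpq => by linarith, shearSorted_zigzag hδ (h.tail hδ), fun p hp q hq => ?_⟩)
    · rw [shear_shearPoint]
      rcases List.mem_append.1 hp with hp | hp
      · linarith [hl p hp]
      · linarith [le_shear_of_mem_zigzag hδ (h.tail hδ) hp, hl _ hg.getLastD_mem]
    · linarith [le_shear_of_mem_zigzag hδ (h.tail hδ) hq, hg.le_getLastD hδ hgap hp]

-- The bad vertices are those at the ordinate `-σ * H`, one before each group. The final vertex has
-- its own ordinate `-σ * (2 * H)` in order not to be counted.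
open Classical in
theorem length_filter_zigzag {bad : Plane → Prop} (hbad : ∀ x, bad (shearPoint ε x (-σ * H)))
    (hbad' : ∀ x, ¬ bad (shearPoint ε x (-σ * (2 * H)))) : ∀ {gs : List (List Plane)} {x : ℝ},
    (∀ g ∈ gs, ∀ p ∈ g, ¬ bad p) →
    ((zigzag ε σ H δ x gs).filter fun p => bad p).length = gs.length
  | [], x, h => by rw [zigzag, List.filter_cons_of_neg (by simpa using hbad' x)]; simp
  | g :: gs, x, h => by
    have hg : (g.filter fun p => bad p) = [] := by
      rw [List.filter_eq_nil_iff]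
      intro p hp
      simpa using h g (by simp) p hp
    rw [zigzag, List.filter_cons_of_pos (by simpa using hbad x), List.filter_append, hg]
    simp [length_filter_zigzag hbad hbad' fun a ha => h a (List.mem_cons_of_mem _ ha)]

/-- The part of the plane that contains the zigzag path. -/
def zigzagRegion (ε σ δ M : ℝ) (gs : List (List Plane)) : Set Plane :=
  {z | σ * z 1 ≤ M ∧ (σ * z 1 < -M ∨
    ∃ g ∈ gs, ∃ a ∈ g, ∃ b ∈ g, shear ε a - δ < shear ε z ∧ shear ε z < shear ε b + δ)}

theorem sign_mul_le (hσ : σ = 1 ∨ σ = -1) {y : ℝ} (h : |y| ≤ M) : -M ≤ σ * y ∧ σ * y ≤ M := by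
  have := abs_le.1 h
  rcases hσ with rfl | rfl <;> constructor <;> linarith

/-- Here `H` is so large that even over the greatest horizontal distance `W` the segment is steep:
at distance `δ` or more before `a` it is still below `-M`, outside the strip of the given points. -/
theorem segment_up_subset (hσ : σ = 1 ∨ σ = -1) (hδ : 0 < δ) (hM : 0 ≤ M) (h2 : 2 * M < H)
    (hH : 2 * M * W < δ * H)
    {v a : Plane} (hv : σ * v 1 ≤ -H) (ha : |a 1| ≤ M) (hl : shear ε v ≤ shear ε a)
    (hr : shear ε a ≤ shear ε v + W) (hg : g ∈ gs) (hag : a ∈ g) :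
    segment ℝ v a ⊆ zigzagRegion ε σ δ M gs := by
  intro z hz
  obtain ⟨t, h0, h1, hx, hy, -⟩ := exists_shear_of_mem_segment ε hz
  obtain ⟨ha1, ha2⟩ := sign_mul_le hσ ha
  have hy' : σ * z 1 = (1 - t) * (σ * v 1) + t * (σ * a 1) := by rw [hy]; ring
  refine ⟨by rw [hy']; nlinarith, ?_⟩
  by_cases h : shear ε a - δ < shear ε z
  · exact Or.inr ⟨g, hg, a, hag, a, hag, h, by rw [hx]; nlinarith⟩
  left
  rw [hx] at h
  have h3 : δ ≤ (1 - t) * W := by nlinarith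
  have h4 : 2 * M < (1 - t) * H := by
    have hH0 : 0 < H := by linarith
    have hW : 0 < W := by
      by_contra! hW
      nlinarith
    have : 2 * M * W < (1 - t) * H * W := by nlinarith
    exact lt_of_mul_lt_mul_right this hW.le
  rw [hy']
  nlinarith

/-- The descent takes place entirely within distance `δ` of the last point of the group. -/
theorem segment_down_subset (hσ : σ = 1 ∨ σ = -1) (hδ : 0 < δ) (hM : 0 ≤ M) (h2 : 2 * M < H)
    {v a : Plane} (hv : σ * v 1 ≤ -H) (ha : |a 1| ≤ M) (hva : shear ε v = shear ε a + δ)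
    (hg : g ∈ gs) (hag : a ∈ g) : segment ℝ a v ⊆ zigzagRegion ε σ δ M gs := by
  intro z hz
  obtain ⟨t, h0, h1, hx, hy, -, ht⟩ := exists_shear_of_mem_segment ε hz
  obtain ⟨ha1, ha2⟩ := sign_mul_le hσ ha
  have hy' : σ * z 1 = (1 - t) * (σ * a 1) + t * (σ * v 1) := by rw [hy]; ring
  refine ⟨by rw [hy']; nlinarith, ?_⟩
  rcases h1.eq_or_lt with rfl | h1
  · left; rw [ht rfl]; linarith
  · exact Or.inr ⟨g, hg, a, hag, a, hag, by rw [hx, hva]; nlinarith, by rw [hx, hva]; nlinarith⟩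

theorem segment_group_subset (hσ : σ = 1 ∨ σ = -1) (hδ : 0 < δ)
    {a b : Plane} (ha : |a 1| ≤ M) (hb : |b 1| ≤ M) (hab : shear ε a ≤ shear ε b)
    (hg : g ∈ gs) (hag : a ∈ g) (hbg : b ∈ g) : segment ℝ a b ⊆ zigzagRegion ε σ δ M gs := by
  intro z hz
  obtain ⟨t, h0, h1, hx, hy, -⟩ := exists_shear_of_mem_segment ε hz
  obtain ⟨ha1, ha2⟩ := sign_mul_le hσ ha
  obtain ⟨hb1, hb2⟩ := sign_mul_le hσ hb
  have hy' : σ * z 1 = (1 - t) * (σ * a 1) + t * (σ * b 1) := by rw [hy]; ring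
  exact ⟨by rw [hy']; nlinarith,
    Or.inr ⟨g, hg, a, hag, b, hbg, by rw [hx]; nlinarith, by rw [hx]; nlinarith⟩⟩

theorem sign_mul_shearPoint (hσ : σ = 1 ∨ σ = -1) (y : ℝ) :
    σ * shearPoint ε x (-σ * y) 1 = -y := by
  rw [shearPoint_one]
  rcases hσ with rfl | rfl <;> ring

theorem zigzagRegion_mono (g : List Plane) :
    zigzagRegion ε σ δ M gs ⊆ zigzagRegion ε σ δ M (g :: gs) := by
  rintro z ⟨h, h'⟩
  refine ⟨h, h'.imp id ?_⟩
  rintro ⟨g', hg', h'⟩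
  exact ⟨g', List.mem_cons_of_mem _ hg', h'⟩

theorem pathSet_zigzag_subset (hσ : σ = 1 ∨ σ = -1) (hδ : 0 < δ) (hM : 0 ≤ M) (h2 : 2 * M < H)
    (hH : 2 * M * W < δ * H) : ∀ {gs : List (List Plane)} {x : ℝ},
    Fits ε σ H δ M W x gs → pathSet (zigzag ε σ H δ x gs) ⊆ zigzagRegion ε σ δ M gs
  | [], x, h => by
    have := sign_mul_shearPoint (ε := ε) (x := x) hσ (2 * H)
    rintro z rfl
    exact ⟨by linarith, Or.inl (by linarith)⟩
  | g :: gs, x, h => by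
    have ih := (pathSet_zigzag_subset hσ hδ hM h2 hH (h.tail hδ)).trans (zigzagRegion_mono g)
    have hb := h.bound g (by simp)
    have hl := h.left g (by simp)
    have hr := h.right g (by simp)
    have hgap := h.gap g (by simp)
    have hm : g ∈ g :: gs := by simp
    have hv := sign_mul_shearPoint (ε := ε) (x := x) hσ H
    obtain ⟨y, t, hz, hy⟩ := zigzag_eq_cons ε σ H δ (shear ε (g.getLastD 0) + δ) gs
    have hv' := sign_mul_shearPoint (ε := ε) (x := shear ε (g.getLastD 0) + δ) hσ y
    have hyH : -y ≤ -H := by rcases hy with rfl | ⟨rfl, -⟩ <;> linarith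
    rw [zigzag, hz]
    rw [hz] at ih
    have hup : ∀ a ∈ g, segment ℝ (shearPoint ε x (-σ * H)) a ⊆
        zigzagRegion ε σ δ M (g :: gs) := fun a ha =>
      segment_up_subset hσ hδ hM h2 hH hv.le (hb a ha)
        (by rw [shear_shearPoint]; linarith [hl a ha]) (by simpa using hr a ha) hm ha
    have hdown := segment_down_subset (ε := ε) hσ hδ hM h2 (hv'.le.trans hyH)
      (hb _ (h.isGroup g hm).getLastD_mem) (by simp) hm (h.isGroup g hm).getLastD_mem
    rcases h.isGroup g hm with ⟨a, rfl⟩ | ⟨a, b, rfl⟩ | ⟨a, b, c, rfl⟩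
    · exact Set.union_subset (hup a (by simp)) (Set.union_subset hdown ih)
    · simp at hgap
      exact Set.union_subset (hup a (by simp)) (Set.union_subset
        (segment_group_subset hσ hδ (hb a (by simp)) (hb b (by simp)) (by linarith) hm (by simp)
          (by simp)) (Set.union_subset hdown ih))
    · simp at hgap
      exact Set.union_subset (hup a (by simp)) (Set.union_subset
        (segment_group_subset hσ hδ (hb a (by simp)) (hb b (by simp)) (by linarith) hm (by simp)
          (by simp)) (Set.union_subset
        (segment_group_subset hσ hδ (hb b (by simp)) (hb c (by simp)) (by linarith) hm (by simp)
          (by simp)) (Set.union_subset hdown ih)))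

theorem mul_wedge_eq (ε σ : ℝ) (p q r : Plane) : σ * wedge (q - p) (r - q) =
    (shear ε q - shear ε p) * (σ * r 1 - σ * q 1) -
      (σ * q 1 - σ * p 1) * (shear ε r - shear ε q) := by
  rw [wedge_eq_shear ε, shear_sub, shear_sub, PiLp.sub_apply, PiLp.sub_apply]; ring

/-- The ascent is steeper than any segment within a group: it rises by at least `H / 2` over at most
`W`, against at most `2 * M` over at least `2 * δ`. -/
theorem turn_up (hσ : σ = 1 ∨ σ = -1) (hδ : 0 < δ) (hM : 0 ≤ M) (h2 : 2 * M < H)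
    (hH : 2 * M * W < δ * H) {p q r : Plane} (hp : σ * p 1 = -H) (hq : |q 1| ≤ M) (hr : |r 1| ≤ M)
    (hl : shear ε p ≤ shear ε q) (hW : shear ε q ≤ shear ε p + W)
    (hqr : shear ε q + 2 * δ ≤ shear ε r) : σ * wedge (q - p) (r - q) ≤ 0 := by
  obtain ⟨hq1, hq2⟩ := sign_mul_le hσ hq
  obtain ⟨hr1, hr2⟩ := sign_mul_le hσ hr
  rw [mul_wedge_eq ε, hp]
  have h3 : (shear ε q - shear ε p) * (σ * r 1 - σ * q 1) ≤ W * (2 * M) :=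
    (mul_le_mul_of_nonneg_left (by linarith) (by linarith)).trans
      (mul_le_mul_of_nonneg_right (by linarith) (by linarith))
  have h4 : H / 2 * (2 * δ) ≤ (σ * q 1 - -H) * (shear ε r - shear ε q) :=
    mul_le_mul (by linarith) (by linarith) (by linarith) (by linarith)
  linarith

theorem turn_top (hσ : σ = 1 ∨ σ = -1) (h2 : 2 * M < H) {p q r : Plane}
    (hp : σ * p 1 ≤ -H) (hq : |q 1| ≤ M) (hr : σ * r 1 ≤ -H) (hM : 0 ≤ M)
    (hl : shear ε p ≤ shear ε q) (hqr : shear ε q ≤ shear ε r) :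
    σ * wedge (q - p) (r - q) ≤ 0 := by
  obtain ⟨hq1, hq2⟩ := sign_mul_le hσ hq
  rw [mul_wedge_eq ε]
  nlinarith

/-- The descent by at least `H / 2` over `δ` is steeper than any descent within a group, by at most
`2 * M` over at least `2 * δ`. -/
theorem turn_down (hσ : σ = 1 ∨ σ = -1) (hδ : 0 < δ) (hM : 0 ≤ M) (h2 : 2 * M < H)
    {p q r : Plane} (hp : |p 1| ≤ M) (hq : |q 1| ≤ M) (hr : σ * r 1 ≤ -H)
    (hpq : shear ε p + 2 * δ ≤ shear ε q) (hqr : shear ε r = shear ε q + δ) :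
    σ * wedge (q - p) (r - q) ≤ 0 := by
  obtain ⟨hq1, hq2⟩ := sign_mul_le hσ hq
  obtain ⟨hp1, hp2⟩ := sign_mul_le hσ hp
  rw [mul_wedge_eq ε, hqr]
  have h3 : 2 * δ * (H / 2) ≤ (shear ε q - shear ε p) * (σ * q 1 - σ * r 1) :=
    mul_le_mul (by linarith) (by linarith) (by linarith) (by linarith)
  nlinarith

/-- The preceding point `p` is arbitrary because the zigzag starts with a bad vertex or consists of
its end alone; this lets the induction pass from group to group. -/
theorem turns_cons_zigzag (hσ : σ = 1 ∨ σ = -1) (hδ : 0 < δ) (hM : 0 ≤ M) (h2 : 2 * M < H)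
    (hH : 2 * M * W < δ * H) {bad : Plane → Prop} (hbad : ∀ x, bad (shearPoint ε x (-σ * H))) :
    ∀ {gs : List (List Plane)} {x : ℝ}, Fits ε σ H δ M W x gs → ∀ p : Plane,
      Turns σ bad (p :: zigzag ε σ H δ x gs)
  | [], _, _, _ => trivial
  | g :: gs, x, h, p => by
    have ih := turns_cons_zigzag hσ hδ hM h2 hH hbad (h.tail hδ)
    have hb := h.bound g (by simp)
    have hl := h.left g (by simp)
    have hr := h.right g (by simp)
    have hgap := h.gap g (by simp)
    have ht := h.turns g (by simp)
    have hm : g ∈ g :: gs := by simp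
    have hv := sign_mul_shearPoint (ε := ε) (x := x) hσ H
    have hx : shear ε (shearPoint ε x (-σ * H)) = x := by simp
    obtain ⟨y, t, hz, hy⟩ := zigzag_eq_cons ε σ H δ (shear ε (g.getLastD 0) + δ) gs
    have hv' := sign_mul_shearPoint (ε := ε) (x := shear ε (g.getLastD 0) + δ) hσ y
    have hx' : shear ε (shearPoint ε (shear ε (g.getLastD 0) + δ) (-σ * y)) =
      shear ε (g.getLastD 0) + δ := by simp
    have hyH : -y ≤ -H := by rcases hy with rfl | ⟨rfl, -⟩ <;> linarith
    rw [zigzag, hz]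
    rw [hz] at ih
    rcases h.isGroup g hm with ⟨a, rfl⟩ | ⟨a, b, rfl⟩ | ⟨a, b, c, rfl⟩
    · have ha := hl a (by simp)
      refine ⟨fun hn => (hn (hbad x)).elim, fun _ => ?_, ih a⟩
      exact turn_top (ε := ε) hσ h2 hv.le (hb a (by simp)) (hv'.le.trans hyH) hM
        (by linarith) (by rw [hx']; simp [hδ.le])
    · have ha := hl a (by simp)
      have ha' := hr a (by simp)
      simp at hgap
      refine ⟨fun hn => (hn (hbad x)).elim, fun _ => ?_, fun _ => ?_, ih b⟩
      · exact turn_up (ε := ε) hσ hδ hM h2 hH hv (hb a (by simp)) (hb b (by simp))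
          (by linarith) (by linarith) hgap
      · exact turn_down (ε := ε) hσ hδ hM h2 (hb a (by simp)) (hb b (by simp)) (hv'.le.trans hyH)
          hgap (by rw [hx']; simp)
    · have ha := hl a (by simp)
      have ha' := hr a (by simp)
      simp at hgap
      refine ⟨fun hn => (hn (hbad x)).elim, fun _ => ?_, fun _ => ht.1 id, fun _ => ?_, ih c⟩
      · exact turn_up (ε := ε) hσ hδ hM h2 hH hv (hb a (by simp)) (hb b (by simp))
          (by linarith) (by linarith) hgap.1.1
      · exact turn_down (ε := ε) hσ hδ hM h2 (hb b (by simp)) (hb c (by simp)) (hv'.le.trans hyH)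
          hgap.2 (by rw [hx']; simp)

end zigzag

/-! ### The upper bound: assembling the polygon -/

theorem exists_shear_injOn (S : Finset Plane) : ∃ ε : ℝ, Set.InjOn (shear ε) (S : Set Plane) := by
  classical
  obtain ⟨ε, hε⟩ := Infinite.exists_notMem_finset
    ((S ×ˢ S).image fun a : Plane × Plane => -(a.1 0 - a.2 0) / (a.1 1 - a.2 1))
  refine ⟨ε, fun p hp q hq h => ?_⟩
  by_cases h1 : p 1 = q 1
  · exact shear_ext h h1
  · refine (hε (Finset.mem_image.2 ⟨(p, q), Finset.mem_product.2 ⟨hp, hq⟩, ?_⟩)).elim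
    simp only [shear] at h
    rw [div_eq_iff (sub_ne_zero.2 h1)]
    linarith

theorem exists_shearSorted {ε : ℝ} (S : Finset Plane) : Set.InjOn (shear ε) (S : Set Plane) →
    ∃ l : List Plane, ShearSorted ε l ∧ l.length = S.card ∧ ∀ p, p ∈ l ↔ p ∈ S := by
  classical
  refine Finset.induction_on_max_value (shear ε) S (fun _ => ⟨[], by simp⟩) ?_
  intro a s ha hmax ih hinj
  obtain ⟨l, hl, hlen, hmem⟩ := ih (hinj.mono (by simp))
  refine ⟨l ++ [a], List.pairwise_append.2 ⟨hl, by simp, ?_⟩, by simp [hlen, ha], ?_⟩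
  · intro p hp q hq
    obtain rfl : q = a := by simpa using hq
    have hps := (hmem p).1 hp
    refine lt_of_le_of_ne (hmax p hps) fun e => ?_
    rw [hinj (by simp [hps]) (by simp) e] at hps
    exact ha hps
  · intro p
    simp [hmem, or_comm]

theorem exists_gap (ε : ℝ) (S : Finset Plane) : ∃ δ : ℝ, 0 < δ ∧ ∀ p ∈ S, ∀ q ∈ S,
    shear ε p < shear ε q → shear ε p + 2 * δ ≤ shear ε q := by
  have h : ∀ᶠ δ : ℝ in 𝓝[>] 0, ∀ p ∈ S, ∀ q ∈ S,
      shear ε p < shear ε q → shear ε p + 2 * δ ≤ shear ε q := by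
    rw [Filter.eventually_all_finset]
    intro p _
    rw [Filter.eventually_all_finset]
    intro q _
    by_cases hpq : shear ε p < shear ε q
    · filter_upwards [Ioo_mem_nhdsGT (show (0 : ℝ) < (shear ε q - shear ε p) / 2 by linarith)]
        with δ hδ _
      linarith [hδ.2]
    · exact Filter.Eventually.of_forall fun _ h => (hpq h).elim
  obtain ⟨δ, h, hδ⟩ := (h.and self_mem_nhdsWithin).exists
  exact ⟨δ, hδ, h⟩

/-- A point far to the left sees all points strictly between two ordinates within the angle of
two points with these ordinates. -/
theorem exists_apex (ε H a b : ℝ) (w : List Plane) : ∃ B : ℝ, ∀ p ∈ w,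
    (-H < p 1 → 0 < wedge (shearPoint ε a (-H) - shearPoint ε (-B) 0)
      (p - shearPoint ε (-B) 0)) ∧
    (p 1 < H → 0 < wedge (p - shearPoint ε (-B) 0)
      (shearPoint ε b H - shearPoint ε (-B) 0)) := by
  classical
  have key : ∀ c d : ℝ, 0 < c → ∀ᶠ B : ℝ in Filter.atTop, 0 < B * c + d := by
    intro c d hc
    filter_upwards [Filter.eventually_gt_atTop (-d / c)] with B hB
    rw [div_lt_iff₀ hc] at hB
    linarith
  have h : ∀ᶠ B : ℝ in Filter.atTop, ∀ p ∈ w.toFinset,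
    (-H < p 1 → 0 < wedge (shearPoint ε a (-H) - shearPoint ε (-B) 0)
      (p - shearPoint ε (-B) 0)) ∧
    (p 1 < H → 0 < wedge (p - shearPoint ε (-B) 0)
      (shearPoint ε b H - shearPoint ε (-B) 0)) := by
    rw [Filter.eventually_all_finset]
    intro p _
    refine Filter.Eventually.and ?_ ?_
    · by_cases hp : -H < p 1
      -- Each of the two cross products is affine in `B`, with the positive slope `p 1 + H` or `H -
      -- p 1`.
      · filter_upwards [key (p 1 + H) (a * p 1 + H * shear ε p) (by linarith)] with B hB _
        rw [wedge_eq_shear ε]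
        simp only [shear_sub, shear_shearPoint, PiLp.sub_apply, shearPoint_one]
        linarith
      · exact Filter.Eventually.of_forall fun _ h => (hp h).elim
    · by_cases hp : p 1 < H
      · filter_upwards [key (H - p 1) (shear ε p * H - p 1 * b) (by linarith)] with B hB _
        rw [wedge_eq_shear ε]
        simp only [shear_sub, shear_shearPoint, PiLp.sub_apply, shearPoint_one]
        linarith
      · exact Filter.Eventually.of_forall fun _ h => (hp h).elim
  obtain ⟨B, hB⟩ := h.exists
  exact ⟨B, fun p hp => hB p (List.mem_toFinset.2 hp)⟩

theorem turnsLeft_reverseAux_cons {bad : Plane → Prop} {c d : Plane} {l m : List Plane}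
    (hl : Turns 1 bad (c :: l)) (hm : Turns (-1) bad (c :: d :: m)) (hc : bad c ∨ l = []) :
    TurnsLeft bad (l.reverseAux (c :: d :: m)) := by
  cases l with
  | nil => exact hm.turnsLeft
  | cons q t =>
    refine turnsLeft_reverseAux (t := t) (c := c) (q := q) (acc := d :: m) hl
      ⟨fun h => ?_, hm.turnsLeft⟩
    simp at hc
    exact (h hc).elim

/-- A common point has ordinate in `[-M, M]`, so it would be within `δ` of the range of a group of
each kind, and these ranges are `2 * δ` apart. -/
theorem disjoint_zigzagRegion {ε δ M : ℝ} {gs hs : List (List Plane)}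
    (h : ∀ g ∈ gs, ∀ g' ∈ hs, (∀ p ∈ g, ∀ q ∈ g', shear ε p + 2 * δ ≤ shear ε q) ∨
      ∀ p ∈ g', ∀ q ∈ g, shear ε p + 2 * δ ≤ shear ε q) :
    Disjoint (zigzagRegion ε 1 δ M gs) (zigzagRegion ε (-1) δ M hs) := by
  rw [Set.disjoint_left]
  rintro z ⟨h1, h2⟩ ⟨h3, h4⟩
  rcases h2 with h2 | ⟨g, hg, a, ha, b, hb, h2, h2'⟩
  · linarith
  rcases h4 with h4 | ⟨g', hg', a', ha', b', hb', h4, h4'⟩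
  · linarith
  rcases h g hg g' hg' with h | h
  · linarith [h b hb a' ha']
  · linarith [h b' hb' a ha]

/-- The lower path is run from right to left, then the upper one from left to right, and a far left
apex closes the polygon. The extreme ordinates `-2 H` and `2 H` of the two ends make them the
extreme directions seen from the apex. -/
theorem exists_simplePolygon_of_fits {ε H δ M W x : ℝ} (hδ : 0 < δ) (hM : 0 ≤ M) (h2 : 2 * M < H)
    (hH : 2 * M * W < δ * H) {gs hs : List (List Plane)} (hgs : Fits ε 1 H δ M W x gs)
    (hhs : Fits ε (-1) H δ M W x hs)
    (h : ∀ g ∈ gs, ∀ g' ∈ hs, (∀ p ∈ g, ∀ q ∈ g', shear ε p + 2 * δ ≤ shear ε q) ∨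
      ∀ p ∈ g', ∀ q ∈ g, shear ε p + 2 * δ ≤ shear ε q) :
    ∃ P : SimplePolygon, (∀ g, g ∈ gs ∨ g ∈ hs → ∀ p ∈ g, p ∈ P.vertexSet) ∧
      P.reflexCount ≤ gs.length + hs.length := by
  classical
  set bad : Plane → Prop := fun p => |p 1| = H with hbad_def
  have hH0 : 0 < H := by linarith
  have hbad : ∀ x, bad (shearPoint ε x (-1 * H)) ∧ bad (shearPoint ε x (-(-1) * H)) := by
    intro x
    simp only [hbad_def, shearPoint_one]
    exact ⟨by rw [neg_one_mul, abs_neg, abs_of_pos hH0], by rw [neg_neg, one_mul, abs_of_pos hH0]⟩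
  have hbad' : ∀ x, ¬ bad (shearPoint ε x (-1 * (2 * H))) ∧
      ¬ bad (shearPoint ε x (-(-1) * (2 * H))) := by
    intro x
    simp only [hbad_def, shearPoint_one]
    refine ⟨?_, ?_⟩
    · rw [neg_one_mul, abs_neg, abs_of_pos (by linarith)]; linarith
    · rw [neg_neg, one_mul, abs_of_pos (by linarith)]; linarith
  have hnb : ∀ p : Plane, |p 1| ≤ M → ¬ bad p := fun p hp hb => by
    have hb : |p 1| = H := hb
    linarith
  have hle := length_filter_zigzag (ε := ε) (δ := δ) (fun x => (hbad x).1) (fun x => (hbad' x).1)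
    (gs := gs) (x := x) fun g hg p hp => hnb p (hgs.bound g hg p hp)
  have hue := length_filter_zigzag (ε := ε) (δ := δ) (fun x => (hbad x).2) (fun x => (hbad' x).2)
    (gs := hs) (x := x) fun g hg p hp => hnb p (hhs.bound g hg p hp)
  obtain ⟨t, a, hta, ht⟩ := zigzag_eq_append ε 1 H δ gs x
  obtain ⟨s, b, hsb, hs'⟩ := zigzag_eq_append ε (-1) H δ hs x
  have hL := shearSorted_zigzag hδ hgs
  have hU := shearSorted_zigzag hδ hhs
  have hdisj := (disjoint_zigzagRegion (M := M) h).mono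
    (pathSet_zigzag_subset (.inl rfl) hδ hM h2 hH hgs)
    (pathSet_zigzag_subset (.inr rfl) hδ hM h2 hH hhs)
  have htL := (turns_cons_zigzag (.inl rfl) hδ hM h2 hH (fun x => (hbad x).1) hgs 0).of_cons
  have htU := turns_cons_zigzag (.inr rfl) hδ hM h2 hH (fun x => (hbad x).2) hhs
  set L := zigzag ε 1 H δ x gs with hLdef
  set U := zigzag ε (-1) H δ x hs with hUdef
  obtain ⟨y, l, hl, hy⟩ := zigzag_eq_cons ε 1 H δ x gs
  obtain ⟨y', u, hu, -⟩ := zigzag_eq_cons ε (-1) H δ x hs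
  have hw : l.reverseAux (shearPoint ε x (-1 * y) :: U) = L.reverse ++ U := by
    rw [List.reverseAux_eq, hLdef, hl]; simp
  have hsimple : IsSimplePath (L.reverse ++ U) := by
    rw [← hw]
    rw [← hLdef, ← hUdef] at *
    rw [hu] at hU hdisj ⊢
    rw [hl] at hL hdisj
    exact isSimplePath_reverse_append hL hU (by simp) hdisj
  have hturn : TurnsLeft bad (L.reverse ++ U) := by
    rw [← hw]
    have := htU (shearPoint ε x (-1 * y))
    rw [← hUdef] at hu
    rw [← hLdef] at hl
    rw [hu] at this ⊢
    rw [hl] at htL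
    refine turnsLeft_reverseAux_cons htL this ?_
    rcases hy with rfl | ⟨-, rfl⟩
    · exact Or.inl (hbad x).1
    · exact Or.inr rfl
  have hw' : L.reverse ++ U = shearPoint ε a (-(2 * H)) :: (t.reverse ++ (s ++
      [shearPoint ε b (2 * H)])) := by
    rw [hta, hsb]; simp
  have hord : ∀ p, p ∈ t ∨ p ∈ s → |p 1| ≤ H := by
    rintro p (hp | hp)
    · rcases ht p hp with h | ⟨g, hg, hp⟩
      · rw [h, neg_one_mul, abs_neg, abs_of_pos hH0]
      · linarith [hgs.bound g hg p hp]
    · rcases hs' p hp with h | ⟨g, hg, hp⟩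
      · rw [h, neg_neg, one_mul, abs_of_pos hH0]
      · linarith [hhs.bound g hg p hp]
  obtain ⟨B, hB⟩ := exists_apex ε (2 * H) a b (L.reverse ++ U)
  have hlen : (L.reverse ++ U).length = (t.length + s.length) + 2 := by
    rw [hw']; simp; omega
  have hlast : (L.reverse ++ U).getD (t.length + s.length + 1) 0 = shearPoint ε b (2 * H) := by
    rw [hw', List.getD_cons_succ, ← List.append_assoc, List.getD_append_right _ _ _ _ (by simp)]
    simp
  have hmem : ∀ p ∈ L.reverse ++ U, p = shearPoint ε a (-(2 * H)) ∨
      p = shearPoint ε b (2 * H) ∨ |p 1| ≤ H := by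
    intro p hp
    rw [hw'] at hp
    simp only [List.mem_cons, List.mem_append, List.mem_reverse, List.not_mem_nil, or_false] at hp
    rcases hp with hp | hp | hp | hp
    · exact Or.inl hp
    · exact Or.inr (Or.inr (hord p (Or.inl hp)))
    · exact Or.inr (Or.inr (hord p (Or.inr hp)))
    · exact Or.inr (Or.inl hp)
  have hfirst : (L.reverse ++ U).getD 0 0 = shearPoint ε a (-(2 * H)) := by
    rw [hw', List.getD_cons_zero]
  obtain ⟨P, hP, hcount⟩ := exists_simplePolygon_of_apex (bad := bad) (Z := shearPoint ε (-B) 0)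
    hlen hsimple (fun p hp => by
      rw [hfirst]
      rcases hmem p hp with h | h | h
      · exact Or.inl h
      · exact Or.inr ((hB p hp).1 (by rw [h, shearPoint_one]; linarith))
      · exact Or.inr ((hB p hp).1 (by linarith [(abs_le.1 h).1])))
    (fun p hp => by
      rw [hlast]
      rcases hmem p hp with h | h | h
      · exact Or.inr ((hB p hp).2 (by rw [h, shearPoint_one]; linarith))
      · exact Or.inl h
      · exact Or.inr ((hB p hp).2 (by linarith [(abs_le.1 h).2]))) hturn
  refine ⟨P, ?_, hcount.trans (le_of_eq ?_)⟩
  · rintro g (hg | hg) p hp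
    · exact hP p (List.mem_append.2 (Or.inl (List.mem_reverse.2 (mem_zigzag _ _ _ _ hp _ _ hg))))
    · exact hP p (List.mem_append.2 (Or.inr (mem_zigzag _ _ _ _ hp _ _ hg)))
  · rw [List.filter_append, List.filter_reverse, List.length_append, List.length_reverse]
    convert congrArg₂ (· + ·) hle hue

/-- Every finite set of points is contained in the vertex set of a simple polygon that has at most
one reflex vertex for every three points. -/
theorem exists_simplePolygon_reflexCount_le (S : Finset Plane) : ∃ P : SimplePolygon,
    (S : Set Plane) ⊆ P.vertexSet ∧ 3 * P.reflexCount ≤ S.card + 2 := by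
  classical
  obtain ⟨ε, hε⟩ := exists_shear_injOn S
  obtain ⟨l, hl, hlen, hmem⟩ := exists_shearSorted S hε
  obtain ⟨δ, hδ, hgap⟩ := exists_gap ε S
  obtain ⟨gs, hgs, hgl, hgr⟩ := exists_groups l
  have hpw : gs.flatten.Pairwise fun p q => shear ε p + 2 * δ ≤ shear ε q := by
    rw [hgs]
    exact hl.imp_of_mem fun ha hb hab => hgap _ ((hmem _).1 ha) _ ((hmem _).1 hb) hab
  obtain ⟨hpw1, hpw2⟩ := List.pairwise_flatten.1 hpw
  have hS : ∀ g ∈ gs, ∀ p ∈ g, p ∈ S := fun g hg p hp =>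
    (hmem p).1 (hgs ▸ List.mem_flatten.2 ⟨g, hg, hp⟩)
  set M : ℝ := ∑ p ∈ S, |p 1|
  set C : ℝ := ∑ p ∈ S, |shear ε p|
  have hM0 : 0 ≤ M := Finset.sum_nonneg fun _ _ => abs_nonneg _
  have hM : ∀ p ∈ S, |p 1| ≤ M := fun p hp =>
    Finset.single_le_sum (f := fun p : Plane => |p 1|) (fun _ _ => abs_nonneg _) hp
  have hC : ∀ p ∈ S, |shear ε p| ≤ C := fun p hp =>
    Finset.single_le_sum (f := fun p : Plane => |shear ε p|) (fun _ _ => abs_nonneg _) hp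
  have hC0 : 0 ≤ C := Finset.sum_nonneg fun _ _ => abs_nonneg _
  set W : ℝ := 2 * C + δ
  -- All abscissas are in `[-C, C]`; a start at `-C - δ` therefore allows the width `2 * C + δ`. The
  -- summands of `H` provide `2 * M < H` and `2 * M * W < δ * H`.
  set H : ℝ := 2 * M + 2 * M * W / δ + 1
  have hq : 0 ≤ 2 * M * W / δ := by positivity
  have hH : 2 * M * W < δ * H := by
    have : δ * (2 * M * W / δ) = 2 * M * W := by field_simp
    have h0 : 0 ≤ δ * (2 * M) := by positivity
    calc 2 * M * W < δ * (2 * M) + δ * (2 * M * W / δ) + δ := by linarith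
      _ = δ * H := by ring
  have fits : ∀ σ : ℝ, ∀ hs : List (List Plane), hs.Sublist gs →
      (∀ g ∈ hs, Turns σ (fun _ => False) g) → Fits ε σ H δ M W (-C - δ) hs := by
    intro σ hs hsub ht
    exact {
      isGroup := fun g hg => hgr g (hsub.subset hg)
      turns := ht
      gap := fun g hg => hpw1 g (hsub.subset hg)
      gaps := hpw2.sublist hsub
      bound := fun g hg p hp => hM p (hS g (hsub.subset hg) p hp)
      left := fun g hg p hp => by
        have := abs_le.1 (hC p (hS g (hsub.subset hg) p hp))
        linarith
      right := fun g hg p hp => by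
        have := abs_le.1 (hC p (hS g (hsub.subset hg) p hp))
        linarith }
  -- A group without a proper turn counts as a cap, so each group is visited by exactly one of the
  -- paths.
  set caps := gs.filter fun g => Turns 1 (fun _ => False) g
  set cups := gs.filter fun g => ¬ Turns 1 (fun _ => False) g
  have hsep : ∀ g ∈ gs, ∀ g' ∈ gs, g ≠ g' →
      (∀ p ∈ g, ∀ q ∈ g', shear ε p + 2 * δ ≤ shear ε q) ∨
      ∀ p ∈ g', ∀ q ∈ g, shear ε p + 2 * δ ≤ shear ε q := by
    refine fun g hg g' hg' hne => List.Pairwise.forall_of_forall_of_flip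
      (R := fun g g' => g ≠ g' → (∀ p ∈ g, ∀ q ∈ g', shear ε p + 2 * δ ≤ shear ε q) ∨
        ∀ p ∈ g', ∀ q ∈ g, shear ε p + 2 * δ ≤ shear ε q) ?_ ?_ ?_ hg hg' hne
    · exact fun g _ h => (h rfl).elim
    · exact hpw2.imp fun h _ => Or.inl h
    · exact hpw2.imp fun h _ => Or.inr h
  obtain ⟨P, hP, hcount⟩ := exists_simplePolygon_of_fits hδ hM0 (by linarith) hH
    (fits 1 caps List.filter_sublist fun g hg => by simpa using (List.mem_filter.1 hg).2)
    (fits (-1) cups List.filter_sublist fun g hg =>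
      ((hgr g (List.mem_filter.1 hg).1).turns).resolve_left (by
        simpa using (List.mem_filter.1 hg).2))
    (fun g hg g' hg' => hsep g (List.mem_filter.1 hg).1 g' (List.mem_filter.1 hg').1 (by
      rintro rfl
      have h1 := (List.mem_filter.1 hg).2
      have h2 := (List.mem_filter.1 hg').2
      simp at h1 h2
      exact h2 h1))
  refine ⟨P, fun p hp => ?_, ?_⟩
  · have : p ∈ gs.flatten := hgs ▸ (hmem p).2 hp
    obtain ⟨g, hg, hpg⟩ := List.mem_flatten.1 this
    refine hP g ?_ p hpg
    by_cases ht : Turns 1 (fun _ => False) g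
    · exact Or.inl (List.mem_filter.2 ⟨hg, by simpa using ht⟩)
    · exact Or.inr (List.mem_filter.2 ⟨hg, by simpa using ht⟩)
  · have : caps.length + cups.length = gs.length := by
      have := List.length_eq_length_filter_add (l := gs) fun g => Turns 1 (fun _ => False) g
      simpa [caps, cups] using this.symm
    omega

/-! ### Existence of the extrema and the two bounds -/

theorem isLeast_steinerReflexivity (S : Finset Plane) :
    IsLeast (steinerReflexCounts S) (steinerReflexivity S) := by
  obtain ⟨P, hP, -⟩ := exists_simplePolygon_reflexCount_le S
  exact ⟨Nat.sInf_mem ⟨_, P, hP, rfl⟩, fun _ h => Nat.sInf_le h⟩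

theorem steinerReflexivity_le (S : Finset Plane) : 3 * steinerReflexivity S ≤ S.card + 2 := by
  obtain ⟨P, hP, h⟩ := exists_simplePolygon_reflexCount_le S
  have := (isLeast_steinerReflexivity S).2 ⟨P, hP, rfl⟩
  omega

instance : Infinite Plane := Module.Free.infinite ℝ Plane

theorem isGreatest_worstSteinerReflexivity (n : ℕ) :
    IsGreatest (steinerReflexivities n) (worstSteinerReflexivity n) := by
  obtain ⟨S, hS⟩ := Infinite.exists_subset_card_eq Plane n
  have hb : BddAbove (steinerReflexivities n) := by
    refine ⟨n + 2, ?_⟩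
    rintro _ ⟨S, hS, rfl⟩
    have := steinerReflexivity_le S
    omega
  exact ⟨Nat.sSup_mem ⟨_, S, hS, rfl⟩ hb, fun _ h => le_csSup hb h⟩

/-- Adding points to a set cannot lower its Steiner reflexivity, so the construction may be padded
to exactly `n` points. -/
theorem le_worstSteinerReflexivity {n k : ℕ} (hk : 1 ≤ k) (h : 4 * k + 2 ≤ n) :
    k ≤ worstSteinerReflexivity n := by
  obtain ⟨S, hS, hP⟩ := exists_finset_le_reflexCount hk
  obtain ⟨T, hST, hT⟩ := Infinite.exists_superset_card_eq S n (hS.trans h)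
  refine le_trans ?_ ((isGreatest_worstSteinerReflexivity n).2 ⟨T, hT, rfl⟩)
  obtain ⟨P, hPT, h⟩ := (isLeast_steinerReflexivity T).1
  rw [← h]
  exact hP P ((Finset.coe_subset.2 hST).trans hPT)

/-- The minimum and the maximum in the definition of the worst-case Steiner reflexivity are
attained, and its value lies between the two bounds. -/
theorem theorem4 (n : ℕ) :
    (∀ S : Finset Plane, S.card = n →
      IsLeast (steinerReflexCounts S) (steinerReflexivity S)) ∧
    IsGreatest (steinerReflexivities n) (worstSteinerReflexivity n) ∧
    ⌈((n : ℚ) - 1) / 4⌉ - 1 ≤ (worstSteinerReflexivity n : ℤ) ∧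
    (worstSteinerReflexivity n : ℤ) ≤ ⌈(n : ℚ) / 3⌉ := by
  refine ⟨fun S _ => isLeast_steinerReflexivity S, isGreatest_worstSteinerReflexivity n, ?_, ?_⟩
  · have h : (n - 2) / 4 ≤ worstSteinerReflexivity n := by
      rcases Nat.eq_zero_or_pos ((n - 2) / 4) with h | h
      · omega
      · exact le_worstSteinerReflexivity h (by omega)
    rw [sub_le_iff_le_add, Int.ceil_le, div_le_iff₀ (by norm_num)]
    have : n ≤ 4 * (worstSteinerReflexivity n + 1) + 1 := by omega
    have : (n : ℚ) ≤ 4 * (worstSteinerReflexivity n + 1) + 1 := by exact_mod_cast this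
    push_cast
    linarith
  · obtain ⟨S, hS, h⟩ := (isGreatest_worstSteinerReflexivity n).1
    have := steinerReflexivity_le S
    rw [hS, h] at this
    have : (3 * worstSteinerReflexivity n : ℚ) ≤ n + 2 := by exact_mod_cast this
    have h3 := Int.le_ceil ((n : ℚ) / 3)
    rw [div_le_iff₀ (by norm_num)] at h3
    have h4 : (3 * (worstSteinerReflexivity n : ℤ) : ℚ) ≤ ⌈(n : ℚ) / 3⌉ * 3 + 2 := by
      push_cast
      linarith
    have h5 : 3 * (worstSteinerReflexivity n : ℤ) ≤ ⌈(n : ℚ) / 3⌉ * 3 + 2 := by exact_mod_cast h4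
    omega
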